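/- Let $\mathfrak g$ be a finite-dimensional simple Lie algebra over $\mathbb C$ with Cartan subalgebra $\mathfrak h$, simple roots $\alpha_i$, simple coroots $h_i$ and fundamental weights $\omega_i$, where $i$ runs over the set $I$ of nodes of the Dynkin diagram. Let $P^+$ be the set of dominant integral weights and, for $\nu\in P^+$, let $V(\nu)$ be the finite-dimensional irreducible $\mathfrak g$-module of highest weight $\nu$. For $J\subseteq I$ put $\vartheta_J=\sum_{j\in J}\alpha_j$, and let $\overline J$ be the minimal connected subdiagram containing $J$ (so $\overline\emptyset=\emptyset$). Let $\partial I$ be the set of nodes connected to at most one other node, and let $\mathrm{supp}(\lambda)=\{i\in I:\lambda(h_i)\neq 0\}$. Let $\lambda\in P^+$ with $\mathrm{supp}(\lambda)\subseteq\partial I$, let $W=\bigotimes_{i\in\partial I}V(\lambda(h_i)\omega_i)$, and for $\mu\in P^+$ let $m_\mu(W)$ be the multiplicity of $V(\mu)$ in $W$. Suppose that $\mu\in P^+$ satisfies $\lambda-\mu=\sum_{i\in I}s_i\alpha_i$ with $s_i\in\mathbb Z$ and $s_i\le 1$ for all $i\in I$. Then $m_\mu(W)\neq 0$ if and only if $\mu=\lambda-\vartheta_{\overline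 S}$ for some $S\subseteq\mathrm{supp}(\lambda)$ with $\#S\neq 1$. Moreover, if $\mu=\lambda-\vartheta_{\overline S}$ for such an $S$, then $m_\mu(W)=1$ if $\#S<3$ and $m_\mu(W)=2$ if $\#S=3$. -/

import Mathlib

open scoped TensorProduct

noncomputable section

namespace OuterMult

/-! ### Tensor products of families of modules over a Lie algebra -/

section Tensor

attribute [local instance 100] LieRing.ofAssociativeRing

variable {κ R L : Type*} [CommRing R] [LieRing L] [LieAlgebra R L]
  {V : κ → Type*} [∀ i, AddCommGroup (V i)] [∀ i, Module R (V i)]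

open scoped Classical in
/-- The endomorphism `1 ⊗ ⋯ ⊗ f ⊗ ⋯ ⊗ 1` of `⨂ i, V i`, with `f` in position `i`. -/
def actAt (i : κ) : Module.End R (V i) →ₗ[R] Module.End R (⨂[R] i, V i) where
  toFun f := PiTensorProduct.map (Function.update (fun _ => LinearMap.id) i f)
  map_add' f g := PiTensorProduct.map_update_add _ i f g
  map_smul' c f := PiTensorProduct.map_update_smul _ i c f

open scoped Classical in
theorem actAt_tprod (i : κ) (f : Module.End R (V i)) (m : ∀ i, V i) :
    actAt i f (PiTensorProduct.tprod R m)
      = PiTensorProduct.tprod R (Function.update m i (f (m i))) := by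
  change PiTensorProduct.map _ _ = _
  rw [PiTensorProduct.map_tprod]
  congr 1
  funext j
  by_cases h : j = i
  · subst h; simp
  · simp [h]

theorem actAt_mul (i : κ) (f g : Module.End R (V i)) :
    actAt i (f * g) = actAt i f * actAt i g := by
  classical
  refine PiTensorProduct.ext ?_
  ext m
  simp [actAt_tprod]

theorem actAt_comm {i j : κ} (h : i ≠ j) (f : Module.End R (V i)) (g : Module.End R (V j)) :
    actAt i f * actAt j g = actAt j g * actAt i f := by
  classical
  refine PiTensorProduct.ext ?_
  ext m
  simp [actAt_tprod, h, h.symm, Function.update_comm h]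

variable [Fintype κ] [∀ i, LieRingModule L (V i)] [∀ i, LieModule R L (V i)]

variable (R L V) in
/-- The tensor product representation:
`x` acts on `⨂ i, V i` as `∑ i, 1 ⊗ ⋯ ⊗ x ⊗ ⋯ ⊗ 1`. -/
def tensorRep : L →ₗ⁅R⁆ Module.End R (⨂[R] i, V i) :=
  { (∑ i, (actAt i).comp (LieModule.toEnd R L (V i)).toLinearMap :
        L →ₗ[R] Module.End R (⨂[R] i, V i)) with
    map_lie' := by
      intro x y
      classical
      have key : ∀ i j : κ, ⁅actAt i (LieModule.toEnd R L (V i) x),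
            actAt j (LieModule.toEnd R L (V j) y)⁆
          = if i = j then actAt i (LieModule.toEnd R L (V i) ⁅x, y⁆) else 0 := by
        intro i j
        split_ifs with h
        · subst h
          rw [LieHom.map_lie, LieRing.of_associative_ring_bracket,
            LieRing.of_associative_ring_bracket, map_sub, actAt_mul, actAt_mul]
        · rw [LieRing.of_associative_ring_bracket, actAt_comm h, sub_self]
      simp only [AddHom.toFun_eq_coe, LinearMap.coe_toAddHom, LinearMap.sum_apply,
        LinearMap.comp_apply, LieHom.coe_toLinearMap, lie_sum, sum_lie, key]
      simp }

/-- The diagonal action of a Lie algebra `L` on the tensor product of a finite family of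
`L`-modules. -/
instance instLieRingModuleTensor : LieRingModule L (⨂[R] i, V i) where
  bracket x m := tensorRep R L V x m
  add_lie x y m := by
    change tensorRep R L V (x + y) m = tensorRep R L V x m + tensorRep R L V y m
    rw [map_add, LinearMap.add_apply]
  lie_add x m n := map_add (tensorRep R L V x) m n
  leibniz_lie x y m := by
    change tensorRep R L V x (tensorRep R L V y m)
      = tensorRep R L V ⁅x, y⁆ m + tensorRep R L V y (tensorRep R L V x m)
    rw [LieHom.map_lie, LieRing.of_associative_ring_bracket]
    simp

instance instLieModuleTensor : LieModule R L (⨂[R] i, V i) where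
  smul_lie t x m := by
    change tensorRep R L V (t • x) m = t • tensorRep R L V x m
    rw [map_smul, LinearMap.smul_apply]
  lie_smul t x m := map_smul (tensorRep R L V x) t m

open scoped Classical in
/-- On pure tensors the action is the Leibniz rule. -/
theorem lie_tprod (x : L) (m : ∀ i, V i) :
    ⁅x, PiTensorProduct.tprod R m⁆
      = ∑ i, PiTensorProduct.tprod R (Function.update m i ⁅x, m i⁆) := by
  change tensorRep R L V x (PiTensorProduct.tprod R m) = _
  change (∑ i, (actAt i).comp (LieModule.toEnd R L (V i)).toLinearMap :
        L →ₗ[R] Module.End R (⨂[R] i, V i)) x (PiTensorProduct.tprod R m) = _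
  simp [LinearMap.sum_apply, actAt_tprod]

end Tensor

/-! ### Dynkin diagrams, weights and highest weight modules

Throughout, `L` is a finite-dimensional simple complex Lie algebra, `H` is a Cartan subalgebra and
`b` is a base of the root system of `(L, H)`. The set `I` of nodes of the Dynkin diagram is
`b.support`; the simple root of `i : b.support` is `(rootSystem H).root i`, and the simple coroot
`h_i` is `(rootSystem H).coroot i`. -/

section Lie

open LieAlgebra LieAlgebra.IsKilling Module

variable {L : Type*} [LieRing L] [LieAlgebra ℂ L] [FiniteDimensional ℂ L] [LieAlgebra.IsSimple ℂ L]
  {H : LieSubalgebra ℂ L} [H.IsCartanSubalgebra] (b : (rootSystem H).Base)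

/-- The graph underlying the Dynkin diagram: distinct nodes `i`, `j` are joined exactly if
the entry of the Cartan matrix at `(i, j)` is nonzero. -/
def dynkinGraph : SimpleGraph b.support where
  Adj i j := i ≠ j ∧ b.cartanMatrix i j ≠ 0
  symm := ⟨fun _ _ h =>
    ⟨h.1.symm, fun h0 => h.2 ((b.cartanMatrix_apply_eq_zero_iff_symm).mp h0)⟩⟩
  loopless := ⟨fun _ h => h.1 rfl⟩

/-- A subdiagram (a set of nodes) is connected; the empty subdiagram counts as connected. -/
def IsConnectedSubdiagram (J : Finset b.support) : Prop :=
  ((dynkinGraph b).induce (J : Set b.support)).Preconnected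

open scoped Classical in
/-- The minimal connected subdiagram `S̄` containing `S`, that is, the intersection of all connected
subdiagrams that contain `S` (which is itself connected, since the diagram is a tree). -/
def hull (S : Finset b.support) : Finset b.support :=
  {i | ∀ J : Finset b.support, S ⊆ J → IsConnectedSubdiagram b J → i ∈ J}

open scoped Classical in
/-- The set `∂I` of nodes connected to at most one other node. -/
def boundary : Finset b.support :=
  {i | ({j | (dynkinGraph b).Adj i j} : Finset b.support).card ≤ 1}

/-- `ϑ_J`, the sum of the simple roots `α_j`, `j ∈ J`. -/
def theta (J : Finset b.support) : Dual ℂ H :=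
  ∑ j ∈ J, (rootSystem H).root j

/-- `P⁺`: a weight is dominant (integral) if all its values on the simple coroots are
non-negative integers. -/
def IsDominant (wt : Dual ℂ H) : Prop :=
  ∀ i : b.support, ∃ n : ℕ, wt ((rootSystem H).coroot i) = n

open scoped Classical in
/-- The support of a weight: the nodes `i` where its value on `h_i` is nonzero. -/
def supp (wt : Dual ℂ H) : Finset b.support :=
  {i | wt ((rootSystem H).coroot i) ≠ 0}

/-- The fundamental weights `ω_i`: the basis of `H*` dual to the basis of simple coroots of `H`. -/
def fundamentalWeight (i : b.support) : Dual ℂ H :=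
  b.toCoweightBasis.coord i

/-- `V` is an irreducible module of highest weight `wt`, i.e. `V ≅ V(wt)`: it is irreducible and
contains a nonzero vector of weight `wt` that is annihilated by all positive root spaces. -/
structure IsIrreducibleOfHighestWeight (wt : Dual ℂ H) (V : Type*) [AddCommGroup V] [Module ℂ V]
    [LieRingModule L V] [LieModule ℂ L V] : Prop where
  irreducible : LieModule.IsIrreducible ℂ L V
  exists_vector : ∃ v : V, v ≠ 0 ∧ (∀ h : H, ⁅(h : L), v⁆ = wt h • v) ∧
    ∀ α : H.root, b.IsPos α → ∀ x ∈ rootSpace H (rootSystem H |>.root α), ⁅x, v⁆ = 0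

end Lie

/-- The multiplicity `dim Hom_L(V, W)` of the finite-dimensional irreducible `L`-module `V` in the
finite-dimensional `L`-module `W`, that is, the number of summands isomorphic to `V` in a
decomposition of `W` as a direct sum of irreducible modules. -/
def multiplicity (L V W : Type*) [LieRing L] [LieAlgebra ℂ L]
    [AddCommGroup V] [Module ℂ V] [LieRingModule L V] [LieModule ℂ L V]
    [AddCommGroup W] [Module ℂ W] [LieRingModule L W] [LieModule ℂ L W] : ℕ :=
  Module.finrank ℂ (V →ₗ⁅ℂ, L⁆ W)

end OuterMult

end

/-!
By complete reducibility, the multiplicity of `V(μ)` in `W` is the dimension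
of the space of vectors of weight `μ` in `W` that are killed by all simple root vectors `e_k`
(`IsChevalley.finrank_hom`). All weights of `W` lie below `λ`, so the hypothesis `s_i ≤ 1` leaves
only the weights `μ = λ - ϑ_J` for sets `J` of nodes.

The weights `χ - ϑ_K` of the module `V(χ)`, where `χ` is a multiple of a single fundamental weight
`ω_i`, have multiplicity at most one. Such a weight occurs exactly if `K` is empty, or `χ ≠ 0` and
`K` is connected and contains `i`. The weight vectors `treeVec` can be normalized so that `e_k`
takes the vector of `K` to the vector of `K \ {k}`, or to zero if the latter does not exist
(`treeVecSpec`). The tensor products of these vectors form a basis of the weight space of `W` for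
`λ - ϑ_J`. The basis is indexed by the partitions of `J` into subtrees, each rooted at its own
element of `supp λ`. In these coordinates the equations `e_k w = 0` become combinatorial: for each
`k ∈ J` and each partition of `J \ {k}`, the coordinates of the partitions of `J` that extend it add
up to zero. The solution space is `extensionKernel`, and `finrank_hwVectors` identifies it with the
space of highest weight vectors.

It remains to compute the dimension of `extensionKernel` on a tree.
* If some `k ∈ J` has no neighbour in `J`, or is not in `supp λ` and has only one, then each equation
  belonging to `k` contains at most one unknown, so that all solutions vanish
  (`degIn_of_extensionKernel_ne_bot`). The Dynkin diagram carries a positive quadratic form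
  (`dynkinGraph_pos`). So it is a tree with at most three leaves, and every other nonempty `J` is
  the connected hull of `J ∩ supp λ`, a set of at least two leaves.
* Such a hull is a star: paths (legs) from a centre `c` to the elements of `S = J ∩ supp λ`
  (`exists_isStar`). The equations at the vertices other than `c` express all coordinates through
  those of the `#S` partitions in which each leg belongs to its own tip and only the owner of `c`
  varies. The equation at `c` says that these `#S` numbers add up to zero. Therefore the dimension
  is `#S - 1` (`IsStar.finrank_extensionKernel`), which is `1` for `#S = 2` and `2` for `#S = 3`;
  for `S = ∅` it is `1`.
-/

noncomputable section

namespace OuterMult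

/-! ### Positivity of the Dynkin diagram -/

section Positivity

open Matrix

/-- Positive definiteness of an integral matrix passes to the reals: semidefiniteness holds on the
dense set of rational vectors, and the kernel vanishes because the determinant is nonzero. -/
theorem posDef_map_intCast_real {n : Type*} [Fintype n] [DecidableEq n] {M : Matrix n n ℤ}
    (hM : M.PosDef) : (M.map (Int.cast : ℤ → ℝ)).PosDef := by
  have hsymm : ∀ i j, M j i = M i j := fun i j => by
    have := hM.isHermitian.apply i j
    simpa using this
  have hint : ∀ z : n → ℤ, 0 ≤ ∑ i, ∑ j, z i * M i j * z j := by
    intro z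
    have := hM.posSemidef.dotProduct_mulVec_nonneg z
    simpa [dotProduct, mulVec, Finset.mul_sum, mul_assoc] using this
  have hrat : ∀ q : n → ℚ, 0 ≤ ∑ i, ∑ j, (q i : ℝ) * M i j * q j := by
    intro q
    -- clear denominators
    set D : ℤ := ∏ i, ((q i).den : ℤ) with hD
    have hDpos : 0 < D := Finset.prod_pos fun i _ => by exact_mod_cast (q i).den_pos
    have hz : ∀ i, ∃ z : ℤ, (z : ℝ) = D * q i := by
      intro i
      obtain ⟨c, hc⟩ : ((q i).den : ℤ) ∣ D := Finset.dvd_prod_of_mem _ (Finset.mem_univ i)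
      refine ⟨c * (q i).num, ?_⟩
      have h1 : ((q i).den : ℝ) * q i = (q i).num := by
        have := Rat.den_mul_eq_num (q i)
        exact_mod_cast this
      rw [hc]
      push_cast
      rw [← h1]
      ring
    choose z hz using hz
    have h := hint z
    have h' : (0 : ℝ) ≤ ∑ i, ∑ j, (z i : ℝ) * M i j * z j := by exact_mod_cast h
    have heq : ∑ i, ∑ j, (z i : ℝ) * M i j * z j
        = (D : ℝ) ^ 2 * ∑ i, ∑ j, (q i : ℝ) * M i j * q j := by
      simp only [hz, Finset.mul_sum]
      refine Finset.sum_congr rfl fun i _ => Finset.sum_congr rfl fun j _ => ?_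
      ring
    rw [heq] at h'
    have : (0 : ℝ) < (D : ℝ) ^ 2 := by positivity
    exact nonneg_of_mul_nonneg_right h' this
  have hreal : ∀ x : n → ℝ, 0 ≤ ∑ i, ∑ j, x i * M i j * x j := by
    have hdense : DenseRange (fun (q : n → ℚ) (i : n) => (q i : ℝ)) :=
      DenseRange.piMap fun _ => Rat.denseRange_cast
    intro x
    refine hdense.induction_on (p := fun x : n → ℝ => 0 ≤ ∑ i, ∑ j, x i * M i j * x j) x ?_ hrat
    exact isClosed_le continuous_const (by fun_prop)
  have hsemi : (M.map (Int.cast : ℤ → ℝ)).PosSemidef := by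
    refine PosSemidef.of_dotProduct_mulVec_nonneg ?_ ?_
    · ext i j
      simp [hsymm]
    · intro x
      simpa [dotProduct, mulVec, Finset.mul_sum, mul_assoc] using hreal x
  refine PosDef.of_dotProduct_mulVec_pos hsemi.isHermitian fun x hx => ?_
  refine lt_of_le_of_ne (hsemi.dotProduct_mulVec_nonneg x) fun h0 => ?_
  have hker := (hsemi.dotProduct_mulVec_zero_iff x).1 h0.symm
  have hdet : (M.map (Int.cast : ℤ → ℝ)).det = 0 := exists_mulVec_eq_zero_iff.1 ⟨x, hx, hker⟩
  have hdet' : M.det = 0 := by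
    have h := (Int.castRingHom ℝ).map_det M
    have h2 : ((M.det : ℤ) : ℝ) = (M.map (Int.cast : ℤ → ℝ)).det := h
    rw [hdet] at h2
    exact_mod_cast h2
  obtain ⟨z, hz, hz0⟩ := exists_mulVec_eq_zero_iff.2 hdet'
  have := hM.dotProduct_mulVec_pos hz
  simp [hz0] at this

open LieAlgebra LieAlgebra.IsKilling Module

variable {L : Type*} [LieRing L] [LieAlgebra ℂ L] [FiniteDimensional ℂ L] [LieAlgebra.IsSimple ℂ L]
  {H : LieSubalgebra ℂ L} [H.IsCartanSubalgebra] (b : (rootSystem H).Base)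

open scoped Classical in
/-- The quadratic form of a Dynkin diagram, with all edges regarded as simple, is positive on
non-negative vectors: rescale the simple roots to unit vectors; then the off-diagonal
products are at most `-1/2` along edges since `a i j * a j i ≥ 1`. -/
theorem dynkinGraph_pos (x : b.support → ℤ) (hx : ∀ i, 0 ≤ x i) (hx0 : x ≠ 0) :
    ∑ i, ∑ j, (if (dynkinGraph b).Adj i j then x i * x j else 0) < 2 * ∑ i, x i ^ 2 := by
  obtain ⟨d, hd, hpos⟩ := b.exists_cartanMatrix_mul_diagaonal_posDef
  have hsymm : ∀ i j, b.cartanMatrix i j * d j = b.cartanMatrix j i * d i := fun i j => by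
    have := hpos.isHermitian.apply j i
    simpa [Matrix.mul_diagonal] using this
  have hR := posDef_map_intCast_real hpos
  have hdR : ∀ i, (0 : ℝ) < d i := fun i => by exact_mod_cast hd i
  set r : b.support → ℝ := fun i => Real.sqrt (d i) with hr
  have hrpos : ∀ i, 0 < r i := fun i => Real.sqrt_pos.2 (hdR i)
  have hr2 : ∀ i, r i * r i = d i := fun i => Real.mul_self_sqrt (hdR i).le
  have hy0 : (fun i => (x i : ℝ) / r i) ≠ 0 := by
    intro h
    apply hx0
    funext i
    have := congrFun h i
    simp only [Pi.zero_apply, div_eq_zero_iff, (hrpos i).ne', or_false] at this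
    exact_mod_cast this
  have hq := hR.dotProduct_mulVec_pos hy0
  have hq' : 0 < ∑ i, ∑ j, (x i : ℝ) * x j * (b.cartanMatrix i j * r j / r i) := by
    refine hq.trans_eq ?_
    simp only [dotProduct, mulVec, Finset.mul_sum, Matrix.map_apply, Matrix.mul_diagonal,
      Pi.star_apply, star_trivial]
    refine Finset.sum_congr rfl fun i _ => Finset.sum_congr rfl fun j _ => ?_
    have h1 := hr2 j
    have h2 := (hrpos j).ne'
    have h3 := (hrpos i).ne'
    push_cast
    rw [← h1]
    field_simp
  have hle : ∀ i j, (b.cartanMatrix i j * r j / r i : ℝ)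
      ≤ (if i = j then 2 else 0) - (if (dynkinGraph b).Adj i j then 1 else 0) := by
    intro i j
    rcases eq_or_ne i j with rfl | hij
    · simp [(hrpos i).ne']
    · rw [if_neg hij]
      split_ifs with hadj
      · have ha := hadj.2
        have hneg := b.cartanMatrix_le_zero_of_ne i j hij
        have hneg' := b.cartanMatrix_le_zero_of_ne j i hij.symm
        have ha' := hadj.symm.2
        have h1 : (b.cartanMatrix i j : ℝ) ≤ -1 := by
          exact_mod_cast (show b.cartanMatrix i j ≤ -1 by omega)
        have h2 : (b.cartanMatrix j i : ℝ) ≤ -1 := by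
          exact_mod_cast (show b.cartanMatrix j i ≤ -1 by omega)
        have hs : (b.cartanMatrix i j : ℝ) * (r j * r j) = b.cartanMatrix j i * (r i * r i) := by
          rw [hr2, hr2]; exact_mod_cast hsymm i j
        have hri := hrpos i
        have hrj := hrpos j
        rw [zero_sub, div_le_iff₀ hri]
        -- both `a i j * r j ^ 2 = a j i * r i ^ 2` and `a i j ≤ -1`, `a j i ≤ -1`
        by_contra hcon
        push Not at hcon
        have h3 : -(b.cartanMatrix i j : ℝ) * r j < r i := by linarith
        have h4 : r j < r i := by nlinarith
        nlinarith [mul_pos hri hri, mul_pos hri hrj]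
      · have h0 : b.cartanMatrix i j = 0 := by
          by_contra h; exact hadj ⟨hij, h⟩
        simp [h0]
  have hfin : (0 : ℝ) < 2 * ∑ i, (x i : ℝ) ^ 2
      - ∑ i, ∑ j, (if (dynkinGraph b).Adj i j then (x i : ℝ) * x j else 0) := by
    refine hq'.trans_le ?_
    rw [Finset.mul_sum, ← Finset.sum_sub_distrib]
    refine Finset.sum_le_sum fun i _ => ?_
    have : (2 : ℝ) * (x i : ℝ) ^ 2 = ∑ j, if i = j then 2 * ((x i : ℝ) * x j) else 0 := by
      simp [pow_two]
    rw [this, ← Finset.sum_sub_distrib]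
    refine Finset.sum_le_sum fun j _ => ?_
    have hxx : (0 : ℝ) ≤ (x i : ℝ) * x j := by
      exact_mod_cast mul_nonneg (hx i) (hx j)
    refine (mul_le_mul_of_nonneg_left (hle i j) hxx).trans_eq ?_
    split_ifs <;> ring
  have : (∑ i, ∑ j, (if (dynkinGraph b).Adj i j then (x i : ℝ) * x j else 0))
      < 2 * ∑ i, (x i : ℝ) ^ 2 := by linarith
  exact_mod_cast this

theorem dynkinGraph_connected : (dynkinGraph b).Connected := by
  have := RootPairing.IsIrreducible.nontrivial (rootSystem H)
  have : Nonempty b.support := b.toWeightBasis.index_nonempty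
  refine ⟨fun i j => ?_⟩
  refine b.induction_on_cartanMatrix (fun j => (dynkinGraph b).Reachable i j)
    (SimpleGraph.Reachable.refl i) fun k l hk hlk => ?_
  rcases eq_or_ne l k with rfl | hne
  · exact hk
  · have hadj : (dynkinGraph b).Adj l k := ⟨hne, hlk⟩
    exact hk.trans hadj.symm.reachable

end Positivity

/-! ### Counting edges in positive graphs -/

section Counting

set_option linter.unusedSectionVars false

variable {I : Type*} [DecidableEq I] (G : SimpleGraph I) [DecidableRel G.Adj]

/-- The number of neighbours of `v` in the set `T`. -/
def degIn (T : Finset I) (v : I) : ℕ := (T.filter (G.Adj v)).card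

/-- The sum over `T` of the degrees in the subgraph induced on `T`, that is, twice the number of
edges of this subgraph. -/
def degSum (T : Finset I) : ℕ := ∑ v ∈ T, degIn G T v

/-- A finite graph is positive if the quadratic form `∑ xᵢ² - ∑_{edges ij} xᵢ xⱼ` is
positive on nonzero vectors with non-negative integral entries. -/
def IsPositiveGraph [Fintype I] : Prop :=
  ∀ x : I → ℤ, (∀ i, 0 ≤ x i) → x ≠ 0 →
    ∑ i, ∑ j, (if G.Adj i j then x i * x j else 0) < 2 * ∑ i, x i ^ 2

variable {G}

theorem degIn_eq_sum (T : Finset I) (v : I) :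
    degIn G T v = ∑ j ∈ T, if G.Adj v j then 1 else 0 := by
  rw [degIn, Finset.card_filter]

theorem degIn_mono {A B : Finset I} (h : A ⊆ B) (v : I) : degIn G A v ≤ degIn G B v :=
  Finset.card_le_card (Finset.filter_subset_filter _ h)

theorem degIn_union {A B : Finset I} (h : Disjoint A B) (v : I) :
    degIn G (A ∪ B) v = degIn G A v + degIn G B v := by
  simp only [degIn_eq_sum, Finset.sum_union h]

theorem sum_degIn_comm (A B : Finset I) : ∑ a ∈ A, degIn G B a = ∑ b ∈ B, degIn G A b := by
  simp only [degIn_eq_sum]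
  rw [Finset.sum_comm]
  simp only [G.adj_comm]

theorem degSum_union {A B : Finset I} (h : Disjoint A B) :
    degSum G (A ∪ B) = degSum G A + degSum G B + 2 * ∑ a ∈ A, degIn G B a := by
  simp only [degSum, Finset.sum_union h, degIn_union h, Finset.sum_add_distrib]
  rw [sum_degIn_comm B A]
  ring

theorem degSum_eq_twice (T : Finset I) :
    degSum G T = 2 * Nat.card (G.induce (T : Set I)).edgeSet := by
  classical
  have h := (G.induce (T : Set I)).sum_degrees_eq_twice_card_edges
  rw [Nat.card_eq_fintype_card, ← SimpleGraph.edgeFinset_card]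
  convert h using 1
  rw [degSum, ← Finset.sum_coe_sort T]
  refine Finset.sum_congr rfl fun v _ => ?_
  rw [degIn, ← SimpleGraph.card_neighborFinset_eq_degree,
    ← Finset.card_map (Function.Embedding.subtype _)]
  congr 1
  ext w
  simp [and_comm]

theorem card_le_degSum_of_preconnected {T : Finset I}
    (hc : (G.induce (T : Set I)).Preconnected) : 2 * T.card ≤ degSum G T + 2 := by
  rcases T.eq_empty_or_nonempty with rfl | hT
  · simp
  have : Nonempty (T : Set I) := hT.to_subtype
  have h := (SimpleGraph.Connected.mk hc).card_vert_le_card_edgeSet_add_one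
  rw [degSum_eq_twice]
  have h2 : Nat.card (T : Set I) = T.card := by simp
  omega

theorem exists_separation {T : Finset I} (h : ¬ (G.induce (T : Set I)).Preconnected) :
    ∃ A B : Finset I, A.Nonempty ∧ B.Nonempty ∧ Disjoint A B ∧ A ∪ B = T ∧
      ∀ a ∈ A, ∀ c ∈ B, ¬ G.Adj a c := by
  classical
  simp only [SimpleGraph.Preconnected, not_forall] at h
  obtain ⟨u, w, huw⟩ := h
  let p : I → Prop := fun v => ∃ hv : v ∈ (T : Set I), (G.induce (T : Set I)).Reachable u ⟨v, hv⟩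
  refine ⟨T.filter p, T.filter (fun v => ¬ p v), ⟨u, ?_⟩, ⟨w, ?_⟩,
    Finset.disjoint_filter_filter_not _ _ _, Finset.filter_union_filter_not_eq _ _, ?_⟩
  · exact Finset.mem_filter.2 ⟨u.2, u.2, SimpleGraph.Reachable.refl _⟩
  · exact Finset.mem_filter.2 ⟨w.2, fun ⟨_, h⟩ => huw h⟩
  · intro a ha c hc hadj
    obtain ⟨haT, haT', har⟩ := Finset.mem_filter.1 ha
    obtain ⟨hcT, hc'⟩ := Finset.mem_filter.1 hc
    refine hc' ⟨hcT, har.trans ?_⟩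
    have : (G.induce (T : Set I)).Adj ⟨a, haT'⟩ ⟨c, hcT⟩ := hadj
    exact this.reachable

theorem sum_degIn_eq_zero {A B : Finset I} (h : ∀ a ∈ A, ∀ c ∈ B, ¬ G.Adj a c) :
    ∑ a ∈ A, degIn G B a = 0 := by
  refine Finset.sum_eq_zero fun a ha => ?_
  rw [degIn, Finset.card_eq_zero, Finset.filter_eq_empty_iff]
  exact fun c hc => h a ha c hc

section Positive

variable [Fintype I]

theorem IsPositiveGraph.degSum_add_two_le (hG : IsPositiveGraph G) {T : Finset I}
    (hT : T.Nonempty) : degSum G T + 2 ≤ 2 * T.card := by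
  have h := hG (fun i => if i ∈ T then 1 else 0) (fun i => by split_ifs <;> simp) (by
    obtain ⟨t, ht⟩ := hT
    intro h
    simpa [ht] using congrFun h t)
  have h1 : ∑ i, ∑ j, (if G.Adj i j then (if i ∈ T then (1 : ℤ) else 0) * (if j ∈ T then 1 else 0)
      else 0) = degSum G T := by
    simp only [degSum, degIn_eq_sum]
    push_cast
    rw [← Finset.sum_filter_add_sum_filter_not Finset.univ (· ∈ T)]
    simp only [Finset.filter_univ_mem]
    rw [Finset.sum_eq_zero (s := Finset.univ.filter (· ∉ T)), add_zero]
    · refine Finset.sum_congr rfl fun i hi => ?_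
      rw [← Finset.sum_filter_add_sum_filter_not Finset.univ (· ∈ T)]
      simp only [Finset.filter_univ_mem]
      rw [Finset.sum_eq_zero (s := Finset.univ.filter (· ∉ T)), add_zero]
      · exact Finset.sum_congr rfl fun j hj => by simp [hi, hj]
      · intro j hj
        simp [(Finset.mem_filter.1 hj).2]
    · intro i hi
      simp [(Finset.mem_filter.1 hi).2]
  have h2 : ∑ i, (if i ∈ T then (1 : ℤ) else 0) ^ 2 = T.card := by simp
  rw [h1, h2] at h
  have h3 := degSum_eq_twice (G := G) T
  omega

theorem IsPositiveGraph.preconnected (hG : IsPositiveGraph G) {T : Finset I}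
    (h : 2 * T.card ≤ degSum G T + 2) : (G.induce (T : Set I)).Preconnected := by
  by_contra hc
  obtain ⟨A, B, hA, hB, hd, rfl, hsep⟩ := exists_separation hc
  have h1 := hG.degSum_add_two_le hA
  have h2 := hG.degSum_add_two_le hB
  rw [degSum_union hd, sum_degIn_eq_zero hsep, Finset.card_union_of_disjoint hd] at h
  omega

theorem IsPositiveGraph.isTree (hG : IsPositiveGraph G) (hc : G.Connected) : G.IsTree := by
  refine SimpleGraph.isTree_iff_connected_and_card.2 ⟨hc, ?_⟩
  have := hc.nonempty
  have h1 := hG.degSum_add_two_le (T := Finset.univ) Finset.univ_nonempty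
  have h2 := hc.card_vert_le_card_edgeSet_add_one
  have h3 : degSum G Finset.univ = 2 * Nat.card G.edgeSet := by
    rw [Nat.card_eq_fintype_card, ← SimpleGraph.edgeFinset_card,
      ← SimpleGraph.sum_degrees_eq_twice_card_edges, degSum]
    refine Finset.sum_congr rfl fun v _ => ?_
    rw [degIn, ← SimpleGraph.card_neighborFinset_eq_degree, SimpleGraph.neighborFinset_eq_filter]
  rw [Nat.card_eq_fintype_card (α := I)] at h2 ⊢
  rw [Finset.card_univ] at h1
  omega

/-- A connected positive graph has at most three leaves: test positivity on the vector
with entry `1` at the leaves and `2` elsewhere. -/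
theorem IsPositiveGraph.card_leaves_le (hG : IsPositiveGraph G) (hc : G.Connected)
    {B : Finset I} (hB : ∀ i ∈ B, degIn G Finset.univ i ≤ 1) : B.card ≤ 3 := by
  have := hc.nonempty
  set l : I → ℤ := fun i => if i ∈ B then 1 else 0 with hl
  have hl01 : ∀ i, 0 ≤ l i ∧ l i ≤ 1 := fun i => by
    simp only [hl]; split_ifs <;> simp
  have h := hG (fun i => 2 - l i) (fun i => by have := hl01 i; omega) (by
    intro h
    have h1 := congrFun h (Classical.arbitrary I)
    have h2 := hl01 (Classical.arbitrary I)
    simp only [Pi.zero_apply] at h1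
    omega)
  have hsum : ∑ i, l i = B.card := by simp [hl]
  have hsq : ∑ i, (2 - l i) ^ 2 = 4 * (Fintype.card I : ℤ) - 3 * B.card := by
    have : ∀ i, (2 - l i) ^ 2 = 4 - 3 * l i := fun i => by
      simp only [hl]; split_ifs <;> norm_num
    simp only [this, Finset.sum_sub_distrib, ← Finset.mul_sum, hsum]
    simp [mul_comm]
  have hdeg : ∀ i, ∑ j, (if G.Adj i j then (1 : ℤ) else 0) = degIn G Finset.univ i := fun i => by
    rw [degIn_eq_sum]; push_cast; rfl
  have hld : ∑ i, l i * degIn G Finset.univ i ≤ B.card := by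
    rw [← hsum]
    refine Finset.sum_le_sum fun i _ => ?_
    simp only [hl]
    split_ifs with hi
    · have := hB i hi
      omega
    · simp
  have hcross : 4 * (degSum G Finset.univ : ℤ) - 4 * B.card
      ≤ ∑ i, ∑ j, (if G.Adj i j then (2 - l i) * (2 - l j) else 0) := by
    have h1 : ∑ i, ∑ j, (if G.Adj i j then l i else 0) = ∑ i, l i * degIn G Finset.univ i := by
      refine Finset.sum_congr rfl fun i _ => ?_
      rw [← hdeg, Finset.mul_sum]
      simp
    have h2 : ∑ i, ∑ j, (if G.Adj i j then l j else 0) = ∑ i, l i * degIn G Finset.univ i := by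
      rw [← h1, Finset.sum_comm]
      simp only [G.adj_comm]
    have h3 : ∑ i, ∑ j, (if G.Adj i j then (4 : ℤ) else 0) = 4 * degSum G Finset.univ := by
      rw [degSum]
      push_cast
      rw [Finset.mul_sum]
      refine Finset.sum_congr rfl fun i _ => ?_
      rw [← hdeg, Finset.mul_sum]
      simp
    have h4 : ∑ i, ∑ j, (if G.Adj i j then (4 : ℤ) else 0)
        - 2 * ∑ i, ∑ j, (if G.Adj i j then l i else 0)
        - 2 * ∑ i, ∑ j, (if G.Adj i j then l j else 0)
        ≤ ∑ i, ∑ j, (if G.Adj i j then (2 - l i) * (2 - l j) else 0) := by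
      simp only [Finset.mul_sum, ← Finset.sum_sub_distrib]
      refine Finset.sum_le_sum fun i _ => Finset.sum_le_sum fun j _ => ?_
      have hi := hl01 i
      have hj := hl01 j
      split_ifs
      · nlinarith [mul_nonneg hi.1 hj.1]
      · simp
    rw [h1, h2, h3] at h4
    linarith
  have hconn : 2 * Fintype.card I ≤ degSum G Finset.univ + 2 := by
    have h1 : (G.induce ((Finset.univ : Finset I) : Set I)).Preconnected := by
      rw [Finset.coe_univ]
      exact (SimpleGraph.induceUnivIso G).connected_iff.2 hc |>.preconnected
    simpa using card_le_degSum_of_preconnected h1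
  rw [hsq] at h
  omega

/-- In a positive graph, a set `J` all of whose vertices outside `S` have at least two
neighbours in `J` is contained in every connected set that contains `J ∩ S`. -/
theorem IsPositiveGraph.subset_of_preconnected (hG : IsPositiveGraph G) {J S K : Finset I}
    (hJ : ∀ k ∈ J, k ∉ S → 2 ≤ degIn G J k) (hK : J ∩ S ⊆ K)
    (hc : (G.induce (K : Set I)).Preconnected) : J ⊆ K := by
  by_contra hn
  have hT : (J \ K).Nonempty := by
    rw [Finset.nonempty_iff_ne_empty, Ne, Finset.sdiff_eq_empty_iff_subset]
    exact hn
  have hd : Disjoint (J \ K) K := Finset.sdiff_disjoint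
  have h1 := card_le_degSum_of_preconnected hc
  have h2 := hG.degSum_add_two_le hT
  have h3 := hG.degSum_add_two_le (T := J \ K ∪ K) (hT.mono Finset.subset_union_left)
  rw [degSum_union hd, Finset.card_union_of_disjoint hd] at h3
  have h4 : 2 * (J \ K).card ≤ degSum G (J \ K) + ∑ a ∈ J \ K, degIn G K a := by
    rw [degSum, ← Finset.sum_add_distrib, mul_comm, ← smul_eq_mul, ← Finset.sum_const]
    refine Finset.sum_le_sum fun a ha => ?_
    obtain ⟨haJ, haK⟩ := Finset.mem_sdiff.1 ha
    rw [← degIn_union hd]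
    refine (hJ a haJ fun haS => haK (hK (Finset.mem_inter.2 ⟨haJ, haS⟩))).trans ?_
    refine degIn_mono ?_ a
    rw [Finset.sdiff_union_self_eq_union]
    exact Finset.subset_union_left
  omega

theorem sum_degIn_ge {J S T : Finset I} (hJ : ∀ k ∈ J, k ∉ S → 2 ≤ degIn G T k)
    (hJS : ∀ k ∈ J, k ∈ S → 1 ≤ degIn G T k) :
    2 * J.card ≤ ∑ k ∈ J, degIn G T k + (J ∩ S).card := by
  rw [← Finset.filter_mem_eq_inter, Finset.card_filter, ← Finset.sum_add_distrib, mul_comm,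
    ← smul_eq_mul, ← Finset.sum_const]
  refine Finset.sum_le_sum fun k hk => ?_
  split_ifs with hkS
  · have := hJS k hk hkS
    omega
  · exact (hJ k hk hkS).trans (Nat.le_add_right _ _)

/-- A nonempty set `J` in a positive graph, all of whose vertices of degree at most one in `J`
lie in `S` and none of which is isolated, contains at least two elements of `S`. -/
theorem IsPositiveGraph.two_le_card_inter (hG : IsPositiveGraph G) {J S : Finset I}
    (hne : J.Nonempty) (hJ : ∀ k ∈ J, k ∉ S → 2 ≤ degIn G J k)
    (hJS : ∀ k ∈ J, k ∈ S → 1 ≤ degIn G J k) : 2 ≤ (J ∩ S).card := by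
  have h1 := hG.degSum_add_two_le hne
  have h2 := sum_degIn_ge hJ hJS
  rw [← degSum] at h2
  omega

/-- If moreover `S` has at most three elements, then `J` is connected, because each component would
contain two elements of `S`. -/
theorem IsPositiveGraph.preconnected_of_degIn (hG : IsPositiveGraph G) {J S : Finset I}
    (hS : S.card ≤ 3) (hJ : ∀ k ∈ J, k ∉ S → 2 ≤ degIn G J k)
    (hJS : ∀ k ∈ J, k ∈ S → 1 ≤ degIn G J k) : (G.induce (J : Set I)).Preconnected := by
  by_contra hc
  obtain ⟨A, B, hA, hB, hd, rfl, hsep⟩ := exists_separation hc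
  have hsep' : ∀ c ∈ B, ∀ a ∈ A, ¬ G.Adj c a := fun c hc a ha h => hsep a ha c hc h.symm
  have hz : ∀ {A B : Finset I}, (∀ a ∈ A, ∀ c ∈ B, ¬ G.Adj a c) → ∀ a ∈ A, degIn G B a = 0 := by
    intro A B h a ha
    rw [degIn, Finset.card_eq_zero, Finset.filter_eq_empty_iff]
    exact fun c hc => h a ha c hc
  have hAd : ∀ a ∈ A, degIn G (A ∪ B) a = degIn G A a := fun a ha => by
    rw [degIn_union hd, hz hsep a ha, add_zero]
  have hBd : ∀ a ∈ B, degIn G (A ∪ B) a = degIn G B a := fun a ha => by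
    rw [degIn_union hd, hz hsep' a ha, zero_add]
  have h1 : 2 ≤ (A ∩ S).card := hG.two_le_card_inter hA
    (fun k hk hkS => hAd k hk ▸ hJ k (Finset.mem_union_left _ hk) hkS)
    (fun k hk hkS => hAd k hk ▸ hJS k (Finset.mem_union_left _ hk) hkS)
  have h2 : 2 ≤ (B ∩ S).card := hG.two_le_card_inter hB
    (fun k hk hkS => hBd k hk ▸ hJ k (Finset.mem_union_right _ hk) hkS)
    (fun k hk hkS => hBd k hk ▸ hJS k (Finset.mem_union_right _ hk) hkS)
  have h3 : (A ∩ S ∪ B ∩ S).card ≤ S.card :=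
    Finset.card_le_card (Finset.union_subset Finset.inter_subset_right Finset.inter_subset_right)
  rw [Finset.card_union_of_disjoint
    (hd.mono Finset.inter_subset_left Finset.inter_subset_left)] at h3
  omega

/-- A connected set containing `S`, of minimal size, has no vertex outside `S` with
fewer than two neighbours in it. -/
theorem IsPositiveGraph.exists_connected_superset (hG : IsPositiveGraph G) (hc : G.Connected)
    (S : Finset I) : ∃ M : Finset I, S ⊆ M ∧ (G.induce (M : Set I)).Preconnected ∧
      ∀ k ∈ M, k ∉ S → 2 ≤ degIn G M k := by
  classical
  have huniv : (G.induce ((Finset.univ : Finset I) : Set I)).Preconnected := by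
    rw [Finset.coe_univ]
    exact (SimpleGraph.induceUnivIso G).connected_iff.2 hc |>.preconnected
  obtain ⟨M, hM, hmin⟩ := Finset.exists_min_image
    (Finset.univ.filter fun M : Finset I => S ⊆ M ∧ (G.induce (M : Set I)).Preconnected)
    Finset.card ⟨Finset.univ, by simpa using huniv⟩
  simp only [Finset.mem_filter, Finset.mem_univ, true_and] at hM hmin
  refine ⟨M, hM.1, hM.2, fun k hk hkS => ?_⟩
  by_contra hlt
  have hd : Disjoint {k} (M.erase k) := by simp
  have hu : {k} ∪ M.erase k = M := by
    rw [← Finset.insert_eq, Finset.insert_erase hk]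
  have h1 := card_le_degSum_of_preconnected hM.2
  have h2 : degSum G M = degSum G (M.erase k) + 2 * degIn G (M.erase k) k := by
    conv_lhs => rw [← hu]
    rw [degSum_union hd]
    simp [degSum, degIn]
  have h3 : degIn G (M.erase k) k ≤ degIn G M k := degIn_mono (Finset.erase_subset _ _) k
  have h4 := Finset.card_erase_add_one hk
  have h5 := hmin (M.erase k) ⟨?_, hG.preconnected (by omega)⟩
  · omega
  · intro s hs
    exact Finset.mem_erase.2 ⟨fun h => hkS (h ▸ hs), hM.1 hs⟩

/-- If `J` is connected, `S ⊆ J` consists of two or three vertices with one neighbour in `J`, and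
all other vertices of `J` have at least two neighbours in `J`, then all
vertices outside `S`, except possibly one, have exactly two neighbours in `J`. -/
theorem IsPositiveGraph.exists_center (hG : IsPositiveGraph G) {J S : Finset I}
    (hSJ : S ⊆ J) (hS2 : 2 ≤ S.card) (hS3 : S.card ≤ 3)
    (hJ : ∀ k ∈ J, k ∉ S → 2 ≤ degIn G J k) (hJS : ∀ k ∈ S, degIn G J k = 1) :
    ∃ c ∈ J, ∀ k ∈ J, k ∉ S → k ≠ c → degIn G J k = 2 := by
  have hSne : S.Nonempty := Finset.card_pos.1 (by omega)
  have h1 := hG.degSum_add_two_le (hSne.mono hSJ)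
  by_cases h : ∃ c ∈ J \ S, degIn G J c ≠ 2
  · obtain ⟨c, hc, hc2⟩ := h
    obtain ⟨hcJ, hcS⟩ := Finset.mem_sdiff.1 hc
    refine ⟨c, hcJ, fun k hk hkS hkc => ?_⟩
    by_contra hk2
    have h3 := hJ c hcJ hcS
    have h4 := hJ k hk hkS
    have h5 : ∑ k ∈ J, degIn G J k = ∑ k ∈ J \ S, degIn G J k + S.card := by
      rw [← Finset.sum_sdiff hSJ, Finset.sum_congr rfl hJS]
      simp
    have hpair : ({c, k} : Finset I) ⊆ J \ S := by
      intro x hx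
      rcases Finset.mem_insert.1 hx with rfl | hx
      · exact hc
      · rw [Finset.mem_singleton.1 hx]
        exact Finset.mem_sdiff.2 ⟨hk, hkS⟩
    have h6 : 2 * ((J \ S) \ {c, k}).card ≤ ∑ k ∈ (J \ S) \ {c, k}, degIn G J k := by
      rw [mul_comm, ← smul_eq_mul, ← Finset.sum_const]
      refine Finset.sum_le_sum fun a ha => ?_
      have ha := (Finset.mem_sdiff.1 (Finset.mem_sdiff.1 ha).1)
      exact hJ a ha.1 ha.2
    have h7 := Finset.sum_sdiff hpair (f := degIn G J)
    rw [Finset.sum_pair (Ne.symm hkc)] at h7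
    have h8 := Finset.card_sdiff_add_card_eq_card hpair
    rw [Finset.card_pair (Ne.symm hkc)] at h8
    have h9 := Finset.card_sdiff_add_card_eq_card hSJ
    rw [degSum] at h1
    omega
  · push Not at h
    obtain ⟨c, hc⟩ := hSne
    exact ⟨c, hSJ hc, fun k hk hkS _ => h k (Finset.mem_sdiff.2 ⟨hk, hkS⟩)⟩

end Positive

end Counting

/-! ### Rooted trees -/

section Rooted

variable {I : Type*} (G : SimpleGraph I)

/-- The parent of `k` in the tree `G` with root `i`: the neighbour of `k` that is closer to `i`
(an unspecified vertex if there is none, in particular for `k = i`). -/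
def par (i k : I) : I :=
  haveI : Nonempty I := ⟨k⟩
  Classical.epsilon fun q => G.Adj k q ∧ G.dist i k = G.dist i q + 1

variable {G}

theorem par_spec (hc : G.Connected) {i k : I} (h : k ≠ i) :
    G.Adj k (par G i k) ∧ G.dist i k = G.dist i (par G i k) + 1 := by
  refine Classical.epsilon_spec (p := fun q => G.Adj k q ∧ G.dist i k = G.dist i q + 1) ?_
  obtain ⟨w, hw⟩ := hc.exists_walk_length_eq_dist k i
  cases w with
  | nil => exact absurd rfl h
  | @cons _ q _ hadj w =>
    refine ⟨q, hadj, ?_⟩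
    have h1 : G.dist q i ≤ w.length := SimpleGraph.dist_le w
    have h2 : G.dist k i ≤ G.dist k q + G.dist q i := hc.dist_triangle
    rw [SimpleGraph.dist_eq_one_iff_adj.2 hadj] at h2
    rw [SimpleGraph.Walk.length_cons] at hw
    rw [SimpleGraph.dist_comm (u := i) (v := k), SimpleGraph.dist_comm (u := i) (v := q)]
    omega

theorem penultimate_eq_par (hT : G.IsTree) {i k q : I} (h : G.Adj k q)
    (hd : G.dist i k = G.dist i q + 1) (p : G.Walk i k) (hp : p.IsPath) : p.penultimate = q := by
  obtain ⟨w, hw, hlen⟩ := (hT.connected i q).exists_path_of_dist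
  classical
  have hk : k ∉ w.support := fun hk => by
    have h1 := SimpleGraph.dist_le (w.takeUntil k hk)
    have h2 := w.length_takeUntil_le_length hk
    omega
  have h2 := congrArg Subtype.val
    ((hT.isAcyclic.subsingleton_path _ _).elim ⟨p, hp⟩ ⟨_, hw.concat hk h.symm⟩)
  simp only at h2
  rw [h2]
  simp

theorem eq_par (hT : G.IsTree) {i k q : I} (h : G.Adj k q) (hd : G.dist i k = G.dist i q + 1) :
    par G i k = q := by
  have hki : k ≠ i := by
    rintro rfl
    simp at hd
  obtain ⟨w, hw, -⟩ := (hT.connected i k).exists_path_of_dist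
  have h1 := par_spec hT.connected hki
  rw [← penultimate_eq_par hT h1.1 h1.2 w hw, penultimate_eq_par hT h hd w hw]

/-- Of two adjacent vertices, one is the parent of the other. -/
theorem par_eq_or_par_eq (hT : G.IsTree) (i : I) {k q : I} (h : G.Adj k q) :
    (k ≠ i ∧ par G i k = q) ∨ (q ≠ i ∧ par G i q = k) := by
  rcases hT.dist_eq_dist_add_one_of_adj i h with h1 | h1
  · refine Or.inl ⟨?_, eq_par hT h h1⟩
    rintro rfl
    simp at h1
  · refine Or.inr ⟨?_, eq_par hT h.symm h1⟩
    rintro rfl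
    simp at h1

theorem par_par_ne (hT : G.IsTree) {i k : I} (h : k ≠ i) (h' : par G i k ≠ i) :
    par G i (par G i k) ≠ k := by
  intro he
  have h1 := (par_spec hT.connected h).2
  have h2 := (par_spec hT.connected h').2
  rw [he] at h2
  omega

theorem par_eq_of_ne (hT : G.IsTree) {i k q : I} (h : G.Adj k q)
    (hq : q ≠ par G i k) : q ≠ i ∧ par G i q = k :=
  (par_eq_or_par_eq hT i h).resolve_left fun h' => hq h'.2.symm

theorem par_mem (hT : G.IsTree) {J : Finset I} (hJ : (G.induce (J : Set I)).Preconnected)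
    {i k : I} (hi : i ∈ J) (hk : k ∈ J) (h : k ≠ i) : par G i k ∈ J := by
  classical
  obtain ⟨w, hw⟩ := (hJ ⟨i, hi⟩ ⟨k, hk⟩).exists_isPath
  have hp := hw.map (f := (SimpleGraph.Embedding.induce (G := G) (J : Set I)).toHom)
    (SimpleGraph.Embedding.induce (G := G) (J : Set I)).injective
  have h1 := par_spec hT.connected h
  have h2 := penultimate_eq_par hT h1.1 h1.2 _ hp
  rw [← h2]
  have h3 := SimpleGraph.Walk.getVert_mem_support
    (w.map (SimpleGraph.Embedding.induce (G := G) (J : Set I)).toHom) (w.length - 1)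
  rw [SimpleGraph.Walk.support_map] at h3
  obtain ⟨x, -, hx⟩ := List.mem_map.1 h3
  have hx' : (x : I) = SimpleGraph.Walk.penultimate
    (w.map (SimpleGraph.Embedding.induce (G := G) (J : Set I)).toHom) := by
    rw [SimpleGraph.Walk.penultimate, SimpleGraph.Walk.length_map]
    exact hx
  exact hx' ▸ x.2

/-- Descent from a vertex to its parent, as an induction principle: a property that holds at the
root and passes from the parent of a vertex to the vertex holds everywhere. -/
theorem par_induction (hc : G.Connected) (i : I) {P : I → Prop} (h0 : P i)
    (h1 : ∀ k, k ≠ i → P (par G i k) → P k) (k : I) : P k := by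
  induction hn : G.dist i k using Nat.strong_induction_on generalizing k with
  | _ n ih =>
    by_cases hk : k = i
    · exact hk ▸ h0
    · exact h1 k hk (ih _ (by have := (par_spec hc hk).2; omega) _ rfl)

end Rooted

/-! ### Star-shaped subtrees -/

section Star

set_option linter.unusedSectionVars false

variable {I : Type*} {G : SimpleGraph I}

/-- A vertex set `J` of the tree `G` is a star with centre `c` and set of tips `S` if `J \ {c}` is
the disjoint union of paths (the legs), each leading from a neighbour of `c` to an element of `S`;
`leg k` is the tip of the leg that contains `k`. -/
structure IsStar (G : SimpleGraph I) (J S : Finset I) (c : I) (leg : I → I) : Prop where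
  subset : S ⊆ J
  center_mem : c ∈ J
  leg_mem : ∀ k ∈ J, k ≠ c → leg k ∈ S
  par_mem : ∀ k ∈ J, k ≠ c → par G c k ∈ J
  leg_par : ∀ k ∈ J, k ≠ c → par G c k ≠ c → leg (par G c k) = leg k
  par_of_ne : ∀ k ∈ J, k ≠ c → ∀ s ∈ S, s ≠ leg k → k ≠ s ∧ par G s k = par G c k
  child : ∀ k ∈ J, k ≠ c → k ≠ leg k → par G (leg k) k ∈ J ∧ par G (leg k) k ≠ c ∧
    leg (par G (leg k) k) = leg k ∧ par G c (par G (leg k) k) = k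
  top : ∀ s ∈ S, s ≠ c → par G s c ∈ J ∧ par G s c ≠ c ∧ leg (par G s c) = s ∧
    par G c (par G s c) = c
  par_leg : ∀ k ∈ J, k ≠ c → par G c k ≠ leg k ∧ par G (leg k) (par G c k) = k

variable [DecidableEq I] [DecidableRel G.Adj]

theorem eq_of_degIn_eq_one {J : Finset I} {k q q' : I} (h : degIn G J k = 1) (hq : q ∈ J)
    (hqa : G.Adj k q) (hq' : q' ∈ J) (hqa' : G.Adj k q') : q = q' := by
  rw [degIn] at h
  exact Finset.card_le_one.1 h.le q (Finset.mem_filter.2 ⟨hq, hqa⟩) q'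
    (Finset.mem_filter.2 ⟨hq', hqa'⟩)

theorem exists_of_degIn_eq_two {J : Finset I} {k q : I} (h : degIn G J k = 2) (hq : q ∈ J)
    (hqa : G.Adj k q) : ∃ d ∈ J, G.Adj k d ∧ d ≠ q ∧ ∀ m ∈ J, G.Adj k m → m = q ∨ m = d := by
  rw [degIn, Finset.card_eq_two] at h
  obtain ⟨x, y, hxy, hJ⟩ := h
  have hmem : ∀ m, (m ∈ J ∧ G.Adj k m) ↔ (m = x ∨ m = y) := fun m => by
    rw [← Finset.mem_filter, hJ]; simp
  rcases (hmem q).1 ⟨hq, hqa⟩ with rfl | rfl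
  · have := (hmem y).2 (Or.inr rfl)
    exact ⟨y, this.1, this.2, hxy.symm, fun m hm hma => (hmem m).1 ⟨hm, hma⟩⟩
  · have := (hmem x).2 (Or.inl rfl)
    exact ⟨x, this.1, this.2, hxy, fun m hm hma => ((hmem m).1 ⟨hm, hma⟩).symm⟩

/-- A connected subset of a tree is a star if all its vertices outside `S` and apart from the
centre have degree two and the elements of `S` have degree one. -/
theorem exists_isStar (hT : G.IsTree) {J S : Finset I} {c : I} (hSJ : S ⊆ J) (hc : c ∈ J)
    (hJ : (G.induce (J : Set I)).Preconnected) (hS : ∀ k ∈ S, degIn G J k = 1)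
    (h2 : ∀ k ∈ J, k ∉ S → k ≠ c → degIn G J k = 2) : ∃ leg, IsStar G J S c leg := by
  have hpar : ∀ {i k}, i ∈ J → k ∈ J → k ≠ i → par G i k ∈ J ∧ G.Adj k (par G i k) :=
    fun hi hk h => ⟨par_mem hT hJ hi hk h, (par_spec hT.connected h).1⟩
  -- the vertices `s` lying beyond `k`, as seen from `c`
  let D : I → I → Prop := fun k s => k = s ∨ par G s k ≠ par G c k
  have hchild : ∀ k ∈ J, k ∉ S → k ≠ c → ∃ d ∈ J, d ≠ c ∧ par G c d = k ∧
      (∀ m ∈ J, G.Adj k m → m = par G c k ∨ m = d) ∧ G.Adj k d ∧ d ≠ par G c k ∧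
      ∀ s ∈ S, (D k s ↔ D d s) ∧ (D k s → par G s k = d) := by
    intro k hk hkS hkc
    obtain ⟨d, hdJ, hda, hdne, hall⟩ := exists_of_degIn_eq_two (h2 k hk hkS hkc)
      (hpar hc hk hkc).1 (hpar hc hk hkc).2
    obtain ⟨hdc, hdk⟩ := par_eq_of_ne hT hda hdne
    refine ⟨d, hdJ, hdc, hdk, hall, hda, hdne, fun s hs => ?_⟩
    have hks : k ≠ s := fun h => hkS (h ▸ hs)
    have hps := hpar (hSJ hs) hk hks
    have hD : D k s → par G s k = d := fun h =>
      (hall _ hps.1 hps.2).resolve_left (h.resolve_left hks)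
    refine ⟨⟨fun h => ?_, fun h => ?_⟩, hD⟩
    · have h3 := hD h
      by_cases hds : d = s
      · exact Or.inl hds
      · refine Or.inr ?_
        rw [hdk]
        have := par_par_ne hT hks (by rw [h3]; exact hds)
        rwa [h3] at this
    · refine Or.inr fun h3 => ?_
      obtain ⟨hds, hpd⟩ := par_eq_of_ne hT hda (by rw [h3]; exact hdne)
      rcases h with h | h
      · exact hds h
      · exact h (hpd.trans hdk.symm)
  have hSD : ∀ k ∈ S, k ≠ c → ∀ s ∈ S, D k s → k = s := by
    intro k hkS hkc s hs h
    by_contra hks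
    have h3 := hpar hc (hSJ hkS) hkc
    have h4 := hpar (hSJ hs) (hSJ hkS) hks
    exact (h.resolve_left hks) (eq_of_degIn_eq_one (hS k hkS) h4.1 h4.2 h3.1 h3.2)
  have hex : ∀ k ∈ J, k ≠ c → ∃ l ∈ S, D k l ∧ ∀ s ∈ S, D k s → s = l := by
    intro k
    induction hn : J.sup (G.dist c) - G.dist c k using Nat.strong_induction_on generalizing k with
    | _ n ih =>
      intro hk hkc
      by_cases hkS : k ∈ S
      · exact ⟨k, hkS, Or.inl rfl, fun s hs h => (hSD k hkS hkc s hs h).symm⟩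
      · obtain ⟨d, hdJ, hdc, hdk, -, -, -, hD⟩ := hchild k hk hkS hkc
        have h3 := (par_spec hT.connected hdc).2
        rw [hdk] at h3
        have h4 : G.dist c d ≤ J.sup (G.dist c) := Finset.le_sup hdJ
        obtain ⟨l, hl, hDl, huniq⟩ := ih _ (by omega) d rfl hdJ hdc
        exact ⟨l, hl, (hD l hl).1.2 hDl, fun s hs h => huniq s hs ((hD s hs).1.1 h)⟩
  choose! leg hlegS hlegD hleguniq using hex
  have hpc : ∀ k ∈ J, k ≠ c → ∀ s ∈ S, s ≠ leg k → k ≠ s ∧ par G s k = par G c k := by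
    intro k hk hkc s hs hne
    have h3 : ¬ D k s := fun h => hne (hleguniq k hk hkc s hs h)
    simp only [D, not_or, not_not] at h3
    exact h3
  refine ⟨leg, hSJ, hc, hlegS, fun k hk hkc => (hpar hc hk hkc).1, ?_, hpc, ?_, ?_, ?_⟩
  · intro k hk hkc hpk
    have h3 := hpar hc hk hkc
    have hqS : par G c k ∉ S := fun hqS => by
      have h4 := hpar hc h3.1 hpk
      exact par_par_ne hT hkc hpk (eq_of_degIn_eq_one (hS _ hqS) h4.1 h4.2 hk h3.2.symm)
    obtain ⟨d, hdJ, hdc, hdk, hall, -, -, hD⟩ := hchild _ h3.1 hqS hpk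
    have hkd : k = d := (hall k hk h3.2.symm).resolve_left fun h => par_par_ne hT hkc hpk h.symm
    have hl := hlegS k hk hkc
    exact (hleguniq _ h3.1 hpk _ hl ((hD _ hl).1.2 (hkd ▸ hlegD k hk hkc))).symm
  · intro k hk hkc hkl
    have hl := hlegS k hk hkc
    have hkS : k ∉ S := fun hkS => hkl (hSD k hkS hkc _ hl (hlegD k hk hkc))
    obtain ⟨d, hdJ, hdc, hdk, -, -, -, hD⟩ := hchild k hk hkS hkc
    have h3 := hD _ hl
    have h4 := h3.2 (hlegD k hk hkc)
    rw [h4]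
    exact ⟨hdJ, hdc, (hleguniq d hdJ hdc _ hl (h3.1.1 (hlegD k hk hkc))).symm, hdk⟩
  · intro s hs hsc
    have h3 := hpar (hSJ hs) hc (Ne.symm hsc)
    have htc : par G s c ≠ c := h3.2.ne'
    have h4 : par G c (par G s c) = c :=
      ((par_eq_or_par_eq hT c h3.2).resolve_left fun h => h.1 rfl).2
    refine ⟨h3.1, htc, ?_, h4⟩
    refine (hleguniq _ h3.1 htc s hs ?_).symm
    by_cases hts : par G s c = s
    · exact Or.inl hts
    · refine Or.inr ?_
      rw [h4]
      exact par_par_ne hT (Ne.symm hsc) hts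
  · intro k hk hkc
    have hl := hlegS k hk hkc
    have h3 := hpar hc hk hkc
    have h4 : ¬ (k ≠ leg k ∧ par G (leg k) k = par G c k) := fun h =>
      (hlegD k hk hkc).elim h.1 (fun h' => h' h.2)
    have h5 := (par_eq_or_par_eq hT (leg k) h3.2).resolve_left h4
    exact h5

end Star

/-! ### Partitions of a vertex set into rooted subtrees -/

section Owners

set_option linter.unusedSectionVars false

variable {I : Type*} [Fintype I] [DecidableEq I] (G : SimpleGraph I) (S : Finset I)

/-- A partial function `o : I → Option I` assigns to some vertices an owner. It is valid if all
owners lie in `S` and the set of vertices owned by `i` is a subtree rooted at `i`, i.e. is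
closed under passing to the parent with respect to the root `i`. -/
def IsValid (o : I → Option I) : Prop :=
  ∀ k i, o k = some i → i ∈ S ∧ (k ≠ i → o (par G i k) = some i)

/-- The partial function `o` is defined exactly on `J`. -/
def HasDom (o : I → Option I) (J : Finset I) : Prop := ∀ k, o k ≠ none ↔ k ∈ J

/-- The coordinates, with respect to tensor products of weight vectors, of the vectors of weight
`λ - ϑ_J` that are annihilated by all positive simple root vectors: complex functions on the
partitions of `J` into rooted subtrees such that, for all `k ∈ J` and all partitions of `J \ {k}`,
the values on the partitions of `J` that extend the given one add up to zero. -/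
def extensionKernel (J : Finset I) : Submodule ℂ ((I → Option I) → ℂ) where
  carrier := {x | (∀ o, ¬ (IsValid G S o ∧ HasDom o J) → x o = 0) ∧
    ∀ k ∈ J, ∀ o, IsValid G S o → HasDom o (J.erase k) →
      ∑ i, x (Function.update o k (some i)) = 0}
  add_mem' := by
    rintro x y ⟨hx, hx'⟩ ⟨hy, hy'⟩
    refine ⟨fun o ho => by simp [hx o ho, hy o ho], fun k hk o ho hd => ?_⟩
    simp [Finset.sum_add_distrib, hx' k hk o ho hd, hy' k hk o ho hd]
  zero_mem' := by simp
  smul_mem' := by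
    rintro a x ⟨hx, hx'⟩
    refine ⟨fun o ho => by simp [hx o ho], fun k hk o ho hd => ?_⟩
    simp [← Finset.mul_sum, hx' k hk o ho hd]

variable {G S}

theorem IsValid.root_eq (hc : G.Connected) {o : I → Option I} (ho : IsValid G S o) {k i : I}
    (h : o k = some i) : o i = some i := by
  revert h
  refine par_induction hc i (P := fun k => o k = some i → o i = some i) id ?_ k
  intro k hk ih h
  exact ih ((ho k i h).2 hk)

theorem HasDom.update {o : I → Option I} {J : Finset I} {k : I} (hk : k ∈ J)
    (ho : HasDom o (J.erase k)) (i : I) : HasDom (Function.update o k (some i)) J := by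
  intro m
  by_cases hm : m = k
  · subst hm; simp [hk]
  · rw [Function.update_of_ne hm, ho m, Finset.mem_erase]
    exact ⟨fun h => h.2, fun h => ⟨hm, h⟩⟩

theorem HasDom.update_none {o : I → Option I} {J : Finset I} (ho : HasDom o J) (k : I) :
    HasDom (Function.update o k none) (J.erase k) := by
  intro m
  by_cases hm : m = k
  · subst hm; simp
  · rw [Function.update_of_ne hm, ho m, Finset.mem_erase]
    exact ⟨fun h => ⟨hm, h⟩, fun h => h.2⟩

theorem HasDom.eq_none {o : I → Option I} {J : Finset I} (ho : HasDom o J) {k : I} (hk : k ∉ J) :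
    o k = none := by
  by_contra h
  exact hk ((ho k).1 h)

theorem HasDom.exists_eq {o : I → Option I} {J : Finset I} (ho : HasDom o J) {k : I}
    (hk : k ∈ J) : ∃ i, o k = some i :=
  Option.ne_none_iff_exists'.1 ((ho k).2 hk)

theorem HasDom.mem {o : I → Option I} {J : Finset I} (ho : HasDom o J) {k i : I}
    (hk : o k = some i) : k ∈ J :=
  (ho k).1 (by simp [hk])

theorem IsValid.update_iff {o : I → Option I} {k i : I} (ho : IsValid G S o) (hk : o k = none)
    (hpar : k ≠ i → par G i k ≠ k) :
    IsValid G S (Function.update o k (some i)) ↔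
      i ∈ S ∧ (k ≠ i → o (par G i k) = some i) := by
  constructor
  · intro h
    have h1 := h k i (by simp)
    refine ⟨h1.1, fun hki => ?_⟩
    have h2 := h1.2 hki
    rwa [Function.update_of_ne (hpar hki)] at h2
  · rintro ⟨hi, hp⟩ m j hmj
    by_cases hm : m = k
    · subst hm
      rw [Function.update_self] at hmj
      obtain rfl : i = j := by simpa using hmj
      refine ⟨hi, fun hne => ?_⟩
      rw [Function.update_of_ne (hpar hne)]
      exact hp hne
    · rw [Function.update_of_ne hm] at hmj
      obtain ⟨hj, hp'⟩ := ho m j hmj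
      refine ⟨hj, fun hne => ?_⟩
      have h3 := hp' hne
      have h4 : par G j m ≠ k := fun h => by rw [h, hk] at h3; cases h3
      rwa [Function.update_of_ne h4]

theorem IsValid.update_none {o : I → Option I} {k i : I} (ho : IsValid G S o) (hk : o k = some i)
    (h : ∀ m, m ≠ i → o m = some i → par G i m ≠ k) :
    IsValid G S (Function.update o k none) := by
  intro m j hmj
  by_cases hm : m = k
  · subst hm; simp at hmj
  · rw [Function.update_of_ne hm] at hmj
    obtain ⟨hj, hp⟩ := ho m j hmj
    refine ⟨hj, fun hne => ?_⟩
    have h1 := hp hne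
    rw [Function.update_of_ne, h1]
    intro h2
    rw [h2, hk] at h1
    obtain rfl : i = j := by simpa using h1
    exact h m hne hmj h2

theorem par_ne_self (hc : G.Connected) {i k : I} (h : k ≠ i) : par G i k ≠ k :=
  (par_spec hc h).1.ne'

/-- If `k ∈ J` has no neighbour in `J`, or has only one and is not in `S`, then a partition of
`J \ {k}` has at most one extension to `J`, so that the extension kernel vanishes. -/
theorem extensionKernel_eq_bot (hT : G.IsTree) {J : Finset I} {k : I} (hk : k ∈ J)
    (huniq : ∀ q ∈ J, G.Adj k q → k ∉ S ∧ ∀ q' ∈ J, G.Adj k q' → q' = q) :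
    extensionKernel G S J = ⊥ := by
  rw [eq_bot_iff]
  rintro x ⟨hx, hx'⟩
  rw [Submodule.mem_bot]
  funext o
  rw [Pi.zero_apply]
  by_cases ho : IsValid G S o ∧ HasDom o J
  swap
  · exact hx o ho
  obtain ⟨ho, hd⟩ := ho
  obtain ⟨i, hi⟩ := hd.exists_eq hk
  have hc := hT.connected
  have hv : IsValid G S (Function.update o k none) := by
    refine ho.update_none hi fun m hm hom hpm => ?_
    have hadj : G.Adj k m := hpm ▸ (par_spec hc hm).1.symm
    have hmJ := hd.mem hom
    obtain ⟨hkS, hq⟩ := huniq m hmJ hadj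
    have hki : k ≠ i := fun h => hkS (h ▸ (ho k i hi).1)
    have h1 := hq _ (hd.mem ((ho k i hi).2 hki)) (par_spec hc hki).1
    rw [← hpm] at h1 hki
    exact par_par_ne hT hm hki h1
  have hsum := hx' k hk _ hv (hd.update_none k)
  rw [Finset.sum_eq_single i] at hsum
  · rwa [Function.update_idem, ← hi, Function.update_eq_self] at hsum
  · intro j _ hji
    apply hx
    rintro ⟨hvj, -⟩
    rw [IsValid.update_iff hv (by simp) (fun h => par_ne_self hc h)] at hvj
    obtain ⟨hjS, hp⟩ := hvj
    by_cases hkj : k = j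
    · subst hkj
      have hki : k ≠ i := hji
      have h1 := (ho k i hi).2 hki
      exact (huniq _ (hd.mem h1) (par_spec hc hki).1).1 hjS
    · have h1 := hp hkj
      rw [Function.update_of_ne (par_ne_self hc hkj)] at h1
      obtain ⟨hkS, hq⟩ := huniq _ (hd.mem h1) (par_spec hc hkj).1
      have hki : k ≠ i := fun h => hkS (h ▸ (ho k i hi).1)
      have h2 := (ho k i hi).2 hki
      rw [hq _ (hd.mem h2) (par_spec hc hki).1, h1] at h2
      exact hji (by simpa using h2)
  · simp

theorem finrank_extensionKernel_empty : Module.finrank ℂ (extensionKernel G S ∅) = 1 := by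
  set o₀ : I → Option I := fun _ => none with ho₀
  have hdom : ∀ o : I → Option I, HasDom o ∅ → o = o₀ := fun o ho => by
    funext k
    exact ho.eq_none (by simp)
  have hv : IsValid G S o₀ := fun k i h => by simp [ho₀] at h
  have hd : HasDom o₀ ∅ := fun k => by simp [ho₀]
  have hmem : (Pi.single o₀ 1 : (I → Option I) → ℂ) ∈ extensionKernel G S ∅ := by
    refine ⟨fun o ho => ?_, by simp⟩
    refine Pi.single_eq_of_ne ?_ _
    rintro rfl
    exact ho ⟨hv, hd⟩
  refine finrank_eq_one (⟨_, hmem⟩ : extensionKernel G S ∅) ?_ ?_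
  · intro h
    have := congrFun (congrArg Subtype.val h) o₀
    simp at this
  · rintro ⟨x, hx⟩
    refine ⟨x o₀, Subtype.ext ?_⟩
    funext o
    by_cases ho : o = o₀
    · subst ho; simp
    · have h1 : x o = 0 := hx.1 o fun h => ho (hdom o h.2)
      simp [h1, Pi.single_eq_of_ne ho]

/-- If there is a nonzero element of the extension kernel, then the vertices of `J` outside `S`
have at least two neighbours in `J`, and those in `S` have at least one. -/
theorem degIn_of_extensionKernel_ne_bot [DecidableRel G.Adj] (hT : G.IsTree) {J : Finset I}
    (h : extensionKernel G S J ≠ ⊥) :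
    (∀ k ∈ J, k ∉ S → 2 ≤ degIn G J k) ∧ ∀ k ∈ J, k ∈ S → 1 ≤ degIn G J k := by
  constructor
  · intro k hk hkS
    by_contra hlt
    refine h (extensionKernel_eq_bot hT hk fun q hq hqa => ⟨hkS, fun q' hq' hqa' => ?_⟩)
    have : degIn G J k ≤ 1 := by omega
    exact Finset.card_le_one.1 this q' (Finset.mem_filter.2 ⟨hq', hqa'⟩) q
      (Finset.mem_filter.2 ⟨hq, hqa⟩)
  · intro k hk _
    by_contra hlt
    refine h (extensionKernel_eq_bot hT hk fun q hq hqa => ?_)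
    have : 0 < degIn G J k := Finset.card_pos.2 ⟨q, Finset.mem_filter.2 ⟨hq, hqa⟩⟩
    omega

end Owners

section StarKernel

set_option linter.unusedSectionVars false

variable {I : Type*} [Fintype I] [DecidableEq I] {G : SimpleGraph I} {S J : Finset I}
  {c : I} {leg : I → I}

/-- The partition of a star into its legs, the centre being owned by the tip `s`. -/
def legPartition (J : Finset I) (c : I) (leg : I → I) (s : I) : I → Option I := fun k =>
  if k ∈ J then (if k = c then some s else some (leg k)) else none

/-- The number of vertices of a star, other than the centre, that do not belong to the tip of
their leg. -/
def defect (J : Finset I) (c : I) (leg : I → I) (o : I → Option I) : ℕ :=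
  ((J.erase c).filter fun k => o k ≠ some (leg k)).card

theorem legPartition_center (hc : c ∈ J) (s : I) : legPartition J c leg s c = some s := by
  simp [legPartition, hc]

theorem legPartition_of_ne {k : I} (hk : k ∈ J) (hkc : k ≠ c) (s : I) :
    legPartition J c leg s k = some (leg k) := by
  simp [legPartition, hk, hkc]

theorem hasDom_legPartition (s : I) : HasDom (legPartition J c leg s) J := by
  intro k
  unfold legPartition
  split_ifs <;> simp_all

theorem defect_legPartition (s : I) : defect J c leg (legPartition J c leg s) = 0 := by
  rw [defect, Finset.card_eq_zero, Finset.filter_eq_empty_iff]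
  intro k hk
  rw [Finset.mem_erase] at hk
  simp [legPartition_of_ne hk.2 hk.1]

theorem eq_legPartition {o : I → Option I} (hd : HasDom o J) (h0 : defect J c leg o = 0) {s : I}
    (hs : o c = some s) : o = legPartition J c leg s := by
  rw [defect, Finset.card_eq_zero, Finset.filter_eq_empty_iff] at h0
  funext k
  by_cases hk : k ∈ J
  · by_cases hkc : k = c
    · subst hkc
      rw [hs, legPartition_center hk]
    · rw [legPartition_of_ne hk hkc]
      have := h0 (Finset.mem_erase.2 ⟨hkc, hk⟩)
      simpa using this
  · rw [hd.eq_none hk, (hasDom_legPartition s).eq_none hk]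

theorem defect_update {o : I → Option I} {k i : I} (hk : k ∈ J) (hkc : k ≠ c)
    (hi : i ≠ leg k) :
    defect J c leg (Function.update o k (some i))
      = defect J c leg (Function.update o k (some (leg k))) + 1 := by
  have hkm : k ∈ J.erase c := Finset.mem_erase.2 ⟨hkc, hk⟩
  have h : (J.erase c).filter (fun m => Function.update o k (some i) m ≠ some (leg m))
      = insert k ((J.erase c).filter
        fun m => Function.update o k (some (leg k)) m ≠ some (leg m)) := by
    ext m
    by_cases hm : m = k
    · subst hm
      have h1 := Finset.mem_erase.1 hkm
      simp [h1.1, h1.2, hi]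
    · simp [hm]
  rw [defect, h, Finset.card_insert_of_notMem, defect]
  simp

variable (hT : G.IsTree) (hS : IsStar G J (J ∩ S) c leg)
include hT hS

theorem IsStar.isValid_legPartition {s : I} (hs : s ∈ J ∩ S) :
    IsValid G S (legPartition J c leg s) := by
  intro k i hki
  have hk := (hasDom_legPartition s).mem hki
  by_cases hkc : k = c
  · subst hkc
    rw [legPartition_center hk] at hki
    obtain rfl : s = i := by simpa using hki
    refine ⟨(Finset.mem_inter.1 hs).2, fun hks => ?_⟩
    obtain ⟨h1, h2, h3, -⟩ := hS.top s hs (Ne.symm hks)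
    rw [legPartition_of_ne h1 h2, h3]
  · rw [legPartition_of_ne hk hkc] at hki
    obtain rfl : leg k = i := by simpa using hki
    refine ⟨(Finset.mem_inter.1 (hS.leg_mem k hk hkc)).2, fun hne => ?_⟩
    obtain ⟨h1, h2, h3, -⟩ := hS.child k hk hkc hne
    rw [legPartition_of_ne h1 h2, h3]

theorem IsStar.owner_mem {o : I → Option I} {K : Finset I} (hK : K ⊆ J) (ho : IsValid G S o)
    (hd : HasDom o K) {k i : I} (h : o k = some i) : i ∈ J ∩ S :=
  Finset.mem_inter.2 ⟨hK (hd.mem (ho.root_eq hT.connected h)), (ho k i h).1⟩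

/-- A vertex not owned by the tip of its leg has the same owner as its parent. -/
theorem IsStar.par_owner {o : I → Option I} {K : Finset I} (hK : K ⊆ J) (ho : IsValid G S o)
    (hd : HasDom o K) {k i : I} (hkc : k ≠ c) (h : o k = some i) (hi : i ≠ leg k) :
    o (par G c k) = some i := by
  have h1 := hS.par_of_ne k (hK (hd.mem h)) hkc i (hS.owner_mem hT hK ho hd h) hi
  rw [← h1.2]
  exact (ho k i h).2 h1.1

/-- If the centre has no owner, then all vertices are owned by the tips of their legs. -/
theorem IsStar.owner_eq_leg {o : I → Option I} {K : Finset I} (hK : K ⊆ J) (ho : IsValid G S o)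
    (hd : HasDom o K) (hc : c ∉ K) {k i : I} (h : o k = some i) : i = leg k := by
  have key : k ≠ c → ∀ i, o k = some i → i = leg k := by
    refine par_induction hT.connected c (P := fun k => k ≠ c → ∀ i, o k = some i → i = leg k)
      (fun h => absurd rfl h) (fun k hkc ih _ i h => ?_) k
    by_contra hi
    have h1 := hS.par_owner hT hK ho hd hkc h hi
    have h2 : par G c k ≠ c := fun h2 => hc (hd.mem (h2 ▸ h1))
    exact hi ((ih h2 i h1).trans (hS.leg_par k (hK (hd.mem h)) hkc h2))
  exact key (fun h' => hc (h' ▸ hd.mem h)) i h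

/-- If `k` has no owner, then the tip of its leg owns neither the parent of `k` nor the centre. -/
theorem IsStar.owner_above {o : I → Option I} {K : Finset I} (ho : IsValid G S o)
    (hd : HasDom o K) {k : I} (hk : k ∈ J) (hkK : k ∉ K) (hkc : k ≠ c) :
    o (par G c k) ≠ some (leg k) ∧ o c ≠ some (leg k) := by
  have step : ∀ m ∈ J, m ≠ c → o m ≠ some (leg m) → o (par G c m) ≠ some (leg m) := by
    intro m hm hmc h h1
    obtain ⟨h2, h3⟩ := hS.par_leg m hm hmc
    have h4 := (ho _ _ h1).2 h2
    rw [h3] at h4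
    exact h h4
  have key : ∀ m, m ∈ J → m ≠ c → o m ≠ some (leg m) → o c ≠ some (leg m) := by
    refine par_induction hT.connected c (fun _ h => absurd rfl h) fun m hmc ih hm _ h => ?_
    have h1 := step m hm hmc h
    by_cases hpc : par G c m = c
    · rwa [hpc] at h1
    · have h2 := hS.leg_par m hm hmc hpc
      rw [← h2] at h1 ⊢
      exact ih (hS.par_mem m hm hmc) hpc h1
  have h0 : o k ≠ some (leg k) := by rw [hd.eq_none hkK]; simp
  exact ⟨step k hk hkc h0, key k hk hkc h0⟩

/-- A partition of `J \ {k}`, with `k` not the centre, has exactly two extensions to `J`: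
one gives `k` to the tip of its leg, the other to the owner of its parent. -/
theorem IsStar.isValid_update_iff {o : I → Option I} (ho : IsValid G S o) {k : I} (hk : k ∈ J)
    (hd : HasDom o (J.erase k)) (hkc : k ≠ c) (i : I) :
    IsValid G S (Function.update o k (some i)) ↔ i = leg k ∨ o (par G c k) = some i := by
  have hpar : k ≠ i → par G i k ≠ k := par_ne_self hT.connected
  have hkn : o k = none := hd.eq_none (by simp)
  have hK : J.erase k ⊆ J := Finset.erase_subset _ _
  rw [ho.update_iff hkn hpar]
  have hl := hS.leg_mem k hk hkc
  by_cases hi : i = leg k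
  · simp only [hi, true_or, iff_true]
    refine ⟨(Finset.mem_inter.1 hl).2, fun hkl => ?_⟩
    obtain ⟨h1, h2, h3, h4⟩ := hS.child k hk hkc hkl
    have h5 : par G (leg k) k ∈ J.erase k := Finset.mem_erase.2 ⟨par_ne_self hT.connected hkl, h1⟩
    obtain ⟨j, hj⟩ := hd.exists_eq h5
    rw [hj]
    by_contra hne
    have h6 := hS.par_owner hT hK ho hd h2 hj (by rw [h3]; simpa using hne)
    rw [h4, hkn] at h6
    cases h6
  · simp only [hi, false_or]
    constructor
    · rintro ⟨hiS, hp⟩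
      by_cases hki : k = i
      · subst hki
        have h1 := (hS.par_of_ne k hk hkc k (Finset.mem_inter.2 ⟨hk, hiS⟩) hi).1
        exact absurd rfl h1
      · have h1 := hp hki
        have h2 := hS.owner_mem hT hK ho hd h1
        rwa [(hS.par_of_ne k hk hkc i h2 hi).2] at h1
    · intro h1
      have h2 := hS.owner_mem hT hK ho hd h1
      refine ⟨(Finset.mem_inter.1 h2).2, fun _ => ?_⟩
      rwa [(hS.par_of_ne k hk hkc i h2 hi).2]

/-- On a star, an element of the extension kernel is determined by its values on the partitions
into legs. -/
theorem IsStar.apply_eq {x : (I → Option I) → ℂ} (hx : x ∈ extensionKernel G S J)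
    {o : I → Option I} (ho : IsValid G S o) (hd : HasDom o J) {s : I} (hs : o c = some s) :
    x o = (-1) ^ defect J c leg o * x (legPartition J c leg s) := by
  induction hn : defect J c leg o generalizing o with
  | zero => rw [eq_legPartition hd hn hs]; simp
  | succ n ih =>
    -- reassign the outermost vertex not owned by the tip of its leg
    have hne : ((J.erase c).filter fun k => o k ≠ some (leg k)).Nonempty := by
      rw [← Finset.card_pos, ← defect, hn]; omega
    obtain ⟨k, hk, hmax⟩ := Finset.exists_max_image _ (G.dist c) hne
    obtain ⟨hkJc, hkl⟩ := Finset.mem_filter.1 hk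
    obtain ⟨hkc, hkJ⟩ := Finset.mem_erase.1 hkJc
    obtain ⟨i, hi⟩ := hd.exists_eq hkJ
    have hil : i ≠ leg k := fun h => hkl (by rw [hi, h])
    have hiS := hS.owner_mem hT subset_rfl ho hd hi
    have h1 := hS.par_of_ne k hkJ hkc i hiS hil
    have hv : IsValid G S (Function.update o k none) := by
      refine ho.update_none hi fun m hmi hom hpm => ?_
      have hmk : G.Adj k m := hpm ▸ (par_spec hT.connected hmi).1.symm
      have hmp : m ≠ par G c k := by
        rw [← h1.2]
        rintro rfl
        exact par_par_ne hT h1.1 hmi hpm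
      obtain ⟨hmc, hpc⟩ := par_eq_of_ne hT hmk hmp
      have hmJ := hd.mem hom
      have hleg : leg m = leg k := by
        have := hS.leg_par m hmJ hmc (by rwa [hpc])
        rw [← this, hpc]
      have h2 := hmax m (Finset.mem_filter.2 ⟨Finset.mem_erase.2 ⟨hmc, hmJ⟩, by
        rw [hom, hleg]; simpa using hil⟩)
      have h3 := (par_spec hT.connected hmc).2
      rw [hpc] at h3
      omega
    have hd' := hd.update_none k
    have hsum := hx.2 k hkJ _ hv hd'
    have hupd : ∀ j, IsValid G S (Function.update (Function.update o k none) k (some j)) ↔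
        j = leg k ∨ j = i := fun j => by
      rw [hS.isValid_update_iff hT hv hkJ hd' hkc j,
        Function.update_of_ne (par_ne_self hT.connected hkc),
        hS.par_owner hT subset_rfl ho hd hkc hi hil]
      simp [eq_comm]
    rw [← Finset.sum_subset (Finset.subset_univ {leg k, i}), Finset.sum_pair (Ne.symm hil)] at hsum
    swap
    · intro j _ hj
      refine hx.1 _ fun h => hj ?_
      rw [hupd] at h
      simpa using h.1
    rw [Function.update_idem, Function.update_idem] at hsum
    have hoi : Function.update o k (some i) = o := by rw [← hi, Function.update_eq_self]
    rw [hoi] at hsum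
    have hdef := defect_update (o := o) hkJ hkc hil
    rw [hoi, hn] at hdef
    have hvl := (hupd (leg k)).2 (Or.inl rfl)
    rw [Function.update_idem] at hvl
    have hdl : HasDom (Function.update o k (some (leg k))) J := by
      have := HasDom.update hkJ hd' (leg k)
      rwa [Function.update_idem] at this
    have h2 := ih hvl hdl (by rwa [Function.update_of_ne (Ne.symm hkc)]) (by omega)
    rw [h2] at hsum
    rw [eq_neg_of_add_eq_zero_right hsum]
    ring

open scoped Classical in
/-- The element of the extension kernel of a star with prescribed values on the partitions into
legs. -/
theorem IsStar.mem_extensionKernel {y : I → ℂ} (hy : ∀ i ∉ J ∩ S, y i = 0)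
    (hsum : ∑ i, y i = 0) :
    (fun o : I → Option I => if IsValid G S o ∧ HasDom o J then
      (-1) ^ defect J c leg o * (o c).elim 0 y else 0) ∈ extensionKernel G S J := by
  refine ⟨fun o ho => if_neg ho, fun k hk o ho hd => ?_⟩
  have hK : J.erase k ⊆ J := Finset.erase_subset _ _
  have hkn : o k = none := hd.eq_none (by simp)
  by_cases hkc : k = c
  · subst hkc
    have hterm : ∀ i, (if IsValid G S (Function.update o k (some i)) ∧
        HasDom (Function.update o k (some i)) J then
        (-1) ^ defect J k leg (Function.update o k (some i)) *
          (Function.update o k (some i) k).elim 0 y else 0)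
        = (-1) ^ defect J k leg o * y i := by
      intro i
      have h1 : defect J k leg (Function.update o k (some i)) = defect J k leg o := by
        unfold defect
        congr 1
        refine Finset.filter_congr fun m hm => ?_
        rw [Function.update_of_ne (Finset.mem_erase.1 hm).1]
      rw [h1, Function.update_self]
      split_ifs with h
      · rfl
      · suffices y i = 0 by simp [this]
        apply hy
        intro hi
        refine h ⟨?_, HasDom.update hk hd i⟩
        rw [ho.update_iff hkn (par_ne_self hT.connected)]
        refine ⟨(Finset.mem_inter.1 hi).2, fun hki => ?_⟩
        obtain ⟨h2, h3, h4, -⟩ := hS.top i hi (Ne.symm hki)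
        obtain ⟨j, hj⟩ := hd.exists_eq (Finset.mem_erase.2 ⟨h3, h2⟩)
        rw [hj, hS.owner_eq_leg hT hK ho hd (by simp) hj, h4]
    rw [Finset.sum_congr rfl fun i _ => hterm i, ← Finset.mul_sum, hsum, mul_zero]
  · have hpJ : par G c k ∈ J.erase k :=
      Finset.mem_erase.2 ⟨par_ne_self hT.connected hkc, hS.par_mem k hk hkc⟩
    obtain ⟨j, hj⟩ := hd.exists_eq hpJ
    obtain ⟨hab, -⟩ := hS.owner_above hT ho hd hk (by simp) hkc
    have hjl : j ≠ leg k := fun h => hab (by rw [hj, h])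
    have hv : ∀ i, IsValid G S (Function.update o k (some i)) ↔ i = leg k ∨ i = j := fun i => by
      rw [hS.isValid_update_iff hT ho hk hd hkc i, hj]
      simp [eq_comm]
    rw [← Finset.sum_subset (Finset.subset_univ {leg k, j}), Finset.sum_pair (Ne.symm hjl)]
    swap
    · intro i _ hi
      refine if_neg fun h => hi ?_
      rw [hv] at h
      simpa using h.1
    beta_reduce
    rw [if_pos ⟨(hv _).2 (Or.inl rfl), HasDom.update hk hd _⟩,
      if_pos ⟨(hv _).2 (Or.inr rfl), HasDom.update hk hd _⟩, defect_update hk hkc hjl,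
      Function.update_of_ne (Ne.symm hkc), Function.update_of_ne (Ne.symm hkc)]
    ring

/-- The extension kernel of a star with set of tips `J ∩ S` has dimension `#(J ∩ S) - 1`: by
evaluation at the partitions into legs it is identified with the
functions on the tips whose values add up to zero. -/
theorem IsStar.finrank_extensionKernel (hne : (J ∩ S).Nonempty) :
    Module.finrank ℂ (extensionKernel G S J) + 1 = (J ∩ S).card := by
  classical
  set T := J ∩ S with hTdef
  let φ : (T → ℂ) →ₗ[ℂ] ℂ := ∑ t, LinearMap.proj t
  have hφ : ∀ y, φ y = ∑ t, y t := fun y => by simp [φ]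
  let ev : extensionKernel G S J →ₗ[ℂ] (T → ℂ) :=
    { toFun := fun x t => x.1 (legPartition J c leg t)
      map_add' := fun x y => rfl
      map_smul' := fun a x => rfl }
  have hc := hS.center_mem
  have hinj : Function.Injective ev := by
    rw [← LinearMap.ker_eq_bot, LinearMap.ker_eq_bot']
    rintro ⟨x, hx⟩ h0
    refine Subtype.ext (funext fun o => ?_)
    by_cases ho : IsValid G S o ∧ HasDom o J
    · obtain ⟨s, hs⟩ := ho.2.exists_eq hc
      have h1 := hS.apply_eq hT hx ho.1 ho.2 hs
      have h2 : x (legPartition J c leg s) = 0 :=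
        congrFun h0 ⟨s, hS.owner_mem hT subset_rfl ho.1 ho.2 hs⟩
      simpa [h2] using h1
    · exact hx.1 o ho
  have hrange : LinearMap.range ev = LinearMap.ker φ := by
    ext y
    rw [LinearMap.mem_ker, hφ]
    constructor
    · rintro ⟨⟨x, hx⟩, rfl⟩
      -- the relation at the centre
      obtain ⟨s, hs⟩ := hne
      have hvs := hS.isValid_legPartition hT hs
      have hds := hasDom_legPartition (J := J) (c := c) (leg := leg) s
      have hv : IsValid G S (Function.update (legPartition J c leg s) c none) := by
        refine hvs.update_none (legPartition_center hc s) fun m hms hm hpm => ?_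
        have hmJ := hds.mem hm
        have hmc : m ≠ c := by
          rintro rfl
          exact par_ne_self hT.connected hms hpm
        rw [legPartition_of_ne hmJ hmc] at hm
        obtain rfl : leg m = s := by simpa using hm
        obtain ⟨h1, -, -, h4⟩ := hS.child m hmJ hmc hms
        rw [hpm] at h4
        exact (hS.child m hmJ hmc hms).2.1 hpm
      have h1 := hx.2 c hc _ hv (hds.update_none c)
      have hupd : ∀ i, Function.update (Function.update (legPartition J c leg s) c none) c (some i)
          = legPartition J c leg i := by
        intro i
        rw [Function.update_idem]
        funext k
        by_cases hkc : k = c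
        · subst hkc; rw [Function.update_self, legPartition_center hc]
        · rw [Function.update_of_ne hkc]
          simp [legPartition, hkc]
      simp only [hupd] at h1
      rw [← Finset.sum_subset (Finset.subset_univ T)] at h1
      · rw [← h1, ← Finset.sum_coe_sort T]
        rfl
      · intro i _ hi
        refine hx.1 _ fun h => hi ?_
        exact hS.owner_mem hT subset_rfl h.1 h.2 (legPartition_center hc i)
    · intro h0
      let y' : I → ℂ := fun i => if h : i ∈ T then y ⟨i, h⟩ else 0
      have hy' : ∀ i ∉ J ∩ S, y' i = 0 := fun i hi => dif_neg hi
      have hsum : ∑ i, y' i = 0 := by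
        rw [← Finset.sum_subset (Finset.subset_univ T) fun i _ hi => hy' i hi,
          ← Finset.sum_coe_sort T, ← h0]
        exact Finset.sum_congr rfl fun t _ => by simp [y']
      refine ⟨⟨_, hS.mem_extensionKernel hT hy' hsum⟩, ?_⟩
      funext t
      change (if _ then _ else _) = _
      rw [if_pos ⟨hS.isValid_legPartition hT t.2, hasDom_legPartition _⟩, defect_legPartition,
        legPartition_center hc]
      simp [y']
  have h1 := LinearMap.finrank_range_add_finrank_ker φ
  have h2 : LinearMap.range φ = ⊤ := by
    rw [LinearMap.range_eq_top]
    intro a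
    obtain ⟨s, hs⟩ := hne
    exact ⟨Pi.single ⟨s, hs⟩ a, by rw [hφ]; simp⟩
  rw [h2, finrank_top, Module.finrank_self, Module.finrank_fintype_fun_eq_card,
    Fintype.card_coe] at h1
  rw [← LinearMap.finrank_range_of_inj hinj, hrange, add_comm]
  exact h1

end StarKernel

/-! ### Invariants of finite-dimensional modules -/

section Invariants

open LieModule Module

attribute [local instance 100] LieRing.ofAssociativeRing

variable {L : Type*} [LieRing L] [LieAlgebra ℂ L] [FiniteDimensional ℂ L]

section Casimir

variable (M : Type*) [AddCommGroup M] [Module ℂ M] [LieRingModule L M] [LieModule ℂ L M]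

/-- The Casimir operator on `M` of a nondegenerate bilinear form `B` on `L`: the sum of
`x_a ∘ x^a` over a basis `x_a` of `L` and its `B`-dual basis `x^a`. -/
def casimir (B : LinearMap.BilinForm ℂ L) (hB : B.Nondegenerate) : Module.End ℂ M :=
  ∑ a, toEnd ℂ L M (B.dualBasis hB (finBasis ℂ L) a) ∘ₗ toEnd ℂ L M (finBasis ℂ L a)

variable {M}

theorem casimir_apply (B : LinearMap.BilinForm ℂ L) (hB : B.Nondegenerate) (m : M) :
    casimir M B hB m
      = ∑ a, ⁅B.dualBasis hB (finBasis ℂ L) a, ⁅finBasis ℂ L a, m⁆⁆ := by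
  simp [casimir, LinearMap.sum_apply]

theorem lie_casimir (B : LinearMap.BilinForm ℂ L) (hB : B.Nondegenerate)
    (hi : ∀ x y z : L, B ⁅x, y⁆ z = - B y ⁅x, z⁆) (x : L) (m : M) :
    ⁅x, casimir M B hB m⁆ = casimir M B hB ⁅x, m⁆ := by
  classical
  set b := finBasis ℂ L with hb
  set d := B.dualBasis hB b with hd
  have hdb : ∀ i j, B (d i) (b j) = if j = i then 1 else 0 :=
    LinearMap.BilinForm.apply_dualBasis_left hB b
  have exp_b : ∀ y, y = ∑ c, B (d c) y • b c := fun y => by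
    conv_lhs => rw [← b.sum_repr y]
    refine Finset.sum_congr rfl fun c _ => ?_
    congr 1
    have := congrArg (B (d c)) (b.sum_repr y)
    simpa only [map_sum, map_smul, hdb, smul_eq_mul, mul_ite, mul_one, mul_zero,
      Finset.sum_ite_eq', Finset.mem_univ, if_true] using this
  have exp_d : ∀ y, y = ∑ c, B y (b c) • d c := fun y => by
    conv_lhs => rw [← d.sum_repr y]
    refine Finset.sum_congr rfl fun c _ => ?_
    congr 1
    have := congrArg (fun z => B z (b c)) (d.sum_repr y)
    simpa only [map_sum, map_smul, LinearMap.sum_apply, LinearMap.smul_apply, hdb, smul_eq_mul,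
      mul_ite, mul_one, mul_zero, Finset.sum_ite_eq, Finset.mem_univ, if_true] using this
  have key : ∑ a, (⁅⁅x, d a⁆, ⁅b a, m⁆⁆ + ⁅d a, ⁅⁅x, b a⁆, m⁆⁆) = 0 := by
    have h1 : ∀ a, ⁅⁅x, d a⁆, ⁅b a, m⁆⁆ = ∑ c, B ⁅x, d a⁆ (b c) • ⁅d c, ⁅b a, m⁆⁆ := fun a => by
      conv_lhs => rw [exp_d ⁅x, d a⁆]
      simp [sum_lie]
    have h2 : ∀ a, ⁅d a, ⁅⁅x, b a⁆, m⁆⁆ = ∑ c, B (d c) ⁅x, b a⁆ • ⁅d a, ⁅b c, m⁆⁆ := fun a => by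
      conv_lhs => rw [exp_b ⁅x, b a⁆]
      simp [sum_lie, lie_sum]
    rw [Finset.sum_add_distrib, Finset.sum_congr rfl fun a _ => h1 a,
      Finset.sum_congr rfl fun a _ => h2 a, Finset.sum_comm, ← Finset.sum_add_distrib]
    refine Finset.sum_eq_zero fun a _ => ?_
    rw [← Finset.sum_add_distrib]
    refine Finset.sum_eq_zero fun c _ => ?_
    rw [hi, ← add_smul, neg_add_cancel, zero_smul]
  rw [casimir_apply, casimir_apply, lie_sum, ← sub_eq_zero, ← Finset.sum_sub_distrib, ← key]
  refine Finset.sum_congr rfl fun a _ => ?_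
  rw [← hb, ← hd, leibniz_lie x (d a), leibniz_lie x (b a), lie_add]
  abel

end Casimir

variable [LieAlgebra.IsSimple ℂ L]

omit [FiniteDimensional ℂ L] in
theorem derivedSeries_one_eq_top : LieAlgebra.derivedSeries ℂ L 1 = ⊤ := by
  rcases LieAlgebra.IsSimple.eq_bot_or_eq_top (R := ℂ) (LieAlgebra.derivedSeries ℂ L 1) with h | h
  · exfalso
    apply LieAlgebra.IsSimple.non_abelian (R := ℂ) (L := L)
    rw [LieAlgebra.derivedSeries_def, LieAlgebra.derivedSeriesOfIdeal_succ,
      LieAlgebra.derivedSeriesOfIdeal_zero] at h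
    refine ⟨fun x y => ?_⟩
    have : ⁅x, y⁆ ∈ (⁅(⊤ : LieIdeal ℂ L), (⊤ : LieIdeal ℂ L)⁆ : LieIdeal ℂ L) :=
      LieSubmodule.lie_mem_lie trivial trivial
    rw [h] at this
    simpa using this
  · exact h

/-- The trace form of a nontrivial irreducible module over a simple Lie algebra is nondegenerate. -/
theorem traceForm_nondegenerate {N : Type*} [AddCommGroup N] [Module ℂ N] [LieRingModule L N]
    [LieModule ℂ L N] [FiniteDimensional ℂ N]
    (hirr : ∀ N' : LieSubmodule ℂ L N, N' = ⊥ ∨ N' = ⊤) (htriv : ∃ (x : L) (n : N), ⁅x, n⁆ ≠ 0) :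
    (traceForm ℂ L N).Nondegenerate := by
  obtain ⟨x, n, hxn⟩ := htriv
  let K : LieIdeal ℂ L :=
    { LinearMap.ker (traceForm ℂ L N) with
      lie_mem := by
        intro x m hm
        change traceForm ℂ L N m = 0 at hm
        change traceForm ℂ L N ⁅x, m⁆ = 0
        ext z
        rw [← lie_skew, map_neg, LinearMap.neg_apply, traceForm_apply_lie_apply, hm]
        simp }
  rcases LieAlgebra.IsSimple.eq_bot_or_eq_top (R := ℂ) K with h | h
  · have : K.toSubmodule = ⊥ := by rw [h]; rfl
    exact LinearMap.BilinForm.nondegenerate_iff_ker_eq_bot.2 this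
  · exfalso
    have h0 : traceForm ℂ L N = 0 := by
      ext y
      have : y ∈ K := by rw [h]; trivial
      have : traceForm ℂ L N y = 0 := this
      rw [this]; rfl
    have h1 := isNilpotent_derivedSeries_of_traceForm_eq_zero h0
    have h2 : LieModule.IsNilpotent L N := by
      rw [isNilpotent_iff_forall' (R := ℂ)] at h1 ⊢
      intro y
      exact h1 ⟨y, by rw [derivedSeries_one_eq_top]; trivial⟩
    have : Nontrivial N := ⟨⁅x, n⁆, 0, hxn⟩
    have h3 := nontrivial_max_triv_of_isNilpotent ℂ L N
    rcases hirr (maxTrivSubmodule ℂ L N) with h4 | h4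
    · rw [h4] at h3
      exact not_subsingleton (⊥ : LieSubmodule ℂ L N) inferInstance
    · have : n ∈ maxTrivSubmodule ℂ L N := by rw [h4]; trivial
      exact hxn ((mem_maxTrivSubmodule _ _ _ _).1 this x)

/-- On a nontrivial irreducible module the Casimir operator of its trace form is injective: its
trace is `dim L ≠ 0`, and its kernel is a submodule. -/
theorem casimir_injective {N : Type*} [AddCommGroup N] [Module ℂ N] [LieRingModule L N]
    [LieModule ℂ L N] [FiniteDimensional ℂ N]
    (hirr : ∀ N' : LieSubmodule ℂ L N, N' = ⊥ ∨ N' = ⊤)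
    (hB : (traceForm ℂ L N).Nondegenerate) (n : N)
    (hn : casimir N (traceForm ℂ L N) hB n = 0) : n = 0 := by
  classical
  have hcomm := lie_casimir (M := N) (traceForm ℂ L N) hB
    (fun x y z => by rw [← lie_skew, map_neg, LinearMap.neg_apply, traceForm_apply_lie_apply])
  let K : LieSubmodule ℂ L N :=
    { LinearMap.ker (casimir N (traceForm ℂ L N) hB) with
      lie_mem := by
        intro x m hm
        change casimir N (traceForm ℂ L N) hB m = 0 at hm
        change casimir N (traceForm ℂ L N) hB ⁅x, m⁆ = 0
        rw [← hcomm, hm, lie_zero] }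
  have hnK : n ∈ K := hn
  rcases hirr K with h | h
  · rw [h] at hnK
    simpa using hnK
  · exfalso
    have h0 : casimir N (traceForm ℂ L N) hB = 0 := by
      ext y
      have : y ∈ K := by rw [h]; trivial
      exact this
    have h1 : LinearMap.trace ℂ N (casimir N (traceForm ℂ L N) hB) = finrank ℂ L := by
      rw [casimir, map_sum]
      have : ∀ a, LinearMap.trace ℂ N
          (toEnd ℂ L N ((traceForm ℂ L N).dualBasis hB (finBasis ℂ L) a) ∘ₗ
            toEnd ℂ L N (finBasis ℂ L a)) = 1 := fun a => by
        rw [← traceForm_apply_apply, LinearMap.BilinForm.apply_dualBasis_left, if_pos rfl]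
      rw [Finset.sum_congr rfl fun a _ => this a]
      simp
    rw [h0, map_zero] at h1
    have h2 : finrank ℂ L = 0 := by exact_mod_cast h1.symm
    rw [finrank_zero_iff] at h2
    exact LieAlgebra.IsSimple.non_abelian (R := ℂ) (L := L) ⟨fun _ _ => Subsingleton.elim _ _⟩

omit [FiniteDimensional ℂ L] in
theorem lie_eq_zero_of_lie_lie_eq_zero {M : Type*} [AddCommGroup M] [Module ℂ M]
    [LieRingModule L M] [LieModule ℂ L M] (h : ∀ (x y : L) (m : M), ⁅x, ⁅y, m⁆⁆ = 0) (x : L)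
    (m : M) : ⁅x, m⁆ = 0 := by
  have hx : x ∈ LieAlgebra.derivedSeries ℂ L 1 := by rw [derivedSeries_one_eq_top]; trivial
  have hle : LieAlgebra.derivedSeries ℂ L 1 ≤ (toEnd ℂ L M).ker := by
    rw [LieAlgebra.derivedSeries_def, LieAlgebra.derivedSeriesOfIdeal_succ,
      LieSubmodule.lie_le_iff]
    intro x _ y _
    rw [LieHom.mem_ker]
    ext m
    simp [h]
  have := hle hx
  rw [LieHom.mem_ker] at this
  have := LinearMap.congr_fun this m
  simpa using this

/-- An invariant linear form on a finite-dimensional module over a simple Lie algebra is detected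
by invariant vectors. This is the form of complete reducibility that is used below. -/
theorem exists_invariant {M : Type*} [AddCommGroup M] [Module ℂ M] [LieRingModule L M]
    [LieModule ℂ L M] [FiniteDimensional ℂ M] (φ : M →ₗ[ℂ] ℂ) (hφ : ∀ (x : L) m, φ ⁅x, m⁆ = 0)
    (h0 : φ ≠ 0) : ∃ m : M, (∀ x : L, ⁅x, m⁆ = 0) ∧ φ m ≠ 0 := by
  induction hn : finrank ℂ M using Nat.strong_induction_on generalizing M with
  | _ d ih =>
  obtain ⟨m, hm⟩ : ∃ m, φ m ≠ 0 := by
    by_contra! h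
    exact h0 (LinearMap.ext h)
  let N : LieSubmodule ℂ L M :=
    { LinearMap.ker φ with lie_mem := fun {x m} _ => hφ x m }
  have hN : ∀ m, m ∈ N ↔ φ m = 0 := fun m => Iff.rfl
  by_cases hprop : ∃ N1 : LieSubmodule ℂ L M, N1 ≤ N ∧ N1 ≠ ⊥ ∧ N1 ≠ N
  · obtain ⟨N1, hle, hbot, hne⟩ := hprop
    -- pass to the quotient by `N1`, then to the preimage of the line that was found there
    have hfin : finrank ℂ (M ⧸ N1) < d := by
      have h1 := Submodule.finrank_quotient_add_finrank N1.toSubmodule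
      have h2 : finrank ℂ N1.toSubmodule ≠ 0 := fun h => hbot (by
        rw [← LieSubmodule.toSubmodule_eq_bot]
        exact Submodule.finrank_eq_zero.1 h)
      have h3 : finrank ℂ (M ⧸ N1) = finrank ℂ (M ⧸ N1.toSubmodule) := rfl
      omega
    let φ1 : (M ⧸ N1) →ₗ[ℂ] ℂ := N1.toSubmodule.liftQ φ (fun y hy => hle hy)
    have hφ1 : ∀ y, φ1 (LieSubmodule.Quotient.mk' N1 y) = φ y := fun y =>
      Submodule.liftQ_apply _ _ _
    obtain ⟨q, hq, hq0⟩ := ih _ hfin φ1 (by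
        intro x q
        obtain ⟨y, rfl⟩ := LieSubmodule.Quotient.surjective_mk' N1 q
        rw [← LieModuleHom.map_lie, hφ1, hφ]) (fun h => hm (by rw [← hφ1, h]; rfl)) rfl
    obtain ⟨y, rfl⟩ := LieSubmodule.Quotient.surjective_mk' N1 q
    rw [hφ1] at hq0
    have hy : ∀ x : L, ⁅x, y⁆ ∈ N1 := fun x => by
      have := hq x
      rw [← LieModuleHom.map_lie, LieSubmodule.Quotient.mk_eq_zero] at this
      exact this
    let M2 : LieSubmodule ℂ L M :=
      { (Submodule.span ℂ {y} ⊔ N1.toSubmodule) with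
        lie_mem := by
          intro x z hz
          change z ∈ Submodule.span ℂ {y} ⊔ N1.toSubmodule at hz
          change ⁅x, z⁆ ∈ Submodule.span ℂ {y} ⊔ N1.toSubmodule
          obtain ⟨u, hu, v, hv, rfl⟩ := Submodule.mem_sup.1 hz
          obtain ⟨c, rfl⟩ := Submodule.mem_span_singleton.1 hu
          rw [lie_add, lie_smul]
          exact Submodule.mem_sup_right (add_mem (N1.smul_mem c (hy x)) (N1.lie_mem hv)) }
    have hyM2 : y ∈ M2 :=
      Submodule.mem_sup_left (Submodule.mem_span_singleton_self y)
    have hlt : finrank ℂ M2 < d := by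
      rw [← hn]
      refine Submodule.finrank_lt (s := M2.toSubmodule) fun htop => hne (le_antisymm hle ?_)
      intro z hz
      have hz2 : z ∈ M2.toSubmodule := by rw [htop]; trivial
      obtain ⟨u, hu, v, hv, rfl⟩ := Submodule.mem_sup.1 hz2
      obtain ⟨c, rfl⟩ := Submodule.mem_span_singleton.1 hu
      have hv0 : φ v = 0 := hle hv
      rw [hN, map_add, map_smul, hv0, add_zero, smul_eq_mul, mul_eq_zero, or_iff_left hq0] at hz
      rw [hz, zero_smul, zero_add]
      exact hv
    obtain ⟨w, hw, hw0⟩ := ih _ hlt (M := M2) (φ ∘ₗ (M2.incl : M2 →ₗ[ℂ] M)) (fun x z => hφ x z)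
      (fun h => hq0 (LinearMap.congr_fun h ⟨y, hyM2⟩)) rfl
    exact ⟨w, fun x => congrArg Subtype.val (hw x), hw0⟩
  · push Not at hprop
    by_cases htriv : ∀ (x : L) (n : N), ⁅x, n⁆ = 0
    · refine ⟨m, fun x => lie_eq_zero_of_lie_lie_eq_zero (fun x y m => ?_) x m, hm⟩
      have := htriv x ⟨⁅y, m⁆, hφ y m⟩
      exact congrArg Subtype.val this
    · push Not at htriv
      have hirr : ∀ N' : LieSubmodule ℂ L N, N' = ⊥ ∨ N' = ⊤ := fun N' => by
        by_cases hb : N' = ⊥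
        · exact Or.inl hb
        · right
          have h1 := hprop (N'.map N.incl) (LieSubmodule.map_incl_le)
            (fun h => hb ((LieSubmodule.eq_bot_iff _).2 fun z hz => Subtype.ext
              ((LieSubmodule.eq_bot_iff _).1 h z ((LieSubmodule.mem_map _).2 ⟨z, hz, rfl⟩))))
          rw [eq_top_iff]
          rintro ⟨z, hz⟩ -
          obtain ⟨z', hz', he⟩ := (LieSubmodule.mem_map _).1 (h1.symm ▸ hz)
          have : z' = ⟨z, hz⟩ := Subtype.ext he
          rwa [← this]
      have hB := traceForm_nondegenerate hirr htriv
      set B := traceForm ℂ L N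
      have hcomm := lie_casimir (M := M) B hB
        (fun x y z => by rw [← lie_skew, map_neg, LinearMap.neg_apply, traceForm_apply_lie_apply])
      have hcoe : ∀ n : N, ((casimir N B hB n : N) : M) = casimir M B hB n := fun n => by
        rw [casimir_apply, casimir_apply, AddSubmonoidClass.coe_finsetSum]
        rfl
      have hinj : Function.Injective (casimir N B hB) :=
        (injective_iff_map_eq_zero _).2 fun n hn => casimir_injective hirr hB n hn
      have hsurj := LinearMap.injective_iff_surjective.1 hinj
      have hCm : casimir M B hB m ∈ N := by
        rw [hN, casimir_apply, map_sum]
        exact Finset.sum_eq_zero fun a _ => hφ _ _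
      obtain ⟨n, hCn⟩ := hsurj ⟨_, hCm⟩
      have hCn' : casimir M B hB n = casimir M B hB m := by rw [← hcoe, hCn]
      refine ⟨m - n, fun x => ?_, ?_⟩
      · have h1 : casimir N B hB ⟨⁅x, m - n⁆, hφ x _⟩ = 0 := by
          apply Subtype.ext
          rw [hcoe]
          change casimir M B hB ⁅x, m - (n : M)⁆ = 0
          rw [← hcomm, map_sub, hCn', sub_self, lie_zero]
        exact congrArg Subtype.val (casimir_injective hirr hB _ h1)
      · rw [map_sub, show φ n = 0 from n.2, sub_zero]
        exact hm

/-- Every nonzero submodule `Q` of a finite-dimensional module admits an equivariant map onto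
itself whose restriction to `Q` is nonzero. -/
theorem exists_lieModuleHom_submodule {P : Type*} [AddCommGroup P] [Module ℂ P] [LieRingModule L P]
    [LieModule ℂ L P] [FiniteDimensional ℂ P] (Q : LieSubmodule ℂ L P) (hQ : Q ≠ ⊥) :
    ∃ π : P →ₗ⁅ℂ, L⁆ Q, ∃ q ∈ Q, π q ≠ 0 := by
  let φ : (P →ₗ[ℂ] Q) →ₗ[ℂ] ℂ :=
    LinearMap.trace ℂ Q ∘ₗ LinearMap.lcomp ℂ Q Q.toSubmodule.subtype
  have hφ : ∀ f, φ f = LinearMap.trace ℂ Q (f ∘ₗ Q.toSubmodule.subtype) := fun f => rfl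
  have hinv : ∀ (x : L) f, φ ⁅x, f⁆ = 0 := fun x f => by
    have : (⁅x, f⁆ : P →ₗ[ℂ] Q) ∘ₗ Q.toSubmodule.subtype
        = toEnd ℂ L Q x * (f ∘ₗ Q.toSubmodule.subtype)
          - (f ∘ₗ Q.toSubmodule.subtype) * toEnd ℂ L Q x := by
      ext q
      rfl
    rw [hφ, this, map_sub, LinearMap.trace_mul_comm, sub_self]
  have h0 : φ ≠ 0 := by
    obtain ⟨f, hf⟩ := Q.toSubmodule.subtype.exists_leftInverse_of_injective
      (Submodule.ker_subtype _)
    intro h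
    have h1 := LinearMap.congr_fun h f
    rw [hφ, hf, LinearMap.trace_id, LinearMap.zero_apply, Nat.cast_eq_zero] at h1
    exact hQ ((LieSubmodule.toSubmodule_eq_bot _).1 (Submodule.finrank_eq_zero.1 h1))
  obtain ⟨f, hf, hf0⟩ := exists_invariant φ hinv h0
  refine ⟨{ f with map_lie' := ?_ }, ?_⟩
  · intro x p
    have := LinearMap.congr_fun (hf x) p
    rw [LieHom.lie_apply] at this
    exact (sub_eq_zero.1 this).symm
  · by_contra! h
    apply hf0
    have : f ∘ₗ Q.toSubmodule.subtype = 0 := by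
      ext q
      exact congrArg Subtype.val (h q q.2)
    rw [hφ, this, map_zero]

end Invariants

/-! ### Chevalley generators -/

section Generators

open LieAlgebra LieAlgebra.IsKilling LieModule Module

variable {L : Type*} [LieRing L] [LieAlgebra ℂ L] [FiniteDimensional ℂ L] [LieAlgebra.IsSimple ℂ L]
  {H : LieSubalgebra ℂ L} [H.IsCartanSubalgebra]

/-- For roots `α` and `β` such that `α + β` is a root, a nonzero root vector for `α` acts nontrivially
on the root space of `β`. If `β(h_α) < 0`, no nonzero vector of weight `β` is primitive; otherwise
the same holds for the weight `-(α + β)`, and the Killing form transfers the conclusion. -/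
theorem exists_lie_ne_zero {α β γ : Weight ℂ H L} (hα : α.IsNonZero)
    (hγ : (γ : H → ℂ) = α + β) {e f : L} (t : IsSl2Triple (coroot α : L) e f)
    (he : e ∈ rootSpace H α) : ∃ y ∈ rootSpace H β, ⁅e, y⁆ ≠ 0 := by
  have hint := apply_coroot_eq_cast α β
  set n : ℤ := (chainBotCoeff α β - chainTopCoeff α β : ℤ) with hn
  have hγα : γ (coroot α) = 2 + n := by
    rw [hγ, Pi.add_apply, root_apply_coroot hα, hint]
  -- no primitive vector has a negative integer weight
  have key : ∀ (χ : Weight ℂ H L) (m : ℤ), χ (coroot α) = m → m < 0 →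
      ∀ z ∈ rootSpace H χ, z ≠ 0 → ⁅e, z⁆ ≠ 0 := by
    intro χ m hm hm0 z hz hz0 hez
    have P : IsSl2Triple.HasPrimitiveVectorWith t z (m : ℂ) :=
      { ne_zero := hz0
        lie_h := by
          have := lie_eq_smul_of_mem_rootSpace hz (coroot α)
          rw [hm] at this
          exact this
        lie_e := hez }
    obtain ⟨k, hk⟩ := P.exists_nat
    have : m = k := by exact_mod_cast hk
    omega
  rcases lt_or_ge n 0 with h | h
  · obtain ⟨y, hy, hy0⟩ := β.exists_ne_zero
    exact ⟨y, hy, key β n hint h y hy hy0⟩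
  · obtain ⟨z, hz, hz0⟩ := (-γ).exists_ne_zero
    have hez := key (-γ) (-(2 + n))
      (by rw [Weight.coe_neg, Pi.neg_apply, hγα]; push_cast; ring) (by omega) z hz hz0
    by_contra! hc
    apply hez
    have hmem : ⁅e, z⁆ ∈ rootSpace H (-β : H → ℂ) := by
      have := lie_mem_genWeightSpace_of_mem_genWeightSpace he hz
      rwa [Weight.coe_neg, hγ, neg_add, add_neg_cancel_left] at this
    have hker := mem_ker_killingForm_of_mem_rootSpace_of_forall_rootSpace_neg ℂ L H hmem (by
      intro y hy
      rw [neg_neg] at hy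
      have h1 := traceForm_apply_lie_apply ℂ L L z e y
      rw [hc y hy, map_zero] at h1
      rw [← lie_skew, map_neg, LinearMap.neg_apply]
      change -(traceForm ℂ L L) ⁅z, e⁆ y = 0
      rw [h1, neg_zero])
    simpa using hker

variable (b : (rootSystem H).Base)

/-- A choice of Chevalley generators: `e i` and `f i` are root vectors for the simple root `α_i` and
its negative that form an `sl₂`-triple with the simple coroot `h_i`. -/
structure IsChevalley (e f : b.support → L) : Prop where
  sl2 : ∀ i : b.support, IsSl2Triple ((rootSystem H).coroot i : L) (e i) (f i)
  e_mem : ∀ i : b.support, e i ∈ rootSpace H (i : Weight ℂ H L)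
  f_mem : ∀ i : b.support, f i ∈ rootSpace H (-(i : Weight ℂ H L) : H → ℂ)

theorem exists_isChevalley : ∃ e f : b.support → L, IsChevalley b e f := by
  have : ∀ i : b.support, ∃ e f : L, IsSl2Triple ((rootSystem H).coroot i : L) e f ∧
      e ∈ rootSpace H (i : Weight ℂ H L) ∧ f ∈ rootSpace H (-(i : Weight ℂ H L) : H → ℂ) := by
    intro i
    have hi := H.isNonZero_coe_root i.1
    obtain ⟨h, e, f, t, he, hf⟩ := exists_isSl2Triple_of_weight_isNonZero hi
    obtain rfl := t.h_eq_coroot hi he hf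
    exact ⟨e, f, t, he, hf⟩
  choose e f h using this
  exact ⟨e, f, fun i => (h i).1, fun i => (h i).2.1, fun i => (h i).2.2⟩

variable {b} {e f : b.support → L}

theorem IsChevalley.lie_f (hc : IsChevalley b e f) (x : H) (i : b.support) :
    ⁅(x : L), f i⁆ = -((rootSystem H).root i x • f i) := by
  rw [← neg_smul]
  exact lie_eq_smul_of_mem_rootSpace (hc.f_mem i) x

theorem IsChevalley.lie_e_f (hc : IsChevalley b e f) {i j : b.support} (h : i ≠ j) :
    ⁅e i, f j⁆ = 0 := by
  by_contra h0
  have hmem := lie_mem_genWeightSpace_of_mem_genWeightSpace (hc.e_mem i) (hc.f_mem j)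
  have hne : genWeightSpace L ((i : Weight ℂ H L) + -(j : Weight ℂ H L) : H → ℂ) ≠ ⊥ := fun hb => by
    rw [hb] at hmem
    exact h0 (by simpa using hmem)
  let w : Weight ℂ H L := ⟨_, hne⟩
  have hw : w.IsNonZero := fun hz => h (by
    have h1 : ((i : Weight ℂ H L) : H → ℂ) + -(j : Weight ℂ H L) = 0 := hz
    rw [add_neg_eq_zero] at h1
    exact Subtype.ext (Subtype.ext (DFunLike.coe_injective h1)))
  refine b.sub_notMem_range_root i.2 j.2 ⟨⟨w, by simpa [LieSubalgebra.root] using hw⟩, ?_⟩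
  ext x
  change ((i : Weight ℂ H L) + -(j : Weight ℂ H L) : H → ℂ) x = _
  rw [← sub_eq_add_neg]
  rfl

theorem mem_of_rootSpace {α : Weight ℂ H L} (hα : α.IsNonZero) {y x : L} (hy : y ∈ rootSpace H α)
    (hy0 : y ≠ 0) (hx : x ∈ rootSpace H α) : ∃ c : ℂ, x = c • y := by
  obtain ⟨c, hc⟩ := (finrank_eq_one_iff_of_nonzero' (⟨y, hy⟩ : rootSpace H α)
    (fun h => hy0 (congrArg Subtype.val h))).1 (finrank_rootSpace_eq_one α hα) ⟨x, hx⟩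
  exact ⟨c, (congrArg Subtype.val hc).symm⟩

/-- The Chevalley generators generate the Lie algebra. -/
theorem IsChevalley.eq_top (hc : IsChevalley b e f) (K : LieSubalgebra ℂ L) (he : ∀ i, e i ∈ K)
    (hf : ∀ i, f i ∈ K) : K = ⊤ := by
  have hpos : ∀ i, b.IsPos i → (rootSpace H (i : Weight ℂ H L) ≤ K.toSubmodule ∧
      (rootSpace H (-(i : Weight ℂ H L) : H → ℂ)).toSubmodule ≤ K.toSubmodule) := by
    intro i hi
    refine hi.induction_on_add (p := fun i =>
      (rootSpace H (i : Weight ℂ H L)).toSubmodule ≤ K.toSubmodule ∧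
      (rootSpace H (-(i : Weight ℂ H L) : H → ℂ)).toSubmodule ≤ K.toSubmodule) ?_ ?_
    · intro i hi
      have h0 := H.isNonZero_coe_root i
      constructor
      · intro x hx
        obtain ⟨c, rfl⟩ := mem_of_rootSpace h0 (hc.e_mem ⟨i, hi⟩) (hc.sl2 ⟨i, hi⟩).e_ne_zero hx
        exact K.smul_mem c (he _)
      · intro x hx
        obtain ⟨c, rfl⟩ := mem_of_rootSpace (α := -i.1) h0.neg (hc.f_mem ⟨i, hi⟩)
          (hc.sl2 ⟨i, hi⟩).f_ne_zero hx
        exact K.smul_mem c (hf _)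
    · intro i j k hk hi hj
      have hj0 := H.isNonZero_coe_root j
      have hk0 := H.isNonZero_coe_root k
      have hk' : ((k : Weight ℂ H L) : H → ℂ) = (j : Weight ℂ H L) + (i : Weight ℂ H L) := by
        rw [add_comm]
        exact congrArg (fun d : Dual ℂ H => (d : H → ℂ)) hk
      constructor
      · obtain ⟨y, hy, hy0⟩ := exists_lie_ne_zero hj0 hk' (hc.sl2 ⟨j, hj⟩) (hc.e_mem ⟨j, hj⟩)
        intro x hx
        have hmem := lie_mem_genWeightSpace_of_mem_genWeightSpace (hc.e_mem ⟨j, hj⟩) hy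
        rw [← hk'] at hmem
        obtain ⟨c, rfl⟩ := mem_of_rootSpace hk0 hmem hy0 hx
        exact K.smul_mem c (K.lie_mem (he _) (hi.1 hy))
      · have t := (hc.sl2 ⟨j, hj⟩).symm
        obtain ⟨y, hy, hy0⟩ := exists_lie_ne_zero (α := -j.1) (β := -i.1) (γ := -k.1) hj0.neg
          (by rw [Weight.coe_neg, hk', neg_add]; rfl) (e := f ⟨j, hj⟩) (f := e ⟨j, hj⟩)
          (by rw [coroot_neg]; exact t) (hc.f_mem ⟨j, hj⟩)
        intro x hx
        have hmem := lie_mem_genWeightSpace_of_mem_genWeightSpace (hc.f_mem ⟨j, hj⟩) hy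
        have heq : (-(j : Weight ℂ H L) : H → ℂ) + (-i.1 : Weight ℂ H L) = (-k.1 : Weight ℂ H L) := by
          rw [Weight.coe_neg, Weight.coe_neg, hk', neg_add]
        rw [heq] at hmem
        obtain ⟨c, rfl⟩ := mem_of_rootSpace hk0.neg hmem hy0 hx
        exact K.smul_mem c (K.lie_mem (hf _) (hi.2 hy))
  have hH : H ≤ K := by
    intro x hx
    have h1 : (⟨x, hx⟩ : H) ∈ Submodule.span ℂ (Set.range b.toCoweightBasis) := by
      rw [b.toCoweightBasis.span_eq]; trivial
    have h2 : Submodule.span ℂ (Set.range b.toCoweightBasis)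
        ≤ K.toSubmodule.comap H.toSubmodule.subtype := by
      rw [Submodule.span_le]
      rintro _ ⟨i, rfl⟩
      rw [b.toCoweightBasis_apply]
      change ((rootSystem H).coroot i : L) ∈ K
      rw [← (hc.sl2 i).lie_e_f]
      exact K.lie_mem (he i) (hf i)
    exact h2 h1
  rw [eq_top_iff]
  have htop : (⊤ : LieSubmodule ℂ H L) = ⨆ χ : Weight ℂ H L, genWeightSpace L χ :=
    (iSup_genWeightSpace_eq_top' ℂ H L).symm
  intro x _
  have hx : x ∈ (⊤ : LieSubmodule ℂ H L).toSubmodule := trivial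
  rw [htop, LieSubmodule.iSup_toSubmodule] at hx
  refine (iSup_le fun χ => ?_ :
    ⨆ χ : Weight ℂ H L, (genWeightSpace L χ).toSubmodule ≤ K.toSubmodule) hx
  by_cases hχ : χ.IsZero
  · rw [hχ.eq]
    intro y hy
    have : y ∈ rootSpace H (0 : H → ℂ) := hy
    rw [rootSpace_zero_eq] at this
    exact hH this
  · let i : H.root := ⟨χ, by simpa [LieSubalgebra.root] using hχ⟩
    rcases RootPairing.Base.IsPos.or_neg b i with h | h
    · exact (hpos i h).1
    · have hr : (rootSystem H).root i
          = -(rootSystem H).root ((rootSystem H).reflectionPerm i i) := by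
        rw [RootPairing.root_reflectionPerm, RootPairing.reflection_apply_self, neg_neg]
      have hχ' : (χ : H → ℂ) = -(((rootSystem H).reflectionPerm i i : H.root) : Weight ℂ H L) :=
        congrArg (fun d : Dual ℂ H => (d : H → ℂ)) hr
      rw [hχ']
      exact (hpos _ h).2

/-- A subspace that is stable under the Chevalley generators is a submodule. -/
theorem IsChevalley.lie_mem (hc : IsChevalley b e f) {M : Type*} [AddCommGroup M] [Module ℂ M]
    [LieRingModule L M] [LieModule ℂ L M] (N : Submodule ℂ M) (he : ∀ i, ∀ m ∈ N, ⁅e i, m⁆ ∈ N)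
    (hf : ∀ i, ∀ m ∈ N, ⁅f i, m⁆ ∈ N) (x : L) {m : M} (hm : m ∈ N) : ⁅x, m⁆ ∈ N := by
  let K : LieSubalgebra ℂ L :=
    { carrier := {x | ∀ m ∈ N, ⁅x, m⁆ ∈ N}
      add_mem' := fun hx hy m hm => by rw [add_lie]; exact add_mem (hx m hm) (hy m hm)
      zero_mem' := fun m _ => by rw [zero_lie]; exact zero_mem _
      smul_mem' := fun c x hx m hm => by rw [smul_lie]; exact N.smul_mem c (hx m hm)
      lie_mem' := fun hx hy m hm => by
        rw [lie_lie]
        exact sub_mem (hx _ (hy m hm)) (hy _ (hx m hm)) }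
  have hK : K = ⊤ := hc.eq_top K he hf
  have : x ∈ K := by rw [hK]; trivial
  exact this m hm

end Generators

/-! ### Weight vectors and highest weight modules -/

section Weights

set_option linter.unusedSectionVars false

open LieAlgebra LieAlgebra.IsKilling LieModule Module

variable {L : Type*} [LieRing L] [LieAlgebra ℂ L] [FiniteDimensional ℂ L] [LieAlgebra.IsSimple ℂ L]
  {H : LieSubalgebra ℂ L} [H.IsCartanSubalgebra] {b : (rootSystem H).Base}

section WeightSpace

variable (M : Type*) [AddCommGroup M] [Module ℂ M] [LieRingModule L M] [LieModule ℂ L M]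

/-- The space of vectors of weight `χ` in an `L`-module, in the strict (not generalized) sense. -/
def wtSpace (χ : Dual ℂ H) : Submodule ℂ M where
  carrier := {m | ∀ x : H, ⁅(x : L), m⁆ = χ x • m}
  add_mem' hm hn x := by rw [lie_add, hm x, hn x, smul_add]
  zero_mem' x := by rw [lie_zero, smul_zero]
  smul_mem' c m hm x := by rw [lie_smul, hm x, smul_comm]

variable {M}

theorem mem_wtSpace {χ : Dual ℂ H} {m : M} :
    m ∈ wtSpace M χ ↔ ∀ x : H, ⁅(x : L), m⁆ = χ x • m := Iff.rfl

variable (M) in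
theorem iSupIndep_wtSpace : iSupIndep fun χ : Dual ℂ H => wtSpace (L := L) M χ := by
  have h := (LieSubmodule.iSupIndep_toSubmodule.2 (iSupIndep_genWeightSpace ℂ H M))
  have h2 := h.comp (f := fun χ : Dual ℂ H => (χ : H → ℂ)) DFunLike.coe_injective
  refine h2.mono fun χ m hm => ?_
  exact (mem_genWeightSpace M (χ : H → ℂ) m).2 fun x => ⟨1, by
    have : ⁅x, m⁆ = χ x • m := hm x
    simp [this]⟩

/-- A vector of weight `χ` in the span of weight vectors lies in the span of those of weight `χ`. -/
theorem mem_span_of_mem_wtSpace {ι : Type*} {s : ι → M} {w : ι → Dual ℂ H}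
    (hs : ∀ i, s i ∈ wtSpace M (w i)) {χ : Dual ℂ H} {m : M} (hm : m ∈ wtSpace M χ)
    (hspan : m ∈ Submodule.span ℂ (Set.range s)) :
    m ∈ Submodule.span ℂ (s '' {i | w i = χ}) := by
  have hle : Submodule.span ℂ (Set.range s)
      ≤ Submodule.span ℂ (s '' {i | w i = χ}) ⊔ ⨆ ψ ≠ χ, wtSpace M ψ := by
    rw [Submodule.span_le]
    rintro _ ⟨i, rfl⟩
    by_cases h : w i = χ
    · exact Submodule.mem_sup_left (Submodule.subset_span ⟨i, h, rfl⟩)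
    · exact Submodule.mem_sup_right (Submodule.mem_iSup_of_mem (w i)
        (Submodule.mem_iSup_of_mem h (hs i)))
  obtain ⟨m1, hm1, m2, hm2, rfl⟩ := Submodule.mem_sup.1 (hle hspan)
  have hm1' : m1 ∈ wtSpace M χ := by
    refine (Submodule.span_le.2 ?_ : Submodule.span ℂ (s '' {i | w i = χ}) ≤ _) hm1
    rintro _ ⟨i, hi, rfl⟩
    have : w i = χ := hi
    rw [← this]
    exact hs i
  have hm2' : m2 ∈ wtSpace M χ := by
    have := sub_mem hm hm1'
    rwa [add_sub_cancel_left] at this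
  have h0 := (Submodule.disjoint_def.1 (iSupIndep_wtSpace M χ)) m2 hm2' hm2
  rw [h0, add_zero]
  exact hm1

theorem lie_mem_wtSpace_add {χ ψ : Dual ℂ H} {m : M} (hm : m ∈ wtSpace M χ) {y : L}
    (hy : ∀ x : H, ⁅(x : L), y⁆ = ψ x • y) : ⁅y, m⁆ ∈ wtSpace M (χ + ψ) := by
  intro x
  rw [leibniz_lie, hy, hm x, smul_lie, lie_smul, ← add_smul, LinearMap.add_apply, add_comm]

variable {e f : b.support → L}

theorem IsChevalley.lie_f_mem (hc : IsChevalley b e f) {χ : Dual ℂ H} {m : M}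
    (hm : m ∈ wtSpace M χ) (i : b.support) :
    ⁅f i, m⁆ ∈ wtSpace M (χ - (rootSystem H).root i) := by
  rw [sub_eq_add_neg]
  exact lie_mem_wtSpace_add hm fun x => by
    rw [hc.lie_f x i, LinearMap.neg_apply, neg_smul]

theorem IsChevalley.lie_e_lie_f (hc : IsChevalley b e f) {χ : Dual ℂ H} {m : M}
    (hm : m ∈ wtSpace M χ) (i : b.support) :
    ⁅e i, ⁅f i, m⁆⁆ = ⁅f i, ⁅e i, m⁆⁆ + χ ((rootSystem H).coroot i) • m := by
  rw [leibniz_lie, (hc.sl2 i).lie_e_f, hm, add_comm]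

theorem IsChevalley.lie_e_lie_f_of_ne (hc : IsChevalley b e f) {i j : b.support} (h : i ≠ j)
    (m : M) : ⁅e i, ⁅f j, m⁆⁆ = ⁅f j, ⁅e i, m⁆⁆ := by
  rw [leibniz_lie, hc.lie_e_f h, zero_lie, zero_add]

end WeightSpace

section Roots

/-- The combination of simple roots with the given coefficients. -/
def rootComb (b : (rootSystem H).Base) (n : b.support → ℕ) : Dual ℂ H :=
  ∑ i, n i • (rootSystem H).root i

theorem linearIndependent_root (b : (rootSystem H).Base) :
    LinearIndependent ℂ fun i : b.support => (rootSystem H).root i :=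
  b.linearIndepOn_root

theorem rootComb_injective : Function.Injective (rootComb b) := by
  intro n m h
  have h1 : ∑ i : b.support, (n i : ℂ) • (rootSystem H).root i
      = ∑ i : b.support, (m i : ℂ) • (rootSystem H).root i := by
    simpa only [rootComb, Nat.cast_smul_eq_nsmul] using h
  funext i
  have h2 := Fintype.linearIndependent_iff.1 (linearIndependent_root b)
    (fun i => (n i : ℂ) - m i) (by simp only [sub_smul, Finset.sum_sub_distrib, h1, sub_self]) i
  exact_mod_cast sub_eq_zero.1 h2

theorem rootComb_add (n m : b.support → ℕ) : rootComb b (n + m) = rootComb b n + rootComb b m := by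
  simp only [rootComb, Pi.add_apply, add_smul, Finset.sum_add_distrib]

theorem rootComb_zero : rootComb b 0 = 0 := by simp [rootComb]

theorem rootComb_single [DecidableEq b.support] (i : b.support) :
    rootComb b (Pi.single i 1) = (rootSystem H).root i := by
  rw [rootComb, Finset.sum_eq_single i]
  · simp
  · intro j _ hj
    rw [Pi.single_eq_of_ne hj, zero_smul]
  · simp

end Roots

section Monomials

variable {M : Type*} [AddCommGroup M] [Module ℂ M] [LieRingModule L M] [LieModule ℂ L M]
  {e f : b.support → L}

/-- The vector `f_{i₁} ⋯ f_{i_r} v`. -/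
def monomial (f : b.support → L) (v : M) (l : List b.support) : M :=
  l.foldr (fun i m => ⁅f i, m⁆) v

open scoped Classical in
theorem IsChevalley.monomial_mem (hc : IsChevalley b e f) {χ : Dual ℂ H} {v : M}
    (hv : v ∈ wtSpace M χ) (l : List b.support) :
    monomial f v l ∈ wtSpace M (χ - rootComb b fun i => l.count i) := by
  induction l with
  | nil =>
    have : (fun i : b.support => List.count i []) = 0 := by funext i; simp
    rw [this, rootComb_zero, sub_zero]
    exact hv
  | cons j l ih =>
    have h : (fun i => (j :: l).count i) = (fun i => l.count i) + Pi.single j 1 := by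
      funext i
      rw [List.count_cons, Pi.add_apply]
      by_cases hij : j = i
      · subst hij; simp
      · simp [hij]
    rw [h, rootComb_add, rootComb_single, ← sub_sub]
    exact hc.lie_f_mem ih j

/-- The submodule generated by a highest weight vector is spanned by the monomials in the `f_i`. -/
def IsChevalley.monomialSpan (hc : IsChevalley b e f) {χ : Dual ℂ H} {v : M}
    (hv : v ∈ wtSpace M χ) (h0 : ∀ i, ⁅e i, v⁆ = 0) : LieSubmodule ℂ L M :=
  { Submodule.span ℂ (Set.range (monomial f v)) with
    lie_mem := by
      classical
      intro x m hm
      have hf : ∀ i, ∀ m ∈ Submodule.span ℂ (Set.range (monomial f v)),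
          ⁅f i, m⁆ ∈ Submodule.span ℂ (Set.range (monomial f v)) := by
        intro i m hm
        refine (Submodule.span_le.2 ?_ : _ ≤ (Submodule.span ℂ (Set.range (monomial f v))).comap
          (toEnd ℂ L M (f i))) hm
        rintro _ ⟨l, rfl⟩
        exact Submodule.subset_span ⟨i :: l, rfl⟩
      refine hc.lie_mem (Submodule.span ℂ (Set.range (monomial f v))) ?_ hf x hm
      intro i m hm
      refine (Submodule.span_le.2 ?_ : _ ≤ (Submodule.span ℂ (Set.range (monomial f v))).comap
        (toEnd ℂ L M (e i))) hm
      rintro _ ⟨l, rfl⟩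
      change ⁅e i, monomial f v l⁆ ∈ Submodule.span ℂ (Set.range (monomial f v))
      induction l with
      | nil =>
        change ⁅e i, v⁆ ∈ _
        rw [h0]
        exact zero_mem _
      | cons j l ih =>
        change ⁅e i, ⁅f j, monomial f v l⁆⁆ ∈ _
        by_cases hij : i = j
        · subst hij
          rw [hc.lie_e_lie_f (hc.monomial_mem hv l)]
          exact add_mem (hf _ _ ih)
            (Submodule.smul_mem _ _ (Submodule.subset_span ⟨l, rfl⟩))
        · rw [hc.lie_e_lie_f_of_ne hij]
          exact hf _ _ ih }

theorem IsChevalley.self_mem_monomialSpan (hc : IsChevalley b e f) {χ : Dual ℂ H} {v : M}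
    (hv : v ∈ wtSpace M χ) (h0 : ∀ i, ⁅e i, v⁆ = 0) : v ∈ hc.monomialSpan hv h0 :=
  Submodule.subset_span ⟨[], rfl⟩

open scoped Classical in
/-- The vectors of weight `χ - ∑ n_i α_i` in a module generated by a vector of highest weight `χ`
are spanned by the monomials of multidegree `n`. -/
theorem IsChevalley.mem_span_monomial (hc : IsChevalley b e f) {χ : Dual ℂ H} {v : M}
    (hv : v ∈ wtSpace M χ) (n : b.support → ℕ) {m : M}
    (hm : m ∈ wtSpace M (χ - rootComb b n))
    (hspan : m ∈ Submodule.span ℂ (Set.range (monomial f v))) :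
    m ∈ Submodule.span ℂ (monomial f v '' {l | ∀ i, l.count i = n i}) := by
  have := mem_span_of_mem_wtSpace (fun l => hc.monomial_mem hv l) hm hspan
  simpa only [sub_right_inj, rootComb_injective.eq_iff, funext_iff] using this

theorem IsChevalley.mem_span_self (hc : IsChevalley b e f) {χ : Dual ℂ H} {v m : M}
    (hv : v ∈ wtSpace M χ) (hm : m ∈ wtSpace M χ)
    (hspan : m ∈ Submodule.span ℂ (Set.range (monomial f v))) : ∃ c : ℂ, m = c • v := by
  classical
  have h := hc.mem_span_monomial hv 0 (by rwa [rootComb_zero, sub_zero]) hspan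
  have h1 : {l : List b.support | ∀ i, l.count i = (0 : b.support → ℕ) i} = {[]} := by
    ext l
    simp only [Pi.zero_apply, Set.mem_ofPred_eq, Set.mem_singleton_iff, List.count_eq_zero]
    exact List.eq_nil_iff_forall_not_mem.symm
  rw [h1, Set.image_singleton] at h
  obtain ⟨c, hc⟩ := Submodule.mem_span_singleton.1 h
  exact ⟨c, hc.symm⟩

theorem IsChevalley.monomialSpan_eq_top (hc : IsChevalley b e f) [LieModule.IsIrreducible ℂ L M]
    {χ : Dual ℂ H} {v : M} (hv : v ∈ wtSpace M χ) (h0 : ∀ i, ⁅e i, v⁆ = 0) (hne : v ≠ 0) (m : M) :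
    m ∈ Submodule.span ℂ (Set.range (monomial f v)) := by
  rcases eq_bot_or_eq_top (hc.monomialSpan hv h0) with h | h
  · exfalso
    have := hc.self_mem_monomialSpan hv h0
    rw [h] at this
    exact hne (by simpa using this)
  · have : m ∈ hc.monomialSpan hv h0 := by rw [h]; trivial
    exact this

/-- In an irreducible module of highest weight `χ` the vectors killed by all `e_i` have weight
`χ`. -/
theorem IsChevalley.eq_zero_of_lie_e (hc : IsChevalley b e f) [LieModule.IsIrreducible ℂ L M]
    {χ ψ : Dual ℂ H} {v m : M} (hv : v ∈ wtSpace M χ) (h0 : ∀ i, ⁅e i, v⁆ = 0) (hne : v ≠ 0)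
    (hm : m ∈ wtSpace M ψ) (hm0 : ∀ i, ⁅e i, m⁆ = 0) (h : ψ ≠ χ) : m = 0 := by
  classical
  by_contra hmne
  have aux : ∀ {v m : M} {χ ψ : Dual ℂ H}, v ∈ wtSpace M χ → m ∈ wtSpace M ψ → m ≠ 0 →
      m ∈ Submodule.span ℂ (Set.range (monomial f v)) → ∃ n, ψ = χ - rootComb b n := by
    intro v m χ ψ hv hm hm0 hspan
    have h1 := mem_span_of_mem_wtSpace (fun l => hc.monomial_mem hv l) hm hspan
    by_contra! hn
    have h2 : {l : List b.support | χ - rootComb b (fun i => l.count i) = ψ} = ∅ := by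
      ext l
      simpa using (hn _).symm
    rw [h2, Set.image_empty, Submodule.span_empty] at h1
    exact hm0 (by simpa using h1)
  obtain ⟨n, hn⟩ := aux hv hm hmne (hc.monomialSpan_eq_top hv h0 hne m)
  obtain ⟨k, hk⟩ := aux hm hv hne (hc.monomialSpan_eq_top hm hm0 hmne v)
  have h1 : rootComb b (n + k) = rootComb b 0 := by
    rw [rootComb_add, rootComb_zero, add_comm]
    rw [hn] at hk
    have h3 : χ = χ - (rootComb b k + rootComb b n) := by
      conv_lhs => rw [hk]
      abel
    exact (sub_eq_self.1 h3.symm)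
  have h2 : n = 0 := by
    funext i
    have := congrFun (rootComb_injective h1) i
    simp only [Pi.add_apply, Pi.zero_apply] at this ⊢
    omega
  rw [h2, rootComb_zero, sub_zero] at hn
  exact h hn

end Monomials

end Weights

/-! ### Multiplicities and highest weight vectors -/

section HighestWeightVectors

set_option linter.unusedSectionVars false

open LieAlgebra LieAlgebra.IsKilling LieModule Module

variable {L : Type*} [LieRing L] [LieAlgebra ℂ L]

section Prod

variable (V W : Type*) [AddCommGroup V] [Module ℂ V] [LieRingModule L V] [LieModule ℂ L V]
  [AddCommGroup W] [Module ℂ W] [LieRingModule L W] [LieModule ℂ L W]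

/-- The direct sum of two modules over a Lie algebra, on the type `V × W`. -/
@[reducible] def prodLieRingModule : LieRingModule L (V × W) where
  bracket x m := (⁅x, m.1⁆, ⁅x, m.2⁆)
  add_lie x y m := Prod.ext (add_lie x y m.1) (add_lie x y m.2)
  lie_add x m n := Prod.ext (lie_add x m.1 n.1) (lie_add x m.2 n.2)
  leibniz_lie x y m := Prod.ext (leibniz_lie x y m.1) (leibniz_lie x y m.2)

attribute [local instance] prodLieRingModule

theorem prodLieModule : LieModule ℂ L (V × W) where
  smul_lie c x m := Prod.ext (smul_lie c x m.1) (smul_lie c x m.2)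
  lie_smul c x m := Prod.ext (lie_smul c x m.1) (lie_smul c x m.2)

end Prod

variable [FiniteDimensional ℂ L] [LieAlgebra.IsSimple ℂ L]
  {H : LieSubalgebra ℂ L} [H.IsCartanSubalgebra] {b : (rootSystem H).Base}
  {e f : b.support → L}

/-- The space of vectors of weight `χ` that are annihilated by all `e_i`. -/
def hwVectors (e : b.support → L) (χ : Dual ℂ H) (M : Type*) [AddCommGroup M] [Module ℂ M]
    [LieRingModule L M] [LieModule ℂ L M] : Submodule ℂ M :=
  wtSpace M χ ⊓ ⨅ i, LinearMap.ker (toEnd ℂ L M (e i))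

theorem mem_hwVectors {χ : Dual ℂ H} {M : Type*} [AddCommGroup M] [Module ℂ M]
    [LieRingModule L M] [LieModule ℂ L M] {m : M} :
    m ∈ hwVectors e χ M ↔ m ∈ wtSpace M χ ∧ ∀ i, ⁅e i, m⁆ = 0 := by
  simp [hwVectors]

theorem monomial_mem_of_mem {M : Type*} [AddCommGroup M] [Module ℂ M]
    [LieRingModule L M] [LieModule ℂ L M] (N : LieSubmodule ℂ L M) {v : M} (hv : v ∈ N)
    (l : List b.support) : monomial f v l ∈ N := by
  induction l with
  | nil => exact hv
  | cons i l ih => exact N.lie_mem ih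

variable {V W : Type*} [AddCommGroup V] [Module ℂ V] [LieRingModule L V] [LieModule ℂ L V]
  [AddCommGroup W] [Module ℂ W] [LieRingModule L W] [LieModule ℂ L W]
  [FiniteDimensional ℂ V] [FiniteDimensional ℂ W]

attribute [local instance] prodLieRingModule prodLieModule

/-- Every highest weight vector of `W` is the image of the highest weight vector `v` of `V`. The
graph of the required homomorphism is the submodule `P` of `V × W` generated by `(v, w)`: its
intersection `Q` with `0 × W` vanishes, because an equivariant map from `P` to `Q` must kill
`(v, w)`, there being no vectors of the same weight in `Q`. -/
theorem IsChevalley.exists_hom (hc : IsChevalley b e f) [LieModule.IsIrreducible ℂ L V]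
    {χ : Dual ℂ H} {v : V} (hv : v ∈ hwVectors e χ V) (hne : v ≠ 0) {w : W}
    (hw : w ∈ hwVectors e χ W) : ∃ T : V →ₗ⁅ℂ, L⁆ W, T v = w := by
  rw [mem_hwVectors] at hv hw
  have hp : ((v, w) : V × W) ∈ wtSpace (V × W) χ := fun x => Prod.ext (hv.1 x) (hw.1 x)
  have hp0 : ∀ i, ⁅e i, ((v, w) : V × W)⁆ = 0 := fun i => Prod.ext (hv.2 i) (hw.2 i)
  set P := hc.monomialSpan hp hp0 with hP
  have hpP : ((v, w) : V × W) ∈ P := hc.self_mem_monomialSpan hp hp0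
  have hle : ∀ N : LieSubmodule ℂ L (V × W), ((v, w) : V × W) ∈ N → P ≤ N := fun N hN => by
    have : Submodule.span ℂ (Set.range (monomial f ((v, w) : V × W))) ≤ N.toSubmodule := by
      rw [Submodule.span_le]
      rintro _ ⟨l, rfl⟩
      exact monomial_mem_of_mem N hN l
    exact this
  let Q : LieSubmodule ℂ L P :=
    { carrier := {q | q.1.1 = 0}
      add_mem' := fun {x y} hx hy => by
        change (x.1 + y.1).1 = 0
        rw [Prod.fst_add, show x.1.1 = 0 from hx, show y.1.1 = 0 from hy, add_zero]
      zero_mem' := rfl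
      smul_mem' := fun c x hx => by
        change (c • x.1).1 = 0
        rw [Prod.smul_fst, show x.1.1 = 0 from hx, smul_zero]
      lie_mem := fun {x q} hq => by
        change ⁅x, q.1.1⁆ = 0
        rw [show q.1.1 = 0 from hq, lie_zero] }
  have hQ : Q = ⊥ := by
    by_contra hQ
    obtain ⟨π, q, -, hπq⟩ := exists_lieModuleHom_submodule Q hQ
    have h1 : π ⟨(v, w), hpP⟩ = 0 := by
      set y := π ⟨(v, w), hpP⟩ with hy
      have hyw : (y.1.1 : V × W) ∈ wtSpace (V × W) χ := fun x => by
        have h2 : ⁅(x : L), y⁆ = χ x • y := by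
          rw [hy, ← LieModuleHom.map_lie, ← map_smul]
          exact congrArg π (Subtype.ext (hp x))
        exact congrArg (fun z : Q => (z.1.1 : V × W)) h2
      obtain ⟨c, hcy⟩ := hc.mem_span_self hp hyw y.1.2
      have h3 : y.1.1.1 = 0 := y.2
      rw [hcy, Prod.smul_fst, smul_eq_zero, or_iff_left hne] at h3
      rw [h3, zero_smul] at hcy
      exact Subtype.ext (Subtype.ext hcy)
    apply hπq
    obtain ⟨k, hk, hkq⟩ := (LieSubmodule.mem_map _).1
      (hle (π.ker.map P.incl) ((LieSubmodule.mem_map _).2 ⟨_, h1, rfl⟩) q.2)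
    have : k = q := Subtype.ext hkq
    rw [← this]
    exact hk
  let E : P →ₗ[ℂ] V := LinearMap.fst ℂ V W ∘ₗ P.toSubmodule.subtype
  have hE : Function.Bijective E := by
    constructor
    · rw [injective_iff_map_eq_zero]
      intro q hq
      have : q ∈ Q := hq
      rw [hQ] at this
      simpa using this
    · intro u
      have hu := hc.monomialSpan_eq_top hv.1 hv.2 hne u
      have : Submodule.span ℂ (Set.range (monomial f v)) ≤ LinearMap.range E := by
        rw [Submodule.span_le]
        rintro _ ⟨l, rfl⟩
        refine ⟨⟨monomial f ((v, w) : V × W) l, monomial_mem_of_mem P hpP l⟩, ?_⟩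
        change (monomial f ((v, w) : V × W) l).1 = monomial f v l
        induction l with
        | nil => rfl
        | cons i l ih => exact congrArg (fun z => ⁅f i, z⁆) ih
      exact this hu
  let E' := LinearEquiv.ofBijective E hE
  have hE' : ∀ q : P, E'.symm q.1.1 = q := fun q => E'.symm_apply_apply q
  refine ⟨{ toLinearMap := LinearMap.snd ℂ V W ∘ₗ P.toSubmodule.subtype ∘ₗ E'.symm.toLinearMap
            map_lie' := ?_ }, ?_⟩
  · intro x u
    obtain ⟨q, rfl⟩ := E'.surjective u
    change (E'.symm (⁅x, q⁆ : P).1.1).1.2 = ⁅x, (E'.symm q.1.1).1.2⁆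
    rw [hE', hE']
    rfl
  · change (E'.symm (⟨(v, w), hpP⟩ : P).1.1).1.2 = w
    rw [hE']

theorem IsChevalley.finrank_hom (hc : IsChevalley b e f) [LieModule.IsIrreducible ℂ L V]
    {χ : Dual ℂ H} {v : V} (hv : v ∈ hwVectors e χ V) (hne : v ≠ 0) :
    finrank ℂ (V →ₗ⁅ℂ, L⁆ W) = finrank ℂ (hwVectors e χ W) := by
  have hv' := mem_hwVectors.1 hv
  let Ev : (V →ₗ⁅ℂ, L⁆ W) →ₗ[ℂ] hwVectors e χ W :=
    { toFun := fun T => ⟨T v, mem_hwVectors.2 ⟨fun x => by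
          rw [← LieModuleHom.map_lie, hv'.1 x, map_smul],
        fun i => by rw [← LieModuleHom.map_lie, hv'.2 i, map_zero]⟩⟩
      map_add' := fun S T => rfl
      map_smul' := fun c T => rfl }
  refine (LinearEquiv.ofBijective Ev ⟨?_, ?_⟩).finrank_eq
  · rw [injective_iff_map_eq_zero]
    intro T hT
    have hTv : T v = 0 := congrArg Subtype.val hT
    have hker : v ∈ T.ker := hTv
    ext u
    have hu := hc.monomialSpan_eq_top hv'.1 hv'.2 hne u
    have : Submodule.span ℂ (Set.range (monomial f v)) ≤ T.ker.toSubmodule := by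
      rw [Submodule.span_le]
      rintro _ ⟨l, rfl⟩
      exact monomial_mem_of_mem T.ker hker l
    exact this hu
  · intro w
    obtain ⟨T, hT⟩ := hc.exists_hom hv hne w.2
    exact ⟨T, Subtype.ext hT⟩

end HighestWeightVectors

/-! ### Multiplicity-free weights of multiples of fundamental modules -/

section Subtrees

set_option linter.unusedSectionVars false

variable {I : Type*} [DecidableEq I] (G : SimpleGraph I) (S : Finset I) (i : I)

/-- The set `K` is empty, or `i ∈ S` and `K` is a subtree that contains `i`: it is closed under
passing to the parent with respect to the root `i`. -/
def IsSubtree (K : Finset I) : Prop := ∀ k ∈ K, i ∈ S ∧ (k ≠ i → par G i k ∈ K)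

variable {G S i}

theorem IsSubtree.root_mem (hc : G.Connected) {K : Finset I} (hK : IsSubtree G S i K) {k : I}
    (hk : k ∈ K) : i ∈ K := by
  revert hk
  refine par_induction hc i (P := fun k => k ∈ K → i ∈ K) id ?_ k
  intro k hk ih h
  exact ih ((hK k h).2 hk)

/-- A vertex of maximal distance from the root can be removed from a subtree. -/
theorem IsSubtree.exists_erase (hc : G.Connected) {K : Finset I} (hK : IsSubtree G S i K)
    (hne : K.Nonempty) : ∃ k ∈ K, IsSubtree G S i (K.erase k) := by
  obtain ⟨k, hk, hmax⟩ := K.exists_max_image (fun k => G.dist i k) hne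
  refine ⟨k, hk, fun j hj => ?_⟩
  rw [Finset.mem_erase] at hj
  refine ⟨(hK j hj.2).1, fun hji => Finset.mem_erase.2 ⟨?_, (hK j hj.2).2 hji⟩⟩
  rintro rfl
  have h1 := (par_spec hc hji).2
  have h2 := hmax j hj.2
  omega

theorem IsSubtree.inter {K K' : Finset I} (hK : IsSubtree G S i K) (hK' : IsSubtree G S i K') :
    IsSubtree G S i (K ∩ K') := fun k hk => by
  rw [Finset.mem_inter] at hk
  exact ⟨(hK k hk.1).1, fun h => Finset.mem_inter.2 ⟨(hK k hk.1).2 h, (hK' k hk.2).2 h⟩⟩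

theorem isSubtree_empty : IsSubtree G S i ∅ := fun k hk => by simp at hk

end Subtrees

section Fundamental

set_option linter.unusedSectionVars false

open LieAlgebra LieAlgebra.IsKilling LieModule Module

variable {L : Type*} [LieRing L] [LieAlgebra ℂ L] [FiniteDimensional ℂ L] [LieAlgebra.IsSimple ℂ L]
  {H : LieSubalgebra ℂ L} [H.IsCartanSubalgebra] (b : (rootSystem H).Base)

theorem cast_cartanMatrix (j k : b.support) :
    ((b.cartanMatrix j k : ℤ) : ℂ) = (rootSystem H).root j ((rootSystem H).coroot k) := by
  have := RootPairing.Base.algebraMap_cartanMatrixIn_apply (P := rootSystem H) ℤ b j k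
  simpa using this

theorem root_coroot_ne_zero {j k : b.support} (h : (dynkinGraph b).Adj j k) :
    (rootSystem H).root j ((rootSystem H).coroot k) ≠ 0 := by
  rw [← cast_cartanMatrix]
  exact_mod_cast h.2

theorem root_coroot_eq_zero {j k : b.support} (hne : j ≠ k) (h : ¬ (dynkinGraph b).Adj j k) :
    (rootSystem H).root j ((rootSystem H).coroot k) = 0 := by
  rw [← cast_cartanMatrix]
  by_contra h0
  exact h ⟨hne, fun h1 => h0 (by rw [h1, Int.cast_zero])⟩

variable [DecidableEq b.support]

theorem theta_eq_rootComb (K : Finset b.support) :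
    theta b K = rootComb b fun k => if k ∈ K then 1 else 0 := by
  simp only [theta, rootComb, ite_smul, one_smul, zero_smul, Finset.sum_ite_mem,
    Finset.univ_inter]

variable {b}

theorem theta_injective : Function.Injective (theta b) := by
  intro K K' h
  rw [theta_eq_rootComb, theta_eq_rootComb] at h
  ext k
  have := congrFun (rootComb_injective h) k
  by_cases h1 : k ∈ K <;> by_cases h2 : k ∈ K' <;> simp_all

theorem theta_erase {K : Finset b.support} {k : b.support} (hk : k ∈ K) :
    theta b (K.erase k) + (rootSystem H).root k = theta b K :=
  Finset.sum_erase_add K _ hk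

theorem theta_empty : theta b (∅ : Finset b.support) = 0 := Finset.sum_empty

variable {S : Finset b.support} {i : b.support}

theorem theta_erase_coroot (hT : (dynkinGraph b).IsTree) {K : Finset b.support} {k : b.support}
    (hki : k ≠ i) (hK : IsSubtree (dynkinGraph b) S i (K.erase k)) :
    theta b (K.erase k) ((rootSystem H).coroot k)
      = if par (dynkinGraph b) i k ∈ K then
        (rootSystem H).root (par (dynkinGraph b) i k : b.support) ((rootSystem H).coroot k)
        else 0 := by
  have hp := (par_spec hT.connected hki).1
  have h0 : ∀ j ∈ K.erase k, j ≠ par (dynkinGraph b) i k →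
      (rootSystem H).root j ((rootSystem H).coroot k) = 0 := by
    intro j hj hjp
    refine root_coroot_eq_zero b (Finset.mem_erase.1 hj).1 fun hadj => ?_
    obtain ⟨hji, hpj⟩ := par_eq_of_ne hT hadj.symm hjp
    have := (hK j hj).2 hji
    rw [hpj] at this
    simp at this
  rw [theta, LinearMap.sum_apply]
  split_ifs with h
  · exact Finset.sum_eq_single_of_mem _ (Finset.mem_erase.2 ⟨hp.ne', h⟩) h0
  · refine Finset.sum_eq_zero fun j hj => h0 j hj ?_
    rintro rfl
    exact h (Finset.mem_erase.1 hj).2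

/-- The scalar by which `h_k` acts on a vector of weight `χ - ϑ_{K \ {k}}`. -/
def eraseCoeff (χ : Dual ℂ H) (K : Finset b.support) (k : b.support) : ℂ :=
  (χ - theta b (K.erase k)) ((rootSystem H).coroot k)

theorem eraseCoeff_of_ne (hT : (dynkinGraph b).IsTree) {χ : Dual ℂ H}
    (hχ : ∀ j : b.support, j ≠ i → χ ((rootSystem H).coroot j) = 0) {K : Finset b.support}
    {k : b.support} (hki : k ≠ i) (hK : IsSubtree (dynkinGraph b) S i (K.erase k)) :
    eraseCoeff χ K k = if par (dynkinGraph b) i k ∈ K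
      then -(rootSystem H).root (par (dynkinGraph b) i k : b.support) ((rootSystem H).coroot k)
      else 0 := by
  rw [eraseCoeff, LinearMap.sub_apply, hχ k hki, theta_erase_coroot hT hki hK]
  split_ifs <;> simp

theorem eraseCoeff_ne_zero_iff (hT : (dynkinGraph b).IsTree) {χ : Dual ℂ H}
    (hχ : ∀ j : b.support, j ≠ i → χ ((rootSystem H).coroot j) = 0)
    (hχi : χ ((rootSystem H).coroot i) ≠ 0 ↔ i ∈ S) {K : Finset b.support} {k : b.support}
    (hk : k ∈ K) (hK : IsSubtree (dynkinGraph b) S i (K.erase k)) :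
    eraseCoeff χ K k ≠ 0 ↔ IsSubtree (dynkinGraph b) S i K := by
  by_cases hki : k = i
  · subst hki
    have h0 : K.erase k = ∅ := by
      rw [Finset.eq_empty_iff_forall_notMem]
      intro j hj
      have := hK.root_mem hT.connected hj
      simp at this
    rw [eraseCoeff, h0, theta_empty, sub_zero, hχi]
    constructor
    · intro hkS j hj
      refine ⟨hkS, fun hjk => ?_⟩
      have : j ∈ K.erase k := Finset.mem_erase.2 ⟨hjk, hj⟩
      rw [h0] at this
      simp at this
    · exact fun h => (h k hk).1
  · rw [eraseCoeff_of_ne hT hχ hki hK]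
    have hp := (par_spec hT.connected hki).1
    split_ifs with h
    · simp only [ne_eq, neg_eq_zero, root_coroot_ne_zero b hp.symm, not_false_eq_true, true_iff]
      have hpe : par (dynkinGraph b) i k ∈ K.erase k := Finset.mem_erase.2 ⟨hp.ne', h⟩
      intro j hj
      refine ⟨(hK _ hpe).1, fun hji => ?_⟩
      by_cases hjk : j = k
      · rw [hjk]; exact h
      · exact (Finset.mem_erase.1 ((hK j (Finset.mem_erase.2 ⟨hjk, hj⟩)).2 hji)).2
    · simp only [ne_eq, not_true_eq_false, false_iff]
      exact fun h' => h ((h' k hk).2 hki)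

variable {V : Type*} [AddCommGroup V] [Module ℂ V] [LieRingModule L V] [LieModule ℂ L V]

open scoped Classical in
/-- A vector of weight `χ - ϑ_K` in a module generated by a vector `v` of highest weight `χ`, where
`χ` is a multiple of the `i`-th fundamental weight. It vanishes unless `K` is a subtree rooted at
`i`; for subtrees it is normalized so that `e_k` sends the vector of `K` to that of `K \ {k}`. -/
def treeVec (f : b.support → L) (χ : Dual ℂ H) (v : V) (S : Finset b.support) (i : b.support)
    (K : Finset b.support) : V :=
  if h : ∃ k ∈ K, IsSubtree (dynkinGraph b) S i (K.erase k) ∧ IsSubtree (dynkinGraph b) S i K then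
    (eraseCoeff χ K h.choose)⁻¹ • ⁅f h.choose, treeVec f χ v S i (K.erase h.choose)⁆
  else if K = ∅ then v else 0
termination_by K.card
decreasing_by exact Finset.card_erase_lt_of_mem h.choose_spec.1

variable {e f : b.support → L} {χ : Dual ℂ H} {v : V}

theorem treeVec_empty : treeVec f χ v S i ∅ = v := by
  rw [treeVec, dif_neg (by simp), if_pos rfl]

theorem treeVec_of_not_isSubtree {K : Finset b.support} (hK : ¬ IsSubtree (dynkinGraph b) S i K) :
    treeVec f χ v S i K = 0 := by
  rw [treeVec, dif_neg (by simp [hK]), if_neg]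
  rintro rfl
  exact hK isSubtree_empty

theorem exists_treeVec_eq (hT : (dynkinGraph b).IsTree) {K : Finset b.support}
    (hK : IsSubtree (dynkinGraph b) S i K) (hne : K.Nonempty) :
    ∃ k ∈ K, IsSubtree (dynkinGraph b) S i (K.erase k) ∧ treeVec f χ v S i K
      = (eraseCoeff χ K k)⁻¹ • ⁅f k, treeVec f χ v S i (K.erase k)⁆ := by
  obtain ⟨k, hk, hKk⟩ := hK.exists_erase hT.connected hne
  have h : ∃ k ∈ K, IsSubtree (dynkinGraph b) S i (K.erase k) ∧ IsSubtree (dynkinGraph b) S i K :=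
    ⟨k, hk, hKk, hK⟩
  refine ⟨h.choose, h.choose_spec.1, h.choose_spec.2.1, ?_⟩
  conv_lhs => rw [treeVec, dif_pos h]

theorem treeVec_mem (hT : (dynkinGraph b).IsTree) (hc : IsChevalley b e f) (hv : v ∈ wtSpace V χ)
    (K : Finset b.support) : treeVec f χ v S i K ∈ wtSpace V (χ - theta b K) := by
  induction hn : K.card using Nat.strong_induction_on generalizing K with
  | _ n ih =>
  by_cases hK : IsSubtree (dynkinGraph b) S i K
  · rcases K.eq_empty_or_nonempty with rfl | hne
    · rw [treeVec_empty, theta_empty, sub_zero]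
      exact hv
    · obtain ⟨k, hk, -, heq⟩ := exists_treeVec_eq (f := f) (χ := χ) (v := v) hT hK hne
      rw [heq, ← theta_erase hk, ← sub_sub]
      exact Submodule.smul_mem _ _ (hc.lie_f_mem
        (ih _ (hn ▸ Finset.card_erase_lt_of_mem hk) _ rfl) k)
  · rw [treeVec_of_not_isSubtree hK]
    exact zero_mem _

/-- The vector attached to `K` is normalized so that every `e_k` with `k ∈ K` takes it to the vector
attached to `K \ {k}`, and it spans its weight space. -/
structure TreeVecSpec (e f : b.support → L) (χ : Dual ℂ H) (v : V) (S : Finset b.support)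
    (i : b.support) (K : Finset b.support) : Prop where
  lie_e_of_mem : IsSubtree (dynkinGraph b) S i K → ∀ k ∈ K,
    ⁅e k, treeVec f χ v S i K⁆ = treeVec f χ v S i (K.erase k)
  lie_e_of_notMem : ∀ k, k ∉ K → ⁅e k, treeVec f χ v S i K⁆ = 0
  lie_f : ∀ k ∈ K, IsSubtree (dynkinGraph b) S i (K.erase k) →
    ⁅f k, treeVec f χ v S i (K.erase k)⁆ = eraseCoeff χ K k • treeVec f χ v S i K
  exists_smul : ∀ m ∈ wtSpace V (χ - theta b K), ∃ c : ℂ, m = c • treeVec f χ v S i K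

theorem TreeVecSpec.lie_e_lie_f (hT : (dynkinGraph b).IsTree) (hc : IsChevalley b e f)
    (hχ : ∀ j : b.support, j ≠ i → χ ((rootSystem H).coroot j) = 0) (hv : v ∈ wtSpace V χ)
    {K : Finset b.support} (hspec : ∀ j ∈ K, TreeVecSpec e f χ v S i (K.erase j))
    {k : b.support} (hk : k ∈ K) (hKk : IsSubtree (dynkinGraph b) S i (K.erase k))
    {j : b.support} (hj : j ∈ K) :
    ⁅e j, ⁅f k, treeVec f χ v S i (K.erase k)⁆⁆
      = eraseCoeff χ K k • treeVec f χ v S i (K.erase j) := by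
  by_cases hjk : j = k
  · subst hjk
    rw [hc.lie_e_lie_f (treeVec_mem hT hc hv _), (hspec j hj).lie_e_of_notMem j (by simp),
      lie_zero, zero_add, eraseCoeff]
  · have hjK : j ∈ K.erase k := Finset.mem_erase.2 ⟨hjk, hj⟩
    have hkK : k ∈ K.erase j := Finset.mem_erase.2 ⟨Ne.symm hjk, hk⟩
    rw [hc.lie_e_lie_f_of_ne hjk, (hspec k hk).lie_e_of_mem hKk j hjK, Finset.erase_right_comm]
    by_cases hKj : IsSubtree (dynkinGraph b) S i (K.erase j)
    · have hki : k ≠ i := by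
        rintro rfl
        have := hKk.root_mem hT.connected hjK
        simp at this
      have hKjk : IsSubtree (dynkinGraph b) S i ((K.erase j).erase k) := by
        have := hKj.inter hKk
        convert this using 1
        ext m
        simp only [Finset.mem_erase, Finset.mem_inter]
        tauto
      rw [(hspec j hj).lie_f k hkK hKjk, eraseCoeff_of_ne hT hχ hki hKk,
        eraseCoeff_of_ne hT hχ hki hKjk]
      have h1 := (hKj k hkK).2 hki
      rw [if_pos h1, if_pos (Finset.mem_erase.1 h1).2]
    · have hmem := hc.lie_f_mem (treeVec_mem (S := S) (i := i) hT hc hv ((K.erase j).erase k)) k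
      rw [sub_sub, theta_erase hkK] at hmem
      obtain ⟨c, hcm⟩ := (hspec j hj).exists_smul _ hmem
      rw [hcm, treeVec_of_not_isSubtree hKj, smul_zero, smul_zero]

theorem treeVecSpec (hT : (dynkinGraph b).IsTree) (hc : IsChevalley b e f)
    [LieModule.IsIrreducible ℂ L V]
    (hχ : ∀ j : b.support, j ≠ i → χ ((rootSystem H).coroot j) = 0)
    (hχi : χ ((rootSystem H).coroot i) ≠ 0 ↔ i ∈ S) (hv : v ∈ hwVectors e χ V) (hv0 : v ≠ 0)
    (K : Finset b.support) : TreeVecSpec e f χ v S i K := by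
  induction hn : K.card using Nat.strong_induction_on generalizing K with
  | _ n ih =>
  rw [mem_hwVectors] at hv
  have hspec : ∀ j ∈ K, TreeVecSpec e f χ v S i (K.erase j) := fun j hj =>
    ih _ (hn ▸ Finset.card_erase_lt_of_mem hj) _ rfl
  rcases K.eq_empty_or_nonempty with rfl | hne
  · refine ⟨fun _ k hk => by simp at hk, fun k _ => by rw [treeVec_empty]; exact hv.2 k,
      fun k hk => by simp at hk, fun m hm => ?_⟩
    rw [theta_empty, sub_zero] at hm
    rw [treeVec_empty]
    exact hc.mem_span_self hv.1 hm (hc.monomialSpan_eq_top hv.1 hv.2 hv0 m)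
  have hwt : χ - theta b K ≠ χ := fun h => by
    rw [sub_eq_self, ← theta_empty (b := b)] at h
    exact hne.ne_empty (theta_injective (b := b) h)
  have hA : ∀ k ∈ K, IsSubtree (dynkinGraph b) S i (K.erase k) → ∀ j ∈ K,
      ⁅e j, ⁅f k, treeVec f χ v S i (K.erase k)⁆⁆
        = eraseCoeff χ K k • treeVec f χ v S i (K.erase j) := fun k hk hKk j hj =>
    TreeVecSpec.lie_e_lie_f hT hc hχ hv.1 hspec hk hKk hj
  have hA' : ∀ k ∈ K, ∀ j, j ∉ K → ⁅e j, ⁅f k, treeVec f χ v S i (K.erase k)⁆⁆ = 0 := by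
    intro k hk j hj
    have hjk : j ≠ k := fun h => hj (h ▸ hk)
    rw [hc.lie_e_lie_f_of_ne hjk,
      (hspec k hk).lie_e_of_notMem j (fun h => hj (Finset.mem_erase.1 h).2), lie_zero]
  have hymem : ∀ k ∈ K, ⁅f k, treeVec f χ v S i (K.erase k)⁆ ∈ wtSpace V (χ - theta b K) := by
    intro k hk
    have := hc.lie_f_mem (treeVec_mem (S := S) (i := i) hT hc hv.1 (K.erase k)) k
    rwa [sub_sub, theta_erase hk] at this
  have h1 : IsSubtree (dynkinGraph b) S i K → ∀ k ∈ K,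
      ⁅e k, treeVec f χ v S i K⁆ = treeVec f χ v S i (K.erase k) := by
    intro hK j hj
    obtain ⟨k, hk, hKk, heq⟩ := exists_treeVec_eq (f := f) (χ := χ) (v := v) hT hK hne
    rw [heq, lie_smul, hA k hk hKk j hj,
      inv_smul_smul₀ ((eraseCoeff_ne_zero_iff hT hχ hχi hk hKk).2 hK)]
  have h2 : ∀ k, k ∉ K → ⁅e k, treeVec f χ v S i K⁆ = 0 := by
    intro j hj
    by_cases hK : IsSubtree (dynkinGraph b) S i K
    · obtain ⟨k, hk, hKk, heq⟩ := exists_treeVec_eq (f := f) (χ := χ) (v := v) hT hK hne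
      rw [heq, lie_smul, hA' k hk j hj, smul_zero]
    · rw [treeVec_of_not_isSubtree hK, lie_zero]
  have h3 : ∀ k ∈ K, IsSubtree (dynkinGraph b) S i (K.erase k) →
      ⁅f k, treeVec f χ v S i (K.erase k)⁆ = eraseCoeff χ K k • treeVec f χ v S i K := by
    intro k hk hKk
    rw [← sub_eq_zero]
    refine hc.eq_zero_of_lie_e hv.1 hv.2 hv0 (sub_mem (hymem k hk)
      (Submodule.smul_mem _ _ (treeVec_mem hT hc hv.1 K))) (fun j => ?_) hwt
    rw [lie_sub, lie_smul]
    by_cases hj : j ∈ K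
    · rw [hA k hk hKk j hj]
      by_cases hK : IsSubtree (dynkinGraph b) S i K
      · rw [h1 hK j hj, sub_self]
      · have : eraseCoeff χ K k = 0 := by
          by_contra h
          exact hK ((eraseCoeff_ne_zero_iff hT hχ hχi hk hKk).1 h)
        rw [this, zero_smul, zero_smul, sub_zero]
    · rw [hA' k hk j hj, h2 j hj, smul_zero, sub_zero]
  refine ⟨h1, h2, h3, fun m hm => ?_⟩
  have hspan := hc.monomialSpan_eq_top hv.1 hv.2 hv0 m
  rw [theta_eq_rootComb] at hm
  have hm' := hc.mem_span_monomial hv.1 _ hm hspan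
  have hle : Submodule.span ℂ (monomial f v ''
      {l | ∀ i, l.count i = if i ∈ K then 1 else 0}) ≤ ℂ ∙ treeVec f χ v S i K := by
    rw [Submodule.span_le]
    rintro _ ⟨l, hl, rfl⟩
    cases l with
    | nil =>
      obtain ⟨k, hk⟩ := hne
      have := hl k
      simp [hk] at this
    | cons k l =>
      have hk : k ∈ K := by
        by_contra h
        have := hl k
        simp [h] at this
      have hl' : (fun j => l.count j) = fun j => if j ∈ K.erase k then 1 else 0 := by
        funext j
        have := hl j
        rw [List.count_cons] at this
        by_cases hjk : j = k
        · subst hjk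
          simp [hk] at this ⊢
          omega
        · simpa [hjk, Ne.symm hjk] using this
      have hmem := hc.monomial_mem hv.1 l
      have hmem' : monomial f v l ∈ wtSpace V (χ - theta b (K.erase k)) := by
        rw [theta_eq_rootComb, ← hl']
        convert hmem
      obtain ⟨c, hcm⟩ := (hspec k hk).exists_smul _ hmem'
      change ⁅f k, monomial f v l⁆ ∈ ℂ ∙ treeVec f χ v S i K
      rw [hcm, lie_smul]
      refine Submodule.smul_mem _ _ ?_
      by_cases hKk : IsSubtree (dynkinGraph b) S i (K.erase k)
      · rw [h3 k hk hKk]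
        exact Submodule.smul_mem _ _ (Submodule.mem_span_singleton_self _)
      · rw [treeVec_of_not_isSubtree hKk, lie_zero]
        exact zero_mem _
  obtain ⟨c, hcm⟩ := Submodule.mem_span_singleton.1 (hle (by convert hm'))
  exact ⟨c, hcm.symm⟩

theorem treeVec_ne_zero (hT : (dynkinGraph b).IsTree)
    (hspec : ∀ K, TreeVecSpec e f χ v S i K) (hv0 : v ≠ 0)
    {K : Finset b.support} (hK : IsSubtree (dynkinGraph b) S i K) : treeVec f χ v S i K ≠ 0 := by
  induction hn : K.card using Nat.strong_induction_on generalizing K with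
  | _ n ih =>
  rcases K.eq_empty_or_nonempty with rfl | hne
  · rwa [treeVec_empty]
  · obtain ⟨k, hk, hKk⟩ := hK.exists_erase hT.connected hne
    intro h0
    have h1 := (hspec K).lie_e_of_mem hK k hk
    rw [h0, lie_zero] at h1
    exact ih _ (hn ▸ Finset.card_erase_lt_of_mem hk) hKk rfl h1.symm

end Fundamental

/-! ### Highest weight vectors in a tensor product -/

section TensorVectors

set_option linter.unusedSectionVars false

open LieAlgebra LieAlgebra.IsKilling LieModule Module PiTensorProduct

section Fibers

variable {I : Type*} [Fintype I] [DecidableEq I]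

/-- The set of vertices owned by `i`. -/
def fiber (o : I → Option I) (i : I) : Finset I := Finset.univ.filter fun k => o k = some i

theorem mem_fiber {o : I → Option I} {i k : I} : k ∈ fiber o i ↔ o k = some i := by
  simp [fiber]

theorem isValid_iff {G : SimpleGraph I} {S : Finset I} {o : I → Option I} :
    IsValid G S o ↔ ∀ i, IsSubtree G S i (fiber o i) := by
  simp only [IsValid, IsSubtree, mem_fiber]
  exact forall_comm

theorem fiber_update_none (o : I → Option I) (k i : I) :
    fiber (Function.update o k none) i = (fiber o i).erase k := by
  ext m
  rw [mem_fiber, Finset.mem_erase, mem_fiber]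
  by_cases hm : m = k
  · subst hm; simp
  · simp [hm]

theorem eq_of_fiber_eq {o o' : I → Option I} (h : ∀ i, fiber o i = fiber o' i) : o = o' := by
  funext k
  apply Option.ext
  intro i
  rw [← mem_fiber, ← mem_fiber, h]

/-- A sum over all functions `o` that depends on `o` with its value at `k` forgotten. -/
theorem sum_update_none {M : Type*} [AddCommGroup M] [Module ℂ M] (k : I)
    (x : (I → Option I) → ℂ) (hx : ∀ o, o k = none → x o = 0) (T : (I → Option I) → M) :
    ∑ o, x o • T (Function.update o k none)
      = ∑ o, (if o k = none then ∑ i, x (Function.update o k (some i)) else 0) • T o := by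
  rw [← Finset.sum_fiberwise Finset.univ (fun o => Function.update o k none)]
  refine Finset.sum_congr rfl fun o' _ => ?_
  have h1 : ∀ o ∈ Finset.univ.filter fun o => Function.update o k none = o',
      x o • T (Function.update o k none) = x o • T o' := fun o ho => by
    rw [(Finset.mem_filter.1 ho).2]
  rw [Finset.sum_congr rfl h1, ← Finset.sum_smul]
  congr 1
  split_ifs with h
  · have h2 : (Finset.univ.filter fun o => Function.update o k none = o')
        = Finset.univ.image fun z : Option I => Function.update o' k z := by
      ext o
      simp only [Finset.mem_filter, Finset.mem_univ, true_and, Finset.mem_image]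
      constructor
      · rintro rfl
        exact ⟨o k, by simp⟩
      · rintro ⟨z, rfl⟩
        rw [Function.update_idem, ← h, Function.update_eq_self]
    rw [h2, Finset.sum_image (fun a _ b _ hab => by
      have := congrFun hab k
      simpa using this), Fintype.sum_option, hx _ (by simp), zero_add]
  · rw [Finset.filter_eq_empty_iff.2, Finset.sum_empty]
    rintro o - rfl
    simp at h

end Fibers

variable {L : Type*} [LieRing L] [LieAlgebra ℂ L] [FiniteDimensional ℂ L] [LieAlgebra.IsSimple ℂ L]
  {H : LieSubalgebra ℂ L} [H.IsCartanSubalgebra] {b : (rootSystem H).Base}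
  [DecidableEq b.support] {B S : Finset b.support}
  {V : B → Type*} [∀ i, AddCommGroup (V i)] [∀ i, Module ℂ (V i)]
  [∀ i, LieRingModule L (V i)] [∀ i, LieModule ℂ L (V i)]

theorem lie_tprod_eq (x : L) (m : ∀ i, V i) :
    ⁅x, tprod ℂ m⁆ = ∑ i, tprod ℂ (Function.update m i ⁅x, m i⁆) := by
  rw [lie_tprod]
  refine Finset.sum_congr rfl fun i _ => ?_
  congr 1
  convert rfl

theorem tprod_mem_wtSpace {m : ∀ i, V i} {w : B → Dual ℂ H} (hm : ∀ i, m i ∈ wtSpace (V i) (w i)) :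
    (tprod ℂ m : ⨂[ℂ] i, V i) ∈ wtSpace (⨂[ℂ] i, V i) (∑ i, w i) := by
  rw [mem_wtSpace]
  intro x
  have h : ∀ i, tprod ℂ (Function.update m i ⁅(x : L), m i⁆)
      = w i x • (tprod ℂ m : ⨂[ℂ] i, V i) := fun i => by
    rw [hm i x, MultilinearMap.map_update_smul, Function.update_eq_self]
  rw [lie_tprod_eq, Finset.sum_congr rfl fun i _ => h i, ← Finset.sum_smul]
  congr 1
  exact (LinearMap.sum_apply _ _ _).symm

variable {e f : b.support → L} {χ : B → Dual ℂ H} {v : ∀ i, V i}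

/-- The tensor product of the vectors attached to the subtrees of the partition `o`. -/
def tensorVec (f : b.support → L) (χ : B → Dual ℂ H) (v : ∀ i, V i) (S : Finset b.support)
    (o : b.support → Option b.support) : ⨂[ℂ] i, V i :=
  tprod ℂ fun i => treeVec f (χ i) (v i) S i (fiber o i)

section Action

variable (hspec : ∀ (i : B) (K : Finset b.support), TreeVecSpec e f (χ i) (v i) S i K)

include hspec

theorem lie_e_tensorVec_of_eq_none {o : b.support → Option b.support} {k : b.support}
    (hk : o k = none) : ⁅e k, tensorVec f χ v S o⁆ = 0 := by
  rw [tensorVec, lie_tprod_eq]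
  refine Finset.sum_eq_zero fun i _ => ?_
  rw [(hspec i _).lie_e_of_notMem k (by simp [mem_fiber, hk]), MultilinearMap.map_update_zero]

theorem lie_e_tensorVec (hSB : S ⊆ B) {o : b.support → Option b.support}
    (ho : IsValid (dynkinGraph b) S o) {k : b.support} (hk : o k ≠ none) :
    ⁅e k, tensorVec f χ v S o⁆ = tensorVec f χ v S (Function.update o k none) := by
  obtain ⟨j, hj⟩ := Option.ne_none_iff_exists'.1 hk
  have hjB : j ∈ B := hSB (ho k j hj).1
  rw [tensorVec, lie_tprod_eq, Finset.sum_eq_single (⟨j, hjB⟩ : B)]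
  · rw [(hspec _ _).lie_e_of_mem (isValid_iff.1 ho j) k (mem_fiber.2 hj), tensorVec]
    congr 1
    funext i
    by_cases hi : i = ⟨j, hjB⟩
    · subst hi
      rw [Function.update_self, fiber_update_none]
    · rw [Function.update_of_ne hi, fiber_update_none, Finset.erase_eq_of_notMem]
      rw [mem_fiber, hj]
      exact fun h => hi (Subtype.ext (Option.some_injective _ h).symm)
  · intro i _ hi
    rw [(hspec i _).lie_e_of_notMem k, MultilinearMap.map_update_zero]
    rw [mem_fiber, hj]
    exact fun h => hi (Subtype.ext (Option.some_injective _ h).symm)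
  · simp

end Action

theorem sum_theta_fiber (hSB : S ⊆ B) {o : b.support → Option b.support}
    (ho : IsValid (dynkinGraph b) S o) {J : Finset b.support} (hd : HasDom o J) :
    ∑ i : B, theta b (fiber o i) = theta b J := by
  have h1 : ∀ i : B, theta b (fiber o i)
      = ∑ k, if o k = some i.1 then (rootSystem H).root k else 0 := fun i => by
    rw [theta, fiber, Finset.sum_filter]
  rw [Finset.sum_congr rfl fun i _ => h1 i, Finset.sum_comm, theta,
    ← Finset.sum_filter_add_sum_filter_not Finset.univ (· ∈ J), Finset.filter_univ_mem,
    add_eq_left.2 (Finset.sum_eq_zero _)]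
  · refine Finset.sum_congr rfl fun k hk => ?_
    obtain ⟨j, hj⟩ := hd.exists_eq hk
    rw [Finset.sum_eq_single (⟨j, hSB (ho k j hj).1⟩ : B), if_pos hj]
    · intro i _ hi
      rw [if_neg]
      rw [hj]
      exact fun h => hi (Subtype.ext (Option.some_injective _ h).symm)
    · simp
  · intro k hk
    rw [Finset.mem_filter] at hk
    refine Finset.sum_eq_zero fun i _ => if_neg ?_
    rw [hd.eq_none hk.2]
    simp

theorem tensorVec_mem (hT : (dynkinGraph b).IsTree) (hc : IsChevalley b e f)
    (hv : ∀ i, v i ∈ wtSpace (V i) (χ i)) (hSB : S ⊆ B) {o : b.support → Option b.support}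
    (ho : IsValid (dynkinGraph b) S o) {J : Finset b.support} (hd : HasDom o J) :
    tensorVec f χ v S o ∈ wtSpace (⨂[ℂ] i, V i) (∑ i, χ i - theta b J) := by
  rw [← sum_theta_fiber hSB ho hd, ← Finset.sum_sub_distrib]
  exact tprod_mem_wtSpace fun i => treeVec_mem hT hc (hv i) _

theorem exists_dual_of_linearIndependent {ι M : Type*} [AddCommGroup M] [Module ℂ M] {u : ι → M}
    (hu : LinearIndependent ℂ u) (i : ι) :
    ∃ φ : M →ₗ[ℂ] ℂ, φ (u i) = 1 ∧ ∀ j, j ≠ i → φ (u j) = 0 := by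
  classical
  obtain ⟨φ, hφ⟩ := LinearMap.exists_extend ((Finsupp.lapply i).comp hu.repr)
  have h : ∀ j, φ (u j) = Finsupp.single j (1 : ℂ) i := fun j => by
    have h1 := LinearMap.congr_fun hφ ⟨u j, Submodule.subset_span ⟨j, rfl⟩⟩
    have h2 := hu.repr_eq_single j ⟨u j, Submodule.subset_span ⟨j, rfl⟩⟩ rfl
    exact h1.trans (congrArg (fun z : ι →₀ ℂ => z i) h2)
  exact ⟨φ, by rw [h, Finsupp.single_eq_same], fun j hj => by rw [h, Finsupp.single_eq_of_ne' hj]⟩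

theorem linearIndependent_treeVec (hT : (dynkinGraph b).IsTree) (hc : IsChevalley b e f)
    {i : B} (hspec : ∀ K : Finset b.support, TreeVecSpec e f (χ i) (v i) S i K)
    (hv : v i ∈ wtSpace (V i) (χ i)) (hv0 : v i ≠ 0) :
    LinearIndependent ℂ fun K : {K // IsSubtree (dynkinGraph b) S i K} =>
      treeVec f (χ i) (v i) S i K.1 := by
  have h := (iSupIndep_wtSpace (L := L) (H := H) (V i)).comp
    (f := fun K : {K // IsSubtree (dynkinGraph b) S i K} => χ i - theta b K.1)
    (fun K K' h => Subtype.ext (theta_injective (sub_right_injective h)))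
  exact h.linearIndependent _ (fun K => treeVec_mem hT hc hv K.1)
    (fun K => treeVec_ne_zero hT hspec hv0 K.2)

/-- The coordinate functional of the vector attached to the partition `o`: the tensor product of
coordinate functionals on the factors. -/
theorem exists_dual_tensorVec (hT : (dynkinGraph b).IsTree) (hc : IsChevalley b e f)
    (hspec : ∀ (i : B) (K : Finset b.support), TreeVecSpec e f (χ i) (v i) S i K)
    (hv : ∀ i, v i ∈ wtSpace (V i) (χ i)) (hv0 : ∀ i, v i ≠ 0) (hSB : S ⊆ B)
    {o : b.support → Option b.support} (ho : IsValid (dynkinGraph b) S o) :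
    ∃ Φ : (⨂[ℂ] i, V i) →ₗ[ℂ] ℂ, Φ (tensorVec f χ v S o) = 1 ∧
      ∀ o', IsValid (dynkinGraph b) S o' → o' ≠ o → Φ (tensorVec f χ v S o') = 0 := by
  have h : ∀ i : B, ∃ φ : V i →ₗ[ℂ] ℂ, φ (treeVec f (χ i) (v i) S i (fiber o i)) = 1 ∧
      ∀ K, IsSubtree (dynkinGraph b) S i K → K ≠ fiber o i →
        φ (treeVec f (χ i) (v i) S i K) = 0 := by
    intro i
    obtain ⟨φ, h1, h2⟩ := exists_dual_of_linearIndependent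
      (linearIndependent_treeVec hT hc (hspec i) (hv i) (hv0 i)) ⟨fiber o i, isValid_iff.1 ho i⟩
    exact ⟨φ, h1, fun K hK hne => h2 ⟨K, hK⟩ (fun h => hne (congrArg Subtype.val h))⟩
  choose φ h1 h2 using h
  refine ⟨PiTensorProduct.lift ((MultilinearMap.mkPiAlgebra ℂ B ℂ).compLinearMap φ), ?_, ?_⟩
  · rw [tensorVec, PiTensorProduct.lift.tprod]
    simp [h1]
  · intro o' ho' hne
    rw [tensorVec, PiTensorProduct.lift.tprod]
    have : ∃ i : B, fiber o' i ≠ fiber o i := by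
      by_contra! hall
      refine hne (eq_of_fiber_eq fun i => ?_)
      by_cases hi : i ∈ B
      · exact hall ⟨i, hi⟩
      · have hemp : ∀ {o}, IsValid (dynkinGraph b) S o → fiber o i = ∅ := fun {o} ho => by
          rw [Finset.eq_empty_iff_forall_notMem]
          exact fun k hk => hi (hSB (ho k i (mem_fiber.1 hk)).1)
        rw [hemp ho, hemp ho']
    obtain ⟨i, hi⟩ := this
    rw [MultilinearMap.compLinearMap_apply, MultilinearMap.mkPiAlgebra_apply]
    exact Finset.prod_eq_zero (Finset.mem_univ i) (h2 i _ (isValid_iff.1 ho' i) hi)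

/-- The tensor product of the given modules is spanned by tensor products of monomials. -/
theorem span_tprod_monomial
    (hspan : ∀ i, ∀ m : V i, m ∈ Submodule.span ℂ (Set.range (monomial f (v i))))
    (w : ⨂[ℂ] i, V i) :
    w ∈ Submodule.span ℂ (Set.range fun l : B → List b.support =>
      tprod ℂ fun i => monomial f (v i) (l i)) := by
  let bas := fun i => Basis.ofSpan (K := ℂ) (s := Set.range (monomial f (v i)))
    (fun m _ => hspan i m)
  have hb : ∀ i p, ∃ l, monomial f (v i) l = bas i p := fun i p =>
    Basis.ofSpan_subset (fun m _ => hspan i m) ⟨p, rfl⟩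
  choose l hl using hb
  have htop : w ∈ Submodule.span ℂ (Set.range (Basis.piTensorProduct bas)) := by
    rw [Basis.span_eq]; trivial
  refine Submodule.span_mono ?_ htop
  rintro _ ⟨p, rfl⟩
  refine ⟨fun i => l i (p i), ?_⟩
  rw [Basis.piTensorProduct_apply]
  simp only [hl]

theorem rootComb_sum {ι : Type*} [Fintype ι] (n : ι → b.support → ℕ) :
    rootComb b (fun k => ∑ i, n i k) = ∑ i, rootComb b (n i) := by
  simp only [rootComb, Finset.sum_smul]
  exact Finset.sum_comm

theorem tprod_monomial_mem (hc : IsChevalley b e f) (hv : ∀ i, v i ∈ wtSpace (V i) (χ i))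
    (l : B → List b.support) :
    (tprod ℂ (fun i => monomial f (v i) (l i)) : ⨂[ℂ] i, V i) ∈ wtSpace (⨂[ℂ] i, V i)
      (∑ i, χ i - rootComb b fun k => ∑ i, (l i).count k) := by
  have h := tprod_mem_wtSpace (fun i => hc.monomial_mem (hv i) (l i))
  rw [Finset.sum_sub_distrib, ← rootComb_sum] at h
  convert h

theorem exists_rootComb_of_wtSpace (hc : IsChevalley b e f)
    (hv : ∀ i, v i ∈ wtSpace (V i) (χ i))
    (hspan : ∀ i, ∀ m : V i, m ∈ Submodule.span ℂ (Set.range (monomial f (v i))))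
    {μ : Dual ℂ H} {w : ⨂[ℂ] i, V i} (hw : w ∈ wtSpace (⨂[ℂ] i, V i) μ) (hw0 : w ≠ 0) :
    ∃ n, μ = ∑ i, χ i - rootComb b n := by
  have h1 := mem_span_of_mem_wtSpace (tprod_monomial_mem hc hv) hw (span_tprod_monomial hspan w)
  by_contra! hn
  have h2 : {l : B → List b.support |
      ∑ i, χ i - rootComb b (fun k => ∑ i, (l i).count k) = μ} = ∅ := by
    ext l
    simpa using (hn _).symm
  rw [h2, Set.image_empty, Submodule.span_empty] at h1
  exact hw0 (by simpa using h1)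

/-- The weight space of weight `λ - ϑ_J` is spanned by the vectors attached to the partitions
of `J` into subtrees. -/
theorem mem_span_tensorVec (hc : IsChevalley b e f)
    (hspec : ∀ (i : B) (K : Finset b.support), TreeVecSpec e f (χ i) (v i) S i K)
    (hv : ∀ i, v i ∈ wtSpace (V i) (χ i))
    (hspan : ∀ i, ∀ m : V i, m ∈ Submodule.span ℂ (Set.range (monomial f (v i))))
    {J : Finset b.support} {w : ⨂[ℂ] i, V i}
    (hw : w ∈ wtSpace (⨂[ℂ] i, V i) (∑ i, χ i - theta b J)) :
    w ∈ Submodule.span ℂ (tensorVec f χ v S ''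
      {o | IsValid (dynkinGraph b) S o ∧ HasDom o J}) := by
  have h1 := mem_span_of_mem_wtSpace (tprod_monomial_mem hc hv) hw (span_tprod_monomial hspan w)
  refine (Submodule.span_le.2 ?_ : _ ≤ Submodule.span ℂ (tensorVec f χ v S ''
      {o | IsValid (dynkinGraph b) S o ∧ HasDom o J})) h1
  rintro _ ⟨l, hl, rfl⟩
  have hl1 : ∑ i, χ i - rootComb b (fun k => ∑ i, (l i).count k) = ∑ i, χ i - theta b J := hl
  rw [theta_eq_rootComb, sub_right_inj, rootComb_injective.eq_iff, funext_iff] at hl1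
  -- every simple root occurs at most once, in at most one of the factors
  have hle : ∀ i k, (l i).count k ≤ 1 := fun i k => by
    have h2 : (l i).count k ≤ ∑ i, (l i).count k :=
      Finset.single_le_sum (f := fun i => (l i).count k) (fun _ _ => Nat.zero_le _)
        (Finset.mem_univ i)
    rw [hl1 k] at h2
    split_ifs at h2 <;> omega
  have huniq : ∀ i j k, k ∈ l i → k ∈ l j → i = j := fun i j k hi hj => by
    by_contra hne
    have h2 : ∑ i ∈ ({i, j} : Finset B), (l i).count k ≤ ∑ i, (l i).count k :=
      Finset.sum_le_sum_of_subset (Finset.subset_univ _)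
    rw [Finset.sum_pair hne, hl1 k] at h2
    have h3 := List.count_pos_iff.2 hi
    have h4 := List.count_pos_iff.2 hj
    split_ifs at h2 <;> omega
  have hmem : ∀ k, k ∈ J ↔ ∃ i, k ∈ l i := fun k => by
    have h2 := hl1 k
    constructor
    · intro hk
      rw [if_pos hk] at h2
      by_contra! hno
      rw [Finset.sum_eq_zero fun i _ => List.count_eq_zero.2 (hno i)] at h2
      omega
    · rintro ⟨i, hi⟩
      by_contra hk
      rw [if_neg hk, Finset.sum_eq_zero_iff] at h2
      exact List.count_eq_zero.1 (h2 i (Finset.mem_univ i)) hi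
  have hcoef : ∀ i : B, ∃ c : ℂ, monomial f (v i) (l i)
      = c • treeVec f (χ i) (v i) S i (l i).toFinset := fun i => by
    refine (hspec i _).exists_smul _ ?_
    have h2 := hc.monomial_mem (hv i) (l i)
    rw [theta_eq_rootComb]
    convert h2 using 5 with k
    have h3 := hle i k
    split_ifs with hk
    · have h4 := List.count_pos_iff.2 (List.mem_toFinset.1 hk)
      have h5 : (l i).count k = 1 := by omega
      symm
      convert h5
    · rw [List.mem_toFinset] at hk
      rw [← List.count_eq_zero.2 hk]
      convert rfl
  choose c hcoef using hcoef
  rw [SetLike.mem_coe]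
  change (tprod ℂ fun i => monomial f (v i) (l i)) ∈ _
  simp only [hcoef]
  rw [MultilinearMap.map_smul_univ]
  refine Submodule.smul_mem _ _ ?_
  by_cases hsub : ∀ i : B, IsSubtree (dynkinGraph b) S i (l i).toFinset
  · let o : b.support → Option b.support := fun k =>
      if h : ∃ i, k ∈ l i then some h.choose.1 else none
    have ho : ∀ (i : B) k, o k = some i.1 ↔ k ∈ l i := fun i k => by
      by_cases h : ∃ i, k ∈ l i
      · have h2 : o k = some h.choose.1 := dif_pos h
        rw [h2, Option.some_inj, Subtype.val_inj]
        exact ⟨fun h3 => h3 ▸ h.choose_spec, fun h3 => huniq _ _ k h.choose_spec h3⟩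
      · have h2 : o k = none := dif_neg h
        rw [h2]
        simp only [reduceCtorEq, false_iff]
        exact fun h3 => h ⟨i, h3⟩
    have hfib : ∀ i : B, fiber o i = (l i).toFinset := fun i => by
      ext k
      rw [mem_fiber, ho, List.mem_toFinset]
    refine Submodule.subset_span ⟨o, ⟨isValid_iff.2 fun i => ?_, fun k => ?_⟩, ?_⟩
    · by_cases hi : i ∈ B
      · have := hsub ⟨i, hi⟩
        rwa [← hfib] at this
      · intro k hk
        exfalso
        rw [mem_fiber] at hk
        by_cases h : ∃ i, k ∈ l i
        · have h2 : o k = some h.choose.1 := dif_pos h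
          rw [h2, Option.some_inj] at hk
          exact hi (hk ▸ h.choose.2)
        · have h2 : o k = none := dif_neg h
          rw [h2] at hk
          simp at hk
    · rw [hmem]
      by_cases h : ∃ i, k ∈ l i
      · have h2 : o k = some h.choose.1 := dif_pos h
        simp [h2, h]
      · have h2 : o k = none := dif_neg h
        simp only [h2, h, ne_eq, not_true_eq_false]
    · rw [tensorVec]
      simp only [hfib]
  · push Not at hsub
    obtain ⟨i, hi⟩ := hsub
    rw [MultilinearMap.map_coord_zero _ i (treeVec_of_not_isSubtree hi)]
    exact zero_mem _

end TensorVectors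

section TensorKernel

set_option linter.unusedSectionVars false

open LieAlgebra LieAlgebra.IsKilling LieModule Module PiTensorProduct

variable {L : Type*} [LieRing L] [LieAlgebra ℂ L] [FiniteDimensional ℂ L] [LieAlgebra.IsSimple ℂ L]
  {H : LieSubalgebra ℂ L} [H.IsCartanSubalgebra] {b : (rootSystem H).Base}
  [DecidableEq b.support] {B S : Finset b.support}
  {V : B → Type*} [∀ i, AddCommGroup (V i)] [∀ i, Module ℂ (V i)]
  [∀ i, LieRingModule L (V i)] [∀ i, LieModule ℂ L (V i)]

variable {e f : b.support → L} {χ : B → Dual ℂ H} {v : ∀ i, V i}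

theorem tensorVec_eq_zero {o : b.support → Option b.support}
    (ho : ¬ IsValid (dynkinGraph b) S o) (hoB : ∀ k i, o k = some i → i ∈ B) :
    tensorVec f χ v S o = 0 := by
  rw [isValid_iff] at ho
  push Not at ho
  obtain ⟨i, hi⟩ := ho
  have hiB : i ∈ B := by
    by_contra h
    exact hi fun k hk => absurd (hoB k i (mem_fiber.1 hk)) h
  exact MultilinearMap.map_coord_zero _ (⟨i, hiB⟩ : B) (treeVec_of_not_isSubtree hi)

/-- A partition that extends to `J` by giving `k` to `i` is defined on `J \ {k}`. -/
theorem HasDom.of_update {I : Type*} [Fintype I] [DecidableEq I] {J : Finset I}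
    {o : I → Option I} {k i : I}
    (hok : o k = none) (hd : HasDom (Function.update o k (some i)) J) : HasDom o (J.erase k) := by
  have h1 := hd.update_none k
  rwa [Function.update_idem, ← hok, Function.update_eq_self] at h1

/-- The linear combination of the vectors attached to partitions, with the coefficients `x`. -/
def tensorMap (f : b.support → L) (χ : B → Dual ℂ H) (v : ∀ i, V i) (S : Finset b.support) :
    ((b.support → Option b.support) → ℂ) →ₗ[ℂ] ⨂[ℂ] i, V i :=
  Fintype.linearCombination ℂ (tensorVec f χ v S)

theorem tensorMap_apply (x : (b.support → Option b.support) → ℂ) :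
    tensorMap f χ v S x = ∑ o, x o • tensorVec f χ v S o :=
  Fintype.linearCombination_apply ℂ _ x

/-- The vectors attached to partitions are linearly independent. -/
theorem tensorMap_eq_zero (hT : (dynkinGraph b).IsTree) (hc : IsChevalley b e f)
    (hspec : ∀ (i : B) (K : Finset b.support), TreeVecSpec e f (χ i) (v i) S i K)
    (hv : ∀ i, v i ∈ wtSpace (V i) (χ i)) (hv0 : ∀ i, v i ≠ 0) (hSB : S ⊆ B)
    {x : (b.support → Option b.support) → ℂ}
    (hx : ∀ o, ¬ IsValid (dynkinGraph b) S o → x o = 0) (h0 : tensorMap f χ v S x = 0) :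
    x = 0 := by
  funext o
  by_cases ho : IsValid (dynkinGraph b) S o
  · obtain ⟨Φ, h1, h2⟩ := exists_dual_tensorVec hT hc hspec hv hv0 hSB ho
    have h3 := congrArg Φ h0
    rw [tensorMap_apply, map_sum, Finset.sum_eq_single o, map_smul, h1, map_zero] at h3
    · simpa using h3
    · intro o' _ hne
      by_cases ho' : IsValid (dynkinGraph b) S o'
      · rw [map_smul, h2 o' ho' hne, smul_zero]
      · rw [hx o' ho', zero_smul, map_zero]
    · simp
  · exact hx o ho

/-- The coefficients of a vector of weight `λ - ϑ_J` vanish outside of the partitions of `J`. -/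
def partitionSupported (b : (rootSystem H).Base) (S J : Finset b.support) :
    Submodule ℂ ((b.support → Option b.support) → ℂ) where
  carrier := {x | ∀ o, ¬ (IsValid (dynkinGraph b) S o ∧ HasDom o J) → x o = 0}
  add_mem' := fun hx hy o ho => by rw [Pi.add_apply, hx o ho, hy o ho, add_zero]
  zero_mem' := fun _ _ => rfl
  smul_mem' := fun c x hx o ho => by rw [Pi.smul_apply, hx o ho, smul_zero]

variable {J : Finset b.support} {x : (b.support → Option b.support) → ℂ}

theorem tensorMap_mem (hT : (dynkinGraph b).IsTree) (hc : IsChevalley b e f)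
    (hv : ∀ i, v i ∈ wtSpace (V i) (χ i)) (hSB : S ⊆ B) (hx : x ∈ partitionSupported b S J) :
    tensorMap f χ v S x ∈ wtSpace (⨂[ℂ] i, V i) (∑ i, χ i - theta b J) := by
  rw [tensorMap_apply]
  refine Submodule.sum_mem _ fun o _ => ?_
  by_cases ho : IsValid (dynkinGraph b) S o ∧ HasDom o J
  · exact Submodule.smul_mem _ _ (tensorVec_mem hT hc hv hSB ho.1 ho.2)
  · rw [hx o ho, zero_smul]
    exact zero_mem _

theorem lie_e_tensorMap_of_notMem
    (hspec : ∀ (i : B) (K : Finset b.support), TreeVecSpec e f (χ i) (v i) S i K)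
    (hx : x ∈ partitionSupported b S J) {k : b.support} (hk : k ∉ J) :
    ⁅e k, tensorMap f χ v S x⁆ = 0 := by
  rw [tensorMap_apply, lie_sum]
  refine Finset.sum_eq_zero fun o _ => ?_
  rw [lie_smul]
  by_cases ho : IsValid (dynkinGraph b) S o ∧ HasDom o J
  · rw [lie_e_tensorVec_of_eq_none hspec (ho.2.eq_none hk), smul_zero]
  · rw [hx o ho, zero_smul]

open scoped Classical in
/-- The effect of `e_k` on the coefficients: the coefficient of a partition `o` of `J \ {k}` in
the image is the sum of the coefficients of the partitions of `J` that extend `o`. -/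
def removeCoeff (S : Finset b.support) (k : b.support) (x : (b.support → Option b.support) → ℂ)
    (o : b.support → Option b.support) : ℂ :=
  if IsValid (dynkinGraph b) S o then
    (if o k = none then ∑ i, x (Function.update o k (some i)) else 0) else 0

theorem removeCoeff_smul (hSB : S ⊆ B) (hx : x ∈ partitionSupported b S J) (k : b.support)
    (o : b.support → Option b.support) :
    removeCoeff S k x o • tensorVec f χ v S o
      = (if o k = none then ∑ i, x (Function.update o k (some i)) else 0) •
        tensorVec f χ v S o := by
  rw [removeCoeff]
  by_cases ho : IsValid (dynkinGraph b) S o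
  · rw [if_pos ho]
  rw [if_neg ho, zero_smul]
  by_cases hok : o k = none
  · rw [if_pos hok]
    by_cases h : ∃ i, x (Function.update o k (some i)) ≠ 0
    · obtain ⟨i, hi⟩ := h
      have hval : IsValid (dynkinGraph b) S (Function.update o k (some i)) := by
        by_contra h
        exact hi (hx _ fun h' => h h'.1)
      rw [tensorVec_eq_zero ho fun m j hmj => ?_, smul_zero]
      have hmk : m ≠ k := fun h => by rw [h, hok] at hmj; simp at hmj
      exact hSB (hval m j (by rwa [Function.update_of_ne hmk])).1
    · push Not at h
      rw [Finset.sum_eq_zero fun i _ => h i, zero_smul]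
  · rw [if_neg hok, zero_smul]

theorem lie_e_tensorMap
    (hspec : ∀ (i : B) (K : Finset b.support), TreeVecSpec e f (χ i) (v i) S i K) (hSB : S ⊆ B)
    (hx : x ∈ partitionSupported b S J) {k : b.support} (hk : k ∈ J) :
    ⁅e k, tensorMap f χ v S x⁆ = tensorMap f χ v S (removeCoeff S k x) := by
  have h1 : ∀ o, ⁅e k, x o • tensorVec f χ v S o⁆
      = x o • tensorVec f χ v S (Function.update o k none) := by
    intro o
    refine (lie_smul (x o) (e k) (tensorVec f χ v S o)).trans ?_
    by_cases ho : IsValid (dynkinGraph b) S o ∧ HasDom o J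
    · exact congrArg (x o • ·) (lie_e_tensorVec hspec hSB ho.1 ((ho.2 k).2 hk))
    · rw [hx o ho, zero_smul, zero_smul]
  calc ⁅e k, tensorMap f χ v S x⁆ = ∑ o, x o • tensorVec f χ v S (Function.update o k none) := by
        rw [tensorMap_apply, lie_sum]
        exact Finset.sum_congr rfl fun o _ => h1 o
    _ = _ := sum_update_none k x (fun o hok => hx o fun ho => (ho.2 k).2 hk hok)
        (tensorVec f χ v S)
    _ = ∑ o, removeCoeff S k x o • tensorVec f χ v S o :=
        Finset.sum_congr rfl fun o _ => (removeCoeff_smul hSB hx k o).symm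
    _ = _ := (tensorMap_apply _).symm

theorem removeCoeff_eq_zero_iff (hx : x ∈ partitionSupported b S J) (k : b.support) :
    removeCoeff S k x = 0 ↔ ∀ o, IsValid (dynkinGraph b) S o → HasDom o (J.erase k) →
      ∑ i, x (Function.update o k (some i)) = 0 := by
  constructor
  · intro h o ho hd
    have h1 := congrFun h o
    rwa [removeCoeff, if_pos ho, if_pos (hd.eq_none (by simp))] at h1
  · intro h
    funext o
    rw [removeCoeff, Pi.zero_apply]
    split_ifs with ho hok
    · by_cases hd : HasDom o (J.erase k)
      · exact h o ho hd
      · exact Finset.sum_eq_zero fun i _ => hx _ fun hi => hd (hi.2.of_update hok)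
    · rfl
    · rfl

theorem map_partitionSupported (hc : IsChevalley b e f)
    (hspec : ∀ (i : B) (K : Finset b.support), TreeVecSpec e f (χ i) (v i) S i K)
    (hv : ∀ i, v i ∈ wtSpace (V i) (χ i))
    (hspan : ∀ i, ∀ m : V i, m ∈ Submodule.span ℂ (Set.range (monomial f (v i))))
    {w : ⨂[ℂ] i, V i} (hw : w ∈ wtSpace (⨂[ℂ] i, V i) (∑ i, χ i - theta b J)) :
    ∃ x ∈ partitionSupported b S J, tensorMap f χ v S x = w := by
  classical
  have hle : Submodule.span ℂ (tensorVec f χ v S ''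
      {o | IsValid (dynkinGraph b) S o ∧ HasDom o J})
      ≤ (partitionSupported b S J).map (tensorMap f χ v S) := by
    rw [Submodule.span_le]
    rintro _ ⟨o, ho, rfl⟩
    refine ⟨Pi.single o 1, fun o' ho' =>
      Pi.single_eq_of_ne (fun h => ho' (by rw [h]; exact ho)) _, ?_⟩
    rw [tensorMap_apply, Finset.sum_eq_single o, Pi.single_eq_same, one_smul]
    · intro o' _ hne
      rw [Pi.single_eq_of_ne hne, zero_smul]
    · simp
  exact hle (mem_span_tensorVec hc hspec hv hspan hw)

/-- The highest weight vectors of weight `λ - ϑ_J` in the tensor product are described by the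
combinatorial equations that define `extensionKernel`. -/
theorem finrank_hwVectors (hT : (dynkinGraph b).IsTree) (hc : IsChevalley b e f)
    (hspec : ∀ (i : B) (K : Finset b.support), TreeVecSpec e f (χ i) (v i) S i K)
    (hv : ∀ i, v i ∈ wtSpace (V i) (χ i)) (hv0 : ∀ i, v i ≠ 0)
    (hspan : ∀ i, ∀ m : V i, m ∈ Submodule.span ℂ (Set.range (monomial f (v i))))
    (hSB : S ⊆ B) (J : Finset b.support) :
    finrank ℂ (hwVectors e (∑ i, χ i - theta b J) (⨂[ℂ] i, V i))
      = finrank ℂ (extensionKernel (dynkinGraph b) S J) := by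
  have hmem : ∀ x : extensionKernel (dynkinGraph b) S J,
      tensorMap f χ v S x.1 ∈ hwVectors e (∑ i, χ i - theta b J) (⨂[ℂ] i, V i) := by
    rintro ⟨x, hx, hx'⟩
    refine mem_hwVectors.2 ⟨tensorMap_mem hT hc hv hSB hx, fun k => ?_⟩
    by_cases hk : k ∈ J
    · have h1 : removeCoeff S k x = 0 := (removeCoeff_eq_zero_iff hx k).2 (hx' k hk)
      have h2 : tensorMap f χ v S (removeCoeff S k x) = 0 := by
        rw [h1]
        exact LinearMap.map_zero _
      exact (lie_e_tensorMap hspec hSB hx hk).trans h2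
    · exact lie_e_tensorMap_of_notMem hspec hx hk
  let Ψ : extensionKernel (dynkinGraph b) S J →ₗ[ℂ]
      hwVectors e (∑ i, χ i - theta b J) (⨂[ℂ] i, V i) :=
    (tensorMap f χ v S ∘ₗ (extensionKernel (dynkinGraph b) S J).subtype).codRestrict _ hmem
  refine (LinearEquiv.ofBijective Ψ ⟨?_, ?_⟩).finrank_eq.symm
  · rw [injective_iff_map_eq_zero]
    intro x hx
    exact Subtype.ext (tensorMap_eq_zero hT hc hspec hv hv0 hSB
      (fun o ho => x.2.1 o fun h => ho h.1) (congrArg Subtype.val hx))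
  · rintro ⟨w, hw⟩
    obtain ⟨hw1, hw2⟩ := mem_hwVectors.1 hw
    have hex := map_partitionSupported hc hspec hv hspan hw1
    obtain ⟨x, hx, hxw⟩ := hex
    have hx0 : ∀ k ∈ J, removeCoeff S k x = 0 := by
      intro k hk
      have h1 : tensorMap f χ v S (removeCoeff S k x) = 0 :=
        (lie_e_tensorMap hspec hSB hx hk).symm.trans
          ((congrArg (fun w : ⨂[ℂ] i, V i => ⁅e k, w⁆) hxw).trans (hw2 k))
      have h2 : ∀ o, ¬ IsValid (dynkinGraph b) S o → removeCoeff S k x o = 0 := by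
        intro o ho
        rw [removeCoeff, if_neg ho]
      exact tensorMap_eq_zero hT hc hspec hv hv0 hSB h2 h1
    have hker : x ∈ extensionKernel (dynkinGraph b) S J :=
      ⟨hx, fun k hk => (removeCoeff_eq_zero_iff hx k).1 (hx0 k hk)⟩
    exact ⟨⟨x, hker⟩, Subtype.ext hxw⟩

end TensorKernel

/-! ### Connected hulls of sets of leaves -/

section Hull

set_option linter.unusedSectionVars false

variable {I : Type*} [DecidableEq I] {G : SimpleGraph I} [DecidableRel G.Adj] [Fintype I]

theorem one_le_degIn_of_preconnected {M : Finset I}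
    (hM : (G.induce (M : Set I)).Preconnected) {k l : I} (hk : k ∈ M) (hl : l ∈ M)
    (hkl : k ≠ l) : 1 ≤ degIn G M k := by
  obtain ⟨p⟩ := hM ⟨k, hk⟩ ⟨l, hl⟩
  cases p with
  | nil => exact absurd rfl hkl
  | @cons _ m _ h _ =>
    exact Finset.card_pos.2 ⟨m.1, Finset.mem_filter.2 ⟨m.2, h⟩⟩

/-- For a set `T` of at least two leaves, the multiplicity space attached to the minimal connected
superset `M` of `T` has dimension `#T - 1`. -/
theorem IsPositiveGraph.finrank_extensionKernel (hG : IsPositiveGraph G) (hc : G.Connected)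
    {S T M : Finset I} (hS : ∀ i ∈ S, degIn G Finset.univ i ≤ 1) (hTS : T ⊆ S) (hT : 2 ≤ T.card)
    (hTM : T ⊆ M) (hM : (G.induce (M : Set I)).Preconnected)
    (hdeg : ∀ k ∈ M, k ∉ T → 2 ≤ degIn G M k) :
    Module.finrank ℂ (extensionKernel G S M) + 1 = T.card := by
  have hle : ∀ i ∈ S, degIn G M i ≤ 1 := fun i hi =>
    (degIn_mono (Finset.subset_univ M) i).trans (hS i hi)
  have hMS : M ∩ S = T := by
    refine Finset.Subset.antisymm (fun k hk => ?_) (Finset.subset_inter hTM hTS)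
    obtain ⟨hkM, hkS⟩ := Finset.mem_inter.1 hk
    by_contra hkT
    exact absurd ((hdeg k hkM hkT).trans (hle k hkS)) (by norm_num)
  have hone : ∀ k ∈ T, degIn G M k = 1 := by
    intro k hk
    obtain ⟨l, hl, hlk⟩ := Finset.exists_mem_ne (show 1 < T.card by omega) k
    exact le_antisymm (hle k (hTS hk))
      (one_le_degIn_of_preconnected hM (hTM hk) (hTM hl) hlk.symm)
  have hT3 : T.card ≤ 3 := hG.card_leaves_le hc fun i hi => hS i (hTS hi)
  obtain ⟨c, hcM, hc2⟩ := hG.exists_center hTM hT hT3 hdeg hone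
  obtain ⟨leg, hstar⟩ := exists_isStar (hG.isTree hc) hTM hcM hM hone hc2
  rw [← hMS] at hstar
  rw [hstar.finrank_extensionKernel (hG.isTree hc) (by
    rw [hMS]
    exact Finset.card_pos.1 (by omega)), hMS]

end Hull

section Multiplicity

open LieAlgebra LieAlgebra.IsKilling LieModule Module

variable {L : Type*} [LieRing L] [LieAlgebra ℂ L] [FiniteDimensional ℂ L] [LieAlgebra.IsSimple ℂ L]
  {H : LieSubalgebra ℂ L} [H.IsCartanSubalgebra] (b : (rootSystem H).Base)

open scoped Classical in
theorem isPositiveGraph_dynkinGraph : IsPositiveGraph (dynkinGraph b) := by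
  intro x hx hx0
  convert dynkinGraph_pos b x hx hx0

open scoped Classical in
theorem degIn_le_one_of_mem_boundary {i : b.support} (hi : i ∈ boundary b) :
    degIn (dynkinGraph b) Finset.univ i ≤ 1 := by
  rw [boundary, Finset.mem_filter] at hi
  exact hi.2

open scoped Classical in
/-- A connected set `M ⊇ T` is the hull of `T` if all its vertices outside `T` have at least two
neighbours in `M`, since then every connected set containing `T` contains `M`. -/
theorem hull_eq {T M : Finset b.support} (hTM : T ⊆ M) (hM : IsConnectedSubdiagram b M)
    (hdeg : ∀ k ∈ M, k ∉ T → 2 ≤ degIn (dynkinGraph b) M k) : hull b T = M := by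
  ext i
  rw [hull, Finset.mem_filter]
  refine ⟨fun h => h.2 M hTM hM, fun hi => ⟨Finset.mem_univ _, fun K hTK hK => ?_⟩⟩
  exact (isPositiveGraph_dynkinGraph b).subset_of_preconnected hdeg
    (Finset.inter_subset_right.trans hTK) hK hi

theorem hull_empty : hull b ∅ = ∅ := by
  classical
  exact hull_eq b (Finset.Subset.refl _) (fun i => absurd i.2 (by simp)) (by simp)

open scoped Classical in
theorem exists_hull (T : Finset b.support) :
    T ⊆ hull b T ∧ IsConnectedSubdiagram b (hull b T) ∧
      ∀ k ∈ hull b T, k ∉ T → 2 ≤ degIn (dynkinGraph b) (hull b T) k := by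
  obtain ⟨M, h1, h2, h3⟩ := (isPositiveGraph_dynkinGraph b).exists_connected_superset
    (dynkinGraph_connected b) T
  rw [hull_eq b h1 h2 h3]
  exact ⟨h1, h2, h3⟩

/-! ### Reduction of the multiplicity to highest weight vectors -/

open scoped Classical in
theorem fundamentalWeight_coroot (i j : b.support) :
    fundamentalWeight b i ((rootSystem H).coroot j) = if j = i then 1 else 0 := by
  rw [fundamentalWeight, Basis.coord_apply, RootPairing.Base.toCoweightBasis_repr_coroot,
    Finsupp.single_apply]

open scoped Classical in
theorem sum_fundamentalWeight {lam : Dual ℂ H} (hsupp : supp b lam ⊆ boundary b) :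
    ∑ i : boundary b, lam ((rootSystem H).coroot i.1) • fundamentalWeight b i.1 = lam := by
  refine b.toCoweightBasis.ext fun j => ?_
  rw [RootPairing.Base.toCoweightBasis_apply, LinearMap.sum_apply]
  simp only [LinearMap.smul_apply, fundamentalWeight_coroot]
  by_cases hj : j ∈ boundary b
  · rw [Finset.sum_eq_single (⟨j, hj⟩ : boundary b)]
    · simp
    · intro i _ hi
      rw [if_neg fun h => hi (Subtype.ext h.symm), smul_zero]
    · simp
  · rw [Finset.sum_eq_zero]
    · by_contra h
      exact hj (hsupp (Finset.mem_filter.2 ⟨Finset.mem_univ _, Ne.symm h⟩))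
    · intro i _
      rw [if_neg fun h : j = i.1 => hj (by rw [h]; exact i.2), smul_zero]

variable {b}

theorem IsIrreducibleOfHighestWeight.exists_mem_hwVectors {e f : b.support → L}
    (hc : IsChevalley b e f) {wt : Dual ℂ H} {V : Type*} [AddCommGroup V] [Module ℂ V]
    [LieRingModule L V] [LieModule ℂ L V] (hV : IsIrreducibleOfHighestWeight b wt V) :
    ∃ v ∈ hwVectors e wt V, v ≠ 0 := by
  obtain ⟨v, hv0, hvw, hve⟩ := hV.exists_vector
  exact ⟨v, mem_hwVectors.2 ⟨mem_wtSpace.2 hvw, fun i => hve i.1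
    (RootPairing.Base.isPos_of_mem_support i.2) _ (hc.e_mem i)⟩, hv0⟩

/-- If the multiplicity of `μ` is nonzero, then `λ - μ` is a sum of simple roots. For `μ = λ - ϑ_J`
the multiplicity is the dimension of `extensionKernel`. -/
theorem multiplicity_tensor {lam mu : Dual ℂ H} (hsupp : supp b lam ⊆ boundary b)
    (V : boundary b → Type*)
    [∀ i, AddCommGroup (V i)] [∀ i, Module ℂ (V i)] [∀ i, FiniteDimensional ℂ (V i)]
    [∀ i, LieRingModule L (V i)] [∀ i, LieModule ℂ L (V i)]
    (hV : ∀ i : boundary b, IsIrreducibleOfHighestWeight b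
      (lam ((rootSystem H).coroot i.1) • fundamentalWeight b i.1) (V i))
    (Vmu : Type*) [AddCommGroup Vmu] [Module ℂ Vmu] [FiniteDimensional ℂ Vmu]
    [LieRingModule L Vmu] [LieModule ℂ L Vmu]
    (hVmu : IsIrreducibleOfHighestWeight b mu Vmu) :
    (multiplicity L Vmu (⨂[ℂ] i, V i) ≠ 0 → ∃ n, mu = lam - rootComb b n) ∧
    open scoped Classical in
    ∀ J, mu = lam - theta b J → multiplicity L Vmu (⨂[ℂ] i, V i)
      = finrank ℂ (extensionKernel (dynkinGraph b) (supp b lam) J) := by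
  classical
  have hT := (isPositiveGraph_dynkinGraph b).isTree (dynkinGraph_connected b)
  obtain ⟨e, f, hc⟩ := exists_isChevalley b
  choose v hv hv0 using fun i => (hV i).exists_mem_hwVectors hc
  obtain ⟨u, hu, hu0⟩ := hVmu.exists_mem_hwVectors hc
  have := hVmu.irreducible
  have hirr := fun i => (hV i).irreducible
  have hvw := fun i => (mem_hwVectors.1 (hv i)).1
  have hspan : ∀ i, ∀ m : V i, m ∈ Submodule.span ℂ (Set.range (monomial f (v i))) := fun i =>
    hc.monomialSpan_eq_top (hvw i) (mem_hwVectors.1 (hv i)).2 (hv0 i)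
  have hspec : ∀ (i : boundary b) (K : Finset b.support), TreeVecSpec e f
      (lam ((rootSystem H).coroot i.1) • fundamentalWeight b i.1) (v i) (supp b lam) i K := by
    intro i K
    refine treeVecSpec hT hc ?_ ?_ (hv i) (hv0 i) K
    · intro j hj
      rw [LinearMap.smul_apply, fundamentalWeight_coroot, if_neg hj, smul_zero]
    · rw [LinearMap.smul_apply, fundamentalWeight_coroot, if_pos rfl, smul_eq_mul, mul_one, supp,
        Finset.mem_filter]
      exact ⟨fun h => ⟨Finset.mem_univ _, h⟩, fun h => h.2⟩
  have hmult : multiplicity L Vmu (⨂[ℂ] i, V i) = finrank ℂ (hwVectors e mu (⨂[ℂ] i, V i)) :=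
    hc.finrank_hom hu hu0
  have hsum := sum_fundamentalWeight b hsupp
  constructor
  · intro h
    rw [hmult] at h
    have hne : hwVectors e mu (⨂[ℂ] i, V i) ≠ ⊥ := fun h0 => h (by rw [h0, finrank_bot])
    obtain ⟨w, hw, hw0⟩ := Submodule.exists_mem_ne_zero_of_ne_bot hne
    have hex := exists_rootComb_of_wtSpace hc hvw hspan (mem_hwVectors.1 hw).1 hw0
    rwa [hsum] at hex
  · intro J hJ
    have h1 := finrank_hwVectors hT hc hspec hvw hv0 hspan hsupp J
    rw [hsum, ← hJ] at h1
    exact hmult.trans h1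

/-- A sum of simple roots in which every simple root has coefficient at most `1` is `ϑ_J` for a set
`J` of nodes. -/
theorem exists_theta_of_rootComb {lam mu : Dual ℂ H} {s : b.support → ℤ}
    (hs : lam - mu = ∑ i, s i • (rootSystem H).root i) (hs1 : ∀ i, s i ≤ 1)
    {n : b.support → ℕ} (hn : mu = lam - rootComb b n) : ∃ J, mu = lam - theta b J := by
  classical
  have h1 : ∑ i, (s i : ℂ) • (rootSystem H).root i
      = ∑ i : b.support, (n i : ℂ) • (rootSystem H).root i := by
    have h2 : lam - mu = rootComb b n := by rw [hn, sub_sub_cancel]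
    rw [rootComb, hs] at h2
    simpa only [Int.cast_smul_eq_zsmul, Nat.cast_smul_eq_nsmul] using h2
  have h3 : ∀ i, s i = n i := fun i => by
    have h4 := Fintype.linearIndependent_iff.1 (linearIndependent_root b)
      (fun i => (s i : ℂ) - n i) (by simp only [sub_smul, Finset.sum_sub_distrib, h1, sub_self]) i
    exact_mod_cast sub_eq_zero.1 h4
  refine ⟨Finset.univ.filter fun i => n i = 1, ?_⟩
  rw [hn, theta_eq_rootComb]
  congr 2
  funext i
  have h5 := hs1 i
  have h6 := h3 i
  split_ifs with h
  · exact (Finset.mem_filter.1 h).2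
  · have h7 : n i ≠ 1 := fun h8 => h (Finset.mem_filter.2 ⟨Finset.mem_univ _, h8⟩)
    omega

end Multiplicity

end OuterMult

end

open OuterMult LieAlgebra.IsKilling in
theorem proposition3p2
    {L : Type*} [LieRing L] [LieAlgebra ℂ L] [FiniteDimensional ℂ L] [LieAlgebra.IsSimple ℂ L]
    (H : LieSubalgebra ℂ L) [H.IsCartanSubalgebra] (b : (rootSystem H).Base)
    (lam mu : Module.Dual ℂ H) (hlam : IsDominant b lam) (hmu : IsDominant b mu)
    (hsupp : supp b lam ⊆ boundary b)
    (s : b.support → ℤ) (hs : lam - mu = ∑ i, s i • (rootSystem H).root i) (hs1 : ∀ i, s i ≤ 1)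
    (V : boundary b → Type*)
    [∀ i, AddCommGroup (V i)] [∀ i, Module ℂ (V i)] [∀ i, FiniteDimensional ℂ (V i)]
    [∀ i, LieRingModule L (V i)] [∀ i, LieModule ℂ L (V i)]
    (hV : ∀ i : boundary b, IsIrreducibleOfHighestWeight b
      (lam ((rootSystem H).coroot i.1) • fundamentalWeight b i.1) (V i))
    (Vmu : Type*) [AddCommGroup Vmu] [Module ℂ Vmu] [FiniteDimensional ℂ Vmu]
    [LieRingModule L Vmu] [LieModule ℂ L Vmu]
    (hVmu : IsIrreducibleOfHighestWeight b mu Vmu) :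
    (multiplicity L Vmu (⨂[ℂ] i, V i) ≠ 0 ↔
      ∃ S ⊆ supp b lam, S.card ≠ 1 ∧ mu = lam - theta b (hull b S)) ∧
    ∀ S ⊆ supp b lam, S.card ≠ 1 → mu = lam - theta b (hull b S) →
      (S.card < 3 → multiplicity L Vmu (⨂[ℂ] i, V i) = 1) ∧
      (S.card = 3 → multiplicity L Vmu (⨂[ℂ] i, V i) = 2) := by
  classical
  have hG := isPositiveGraph_dynkinGraph b
  have hconn := dynkinGraph_connected b
  have hleaf : ∀ i ∈ supp b lam, degIn (dynkinGraph b) Finset.univ i ≤ 1 := fun i hi =>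
    degIn_le_one_of_mem_boundary b (hsupp hi)
  obtain ⟨hexp, hker⟩ := multiplicity_tensor hsupp V hV Vmu hVmu
  have hval : ∀ S ⊆ supp b lam, mu = lam - theta b (hull b S) →
      (S.card = 0 → multiplicity L Vmu (⨂[ℂ] i, V i) = 1) ∧
      (2 ≤ S.card → multiplicity L Vmu (⨂[ℂ] i, V i) + 1 = S.card) := by
    intro S hS hmuS
    rw [hker _ hmuS]
    refine ⟨fun h0 => ?_, fun h2 => ?_⟩
    · rw [Finset.card_eq_zero.1 h0, hull_empty, finrank_extensionKernel_empty]
    · obtain ⟨h3, h4, h5⟩ := exists_hull b S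
      exact hG.finrank_extensionKernel hconn hleaf hS h2 h3 h4 h5
  refine ⟨⟨fun hne => ?_, ?_⟩, fun S hS h1 hmuS => ?_⟩
  · obtain ⟨n, hn⟩ := hexp hne
    obtain ⟨J, hJ⟩ := exists_theta_of_rootComb hs hs1 hn
    rw [hker J hJ] at hne
    obtain ⟨hd2, hd1⟩ := degIn_of_extensionKernel_ne_bot (hG.isTree hconn)
      (fun h => hne (by rw [h, finrank_bot]))
    rcases J.eq_empty_or_nonempty with rfl | hJne
    · exact ⟨∅, Finset.empty_subset _, by simp, by rw [hull_empty, hJ]⟩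
    · have h2 := hG.two_le_card_inter hJne hd2 hd1
      refine ⟨J ∩ supp b lam, Finset.inter_subset_right, by omega, ?_⟩
      rw [hull_eq b Finset.inter_subset_left
        (hG.preconnected_of_degIn (hG.card_leaves_le hconn hleaf) hd2 hd1) fun k hk hk' =>
          hd2 k hk fun h => hk' (Finset.mem_inter.2 ⟨hk, h⟩)]
      exact hJ
  · rintro ⟨S, hS, h1, hmuS⟩
    obtain ⟨h3, h4⟩ := hval S hS hmuS
    rcases Nat.eq_zero_or_pos S.card with h0 | h0
    · rw [h3 h0]
      exact one_ne_zero
    · have := h4 (by omega)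
      omega
  · obtain ⟨h3, h4⟩ := hval S hS hmuS
    refine ⟨fun h => ?_, fun h => ?_⟩
    · rcases Nat.eq_zero_or_pos S.card with h0 | h0
      · exact h3 h0
      · have := h4 (by omega)
        omega
    · have := h4 (by omega)
      omega
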